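/- Let $X$ be a reflexive complex Banach space with dual $X^*$ and duality pairing $(x,f)=f(x)$, let $1<p<\infty$, $q=p/(p-1)$, and let $I=(a,b]$ with $-\infty\le a<b<\infty$, or $I=\mathbb{R}$. Let $A(t)$, $t\in I$, be linear operators on $X$, with Banach space adjoints $A(t)^*$ on $X^*$. Put $$F_p=\{u\in W^{1,p}_0(I,X): u(t)\in D(A(t))\text{ for a.e. }t\in I,\ A(\cdot)u(\cdot)\in L^p(I,X)\},$$ where the subscript $0$ means that $u$ vanishes at $a$ if $a>-\infty$ (elements of Sobolev spaces are identified with their continuous representatives), and $$F_q'=\{v\in W^{1,q}(I,X^*): v(t)\in D(A(t)^*)\text{ for a.e. }t\in I,\ A(\cdot)^*v(\cdot)\in L^q(I,X^*),\ v(b)=0\},$$ where the condition $v(b)=0$ is dropped if $I=\mathbb{R}$. Let $G_0=-\frac{d}{dt}+A(\cdot)$ in $L^p(I,X)$ with domain $F_p$ and $G_0'=\frac{d}{dt}+A(\cdot)^*$ in $L^q(I,X^*)$ with domain $F_q'$. Assume: (a) There are constants $M,w$ and $w'>w$ such that every $A(t)$ generates a strongly continuous semigroup; $(w,\infty)\subset\rho(A(t))$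 for $t\in I$, and $\|R(\lambda,A(t_k))\cdots R(\lambda,A(t_1))\|\le M(\lambda-w)^{-k}$ for all $\lambda>w$ and all $t_1\le\dots\le t_k$ in $I$ (Kato stability); $t\mapsto R(w',A(t))$ is strongly continuous on $I$; $(w'-G_0)F_p$ is dense in $L^p(I,X)$; and $F_p$ is dense in $L^p(I,X)$ and in $C_0(I,X)$. (b) The adjoints $A(t)^*$ satisfy the same conditions with time reversed, with possibly different constants: every $A(t)^*$ generates a strongly continuous semigroup on $X^*$; they are Kato-stable for products in the reversed time order; $t\mapsto R(w',A(t)^*)$ is strongly continuous on $I$ for some $w'$ larger than the stability exponent; for this $w'$, $(w'-G_0')F_q'$ is dense in $L^q(I,X^*)$; and $F_q'$ is dense in $L^q(I,X^*)$ and in $C_0([a,b),X^*)$ (in $C_0((-\infty,b),X^*)$ if $a=-\infty$, and in $C_0(\mathbb{R},X^*)$ if $I=\mathbb{R}$). Then $G_0$ has a closure in $L^p(I,X)$ which generates the evolution semigroup $(T(\sigma)f)(t)=U(t,t-\sigma)f(t-\sigma)$ if $t-\sigma\in I$, and $(T(\sigma)f)(t)=0$ otherwise, of a strongly continuous, exponentially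 bounded evolution family $U(t,s)$, $t\ge s$ in $I$. For every such $U$, every $s\in I$ and every $x\in X$, the following holds. (i) If $I=(a,b]$, then $u=U(\cdot,s)x$ is the one and only function $u\in C([s,b],X)$ with $u(s)=x$ and $$\int_s^b\bigl(u(\tau),\dot v(\tau)+A(\tau)^*v(\tau)\bigr)\,d\tau=-(x,v(s))\qquad\text{for all }v\in F_q'.$$ (ii) If $I=\mathbb{R}$ and all $U(t,s)$ are invertible, set $U(t,s)=U(s,t)^{-1}$ for $t<s$. Then $u=U(\cdot,s)x$ is the one and only function $u\in C(\mathbb{R},X)$ with $u(s)=x$ and $$\int_{\mathbb{R}}\bigl(u(\tau),\dot v(\tau)+A(\tau)^*v(\tau)\bigr)\,d\tau=0\qquad\text{for all }v\in F_q'\cap C_c(\mathbb{R},X^*).$$ -/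

import Mathlib

open MeasureTheory Set Filter Topology
open scoped ENNReal ZeroAtInfty

noncomputable section

namespace EvolutionEquation

/-! ### Semigroups, generators, resolvents, adjoints -/

section Operators

variable {Y : Type*} [NormedAddCommGroup Y] [NormedSpace ℂ Y]

/-- `T` (restricted to `[0, ∞)`) is a strongly continuous one-parameter semigroup of bounded
operators. -/
structure IsC0Semigroup (T : ℝ → Y →L[ℂ] Y) : Prop where
  map_zero : T 0 = 1
  map_add : ∀ s t : ℝ, 0 ≤ s → 0 ≤ t → T (s + t) = T s ∘L T t
  strongly_continuous : ∀ y : Y, ContinuousOn (fun t => T t y) (Ici 0)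

/-- `y ∈ D(G)` and `G y = z`, where `G` is the generator of the semigroup `T`:
the right derivative at `0` of the orbit of `y` exists and is equal to `z`. -/
def GeneratorRel (T : ℝ → Y →L[ℂ] Y) (y z : Y) : Prop :=
  Tendsto (fun h : ℝ => (h : ℂ)⁻¹ • (T h y - y)) (𝓝[>] 0) (𝓝 z)

/-- The (unbounded) operator `A` is the generator of some strongly continuous semigroup. -/
def IsGenerator (A : Y →ₗ.[ℂ] Y) : Prop :=
  ∃ T : ℝ → Y →L[ℂ] Y, IsC0Semigroup T ∧ ∀ y z : Y, (y, z) ∈ A.graph ↔ GeneratorRel T y z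

/-- `R` is the bounded two-sided inverse of `c - A : D(A) → Y`. -/
def IsResolvent (A : Y →ₗ.[ℂ] Y) (c : ℂ) (R : Y →L[ℂ] Y) : Prop :=
  (∀ y : Y, (R y, c • R y - y) ∈ A.graph) ∧ ∀ y z : Y, (y, z) ∈ A.graph → R (c • y - z) = y

/-- The resolvent set `ρ(A)`. -/
def resolventSet (A : Y →ₗ.[ℂ] Y) : Set ℂ := {c | ∃ R : Y →L[ℂ] Y, IsResolvent A c R}

open Classical in
/-- The resolvent `R(c, A) = (c - A)⁻¹` for `c ∈ ρ(A)` (and `0` otherwise). -/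
def resolvent (c : ℂ) (A : Y →ₗ.[ℂ] Y) : Y →L[ℂ] Y :=
  if h : ∃ R : Y →L[ℂ] Y, IsResolvent A c R then h.choose else 0

theorem isResolvent_resolvent {A : Y →ₗ.[ℂ] Y} {c : ℂ} (h : c ∈ resolventSet A) :
    IsResolvent A c (resolvent c A) := by
  have h' : ∃ R : Y →L[ℂ] Y, IsResolvent A c R := h
  rw [resolvent, dif_pos h']
  exact h'.choose_spec

/-- Kato stability with constants `M, w` of the family `B(t)`, `t ∈ I`:
`(w, ∞) ⊆ ρ(B(t))` and `‖R(c, B(t₁)) ⋯ R(c, B(tₖ))‖ ≤ M (c - w)⁻ᵏ` for all `c > w` and all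
`t₁, …, tₖ ∈ I` with `tᵢ r tⱼ` for `i < j`. For `r = (· ≥ ·)` the products are time-ordered
(later times to the left), which is the condition for equations solved forward in time;
`r = (· ≤ ·)` is its mirror image, for equations solved backward in time. -/
def KatoStable (r : ℝ → ℝ → Prop) (I : Set ℝ) (B : ℝ → Y →ₗ.[ℂ] Y) (M w : ℝ) : Prop :=
  (∀ t ∈ I, ∀ c : ℝ, w < c → (c : ℂ) ∈ resolventSet (B t)) ∧
  ∀ l : List ℝ, (∀ t ∈ l, t ∈ I) → l.Pairwise r → ∀ c : ℝ, w < c →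
    ‖(l.map fun t => resolvent (c : ℂ) (B t)).prod‖ ≤ M * ((c - w) ^ l.length)⁻¹

/-- The graph of the Banach space adjoint: all `(f, g) ∈ Y* × Y*` with `f (A y) = g y` for every
`y ∈ D(A)`. -/
def adjointGraph (A : Y →ₗ.[ℂ] Y) : Submodule ℂ (StrongDual ℂ Y × StrongDual ℂ Y) where
  carrier := {fg | ∀ y z : Y, (y, z) ∈ A.graph → fg.1 z = fg.2 y}
  add_mem' := by
    intro a b ha hb y z h
    simp [ha y z h, hb y z h]
  zero_mem' := by
    intro y z _
    simp
  smul_mem' := by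
    intro c a ha y z h
    simp [ha y z h]

/-- The Banach space adjoint `A*`, an operator on the dual space `Y*`
(meaningful for densely defined `A`). -/
def adjoint (A : Y →ₗ.[ℂ] Y) : StrongDual ℂ Y →ₗ.[ℂ] StrongDual ℂ Y :=
  (adjointGraph A).toLinearPMap

theorem mem_graph_adjoint {A : Y →ₗ.[ℂ] Y} (hA : Dense (A.domain : Set Y))
    (f g : StrongDual ℂ Y) :
    (f, g) ∈ (adjoint A).graph ↔ ∀ y z : Y, (y, z) ∈ A.graph → f z = g y := by
  rw [adjoint, Submodule.toLinearPMap_graph_eq]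
  · rfl
  · rintro ⟨f, g⟩ h hf
    have hf0 : f = 0 := hf
    subst hf0
    have h2 : ∀ y ∈ (A.domain : Set Y), g y = 0 := by
      intro y hy
      have := h y (A ⟨y, hy⟩) (A.mem_graph ⟨y, hy⟩)
      simpa using this.symm
    have h3 : (g : Y → ℂ) = fun _ => 0 :=
      Continuous.ext_on hA g.continuous continuous_const h2
    ext y
    exact congrFun h3 y

end Operators

/-! ### Function spaces on the time interval -/

/-- The time intervals considered: `(a, b]` with `-∞ ≤ a < b < ∞`, and `ℝ`. -/
def IsTimeInterval (I : Set ℝ) : Prop :=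
  (∃ a b : ℝ, a < b ∧ I = Ioc a b) ∨ (∃ b : ℝ, I = Iic b) ∨ I = univ

section Spaces

variable {Y : Type*} [NormedAddCommGroup Y] [NormedSpace ℂ Y]

/-- `f` is the continuous representative of an element of the Sobolev space `W^{1,p}(I, Y)` and
`f'` represents its derivative: `f, f' ∈ L^p(I, Y)` and `f` is a primitive of `f'` on `I`. -/
def IsSobolev (I : Set ℝ) (p : ℝ≥0∞) (f f' : ℝ → Y) : Prop :=
  MemLp f p (volume.restrict I) ∧ MemLp f' p (volume.restrict I) ∧
    ∀ s ∈ I, ∀ t ∈ I, f t - f s = ∫ r in s..t, f' r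

/-- `u ∈ F_p`, with derivative `u'` and with `w = A(·)u(·)`: that is, `u ∈ W^{1,p}_0(I, Y)`
(`u` vanishes at the left end point of `I` if this is finite; at an infinite end point a
`W^{1,p}` function with `p < ∞` vanishes automatically),
`u(t) ∈ D(A(t))` for almost every `t ∈ I`, and `A(·)u(·) ∈ L^p(I, Y)`. -/
structure MemF (I : Set ℝ) (p : ℝ≥0∞) (A : ℝ → Y →ₗ.[ℂ] Y) (u u' w : ℝ → Y) : Prop where
  sobolev : IsSobolev I p u u'
  left_zero : ∀ a : ℝ, IsGLB I a → Tendsto u (𝓝[I] a) (𝓝 0)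
  memLp : MemLp w p (volume.restrict I)
  graph : ∀ᵐ t ∂(volume.restrict I), (u t, w t) ∈ (A t).graph

/-- `v ∈ F'_q`, with derivative `v'` and with `w = B(·)v(·)`: that is, `v ∈ W^{1,q}(I, Y)`,
`v(b) = 0` if `I` has the right end point `b` (no condition if `I = ℝ`),
`v(t) ∈ D(B(t))` for almost every `t ∈ I`, and `B(·)v(·) ∈ L^q(I, Y)`. -/
structure MemFBackward (I : Set ℝ) (q : ℝ≥0∞) (B : ℝ → Y →ₗ.[ℂ] Y) (v v' w : ℝ → Y) : Prop where
  sobolev : IsSobolev I q v v'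
  right_zero : ∀ b : ℝ, IsGreatest I b → v b = 0
  memLp : MemLp w q (volume.restrict I)
  graph : ∀ᵐ t ∂(volume.restrict I), (v t, w t) ∈ (B t).graph

/-- The mirror image of the interval `I` with respect to which end point is included:
`[a, b)` for `I = (a, b]`, and `ℝ` for `I = ℝ`. -/
def mirror (I : Set ℝ) : Set ℝ := closure I \ {b | IsGreatest I b}

/-- The assumptions on a family `A(t)`, `t ∈ I`, under which the closure of
`G₀ = -d/dt + A(·)` with domain `F_p` generates an evolution semigroup: the `A(t)` are Kato-stable
generators with constants `(M, w)`, the map `t ↦ R(w', A(t))` is strongly continuous for some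
`w' > w`, `(w' - G₀) F_p` is dense in `L^p(I, Y)`, and `F_p` is dense both in `L^p(I, Y)` and
in `C₀(I, Y)`. -/
def ForwardAssumptions (I : Set ℝ) (p : ℝ≥0∞) (A : ℝ → Y →ₗ.[ℂ] Y) : Prop :=
  ∃ M w w' : ℝ, w < w' ∧
    (∀ t ∈ I, IsGenerator (A t)) ∧
    KatoStable (· ≥ ·) I A M w ∧
    (∀ y : Y, ContinuousOn (fun t => resolvent (w' : ℂ) (A t) y) I) ∧
    (∀ g : ℝ → Y, MemLp g p (volume.restrict I) → ∀ ε : ℝ≥0∞, 0 < ε →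
      ∃ u u' z : ℝ → Y, MemF I p A u u' z ∧
        eLpNorm (fun t => ((w' : ℂ) • u t - (-u' t + z t)) - g t) p (volume.restrict I) < ε) ∧
    (∀ g : ℝ → Y, MemLp g p (volume.restrict I) → ∀ ε : ℝ≥0∞, 0 < ε →
      ∃ u u' z : ℝ → Y, MemF I p A u u' z ∧
        eLpNorm (fun t => u t - g t) p (volume.restrict I) < ε) ∧
    (∀ g : C₀(I, Y), ∀ ε : ℝ, 0 < ε →
      ∃ u u' z : ℝ → Y, MemF I p A u u' z ∧ ∀ t : I, ‖u t - g t‖ < ε)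

/-- The mirror image of `ForwardAssumptions` for the backward operator `G₀' = d/dt + B(·)` with
domain `F'_q`: the time direction is reversed, and `C₀((a, b], Y)` is replaced by
`C₀([a, b), Y)`. -/
def BackwardAssumptions (I : Set ℝ) (q : ℝ≥0∞) (B : ℝ → Y →ₗ.[ℂ] Y) : Prop :=
  ∃ M w w' : ℝ, w < w' ∧
    (∀ t ∈ I, IsGenerator (B t)) ∧
    KatoStable (· ≤ ·) I B M w ∧
    (∀ y : Y, ContinuousOn (fun t => resolvent (w' : ℂ) (B t) y) I) ∧
    (∀ g : ℝ → Y, MemLp g q (volume.restrict I) → ∀ ε : ℝ≥0∞, 0 < ε →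
      ∃ v v' z : ℝ → Y, MemFBackward I q B v v' z ∧
        eLpNorm (fun t => ((w' : ℂ) • v t - (v' t + z t)) - g t) q (volume.restrict I) < ε) ∧
    (∀ g : ℝ → Y, MemLp g q (volume.restrict I) → ∀ ε : ℝ≥0∞, 0 < ε →
      ∃ v v' z : ℝ → Y, MemFBackward I q B v v' z ∧
        eLpNorm (fun t => v t - g t) q (volume.restrict I) < ε) ∧
    (∀ g : C₀(mirror I, Y), ∀ ε : ℝ, 0 < ε →
      ∃ v v' z : ℝ → Y, MemFBackward I q B v v' z ∧
        ∀ t : mirror I, (t : ℝ) ∈ I → ‖v t - g t‖ < ε)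

end Spaces

/-! ### Evolution families and evolution semigroups -/

section EvolutionFamilies

variable {X : Type*} [NormedAddCommGroup X] [NormedSpace ℂ X]

/-- `U(t, s)`, `t ≥ s` in `I`, is a strongly continuous, exponentially bounded evolution family
(propagator). Values of `U` at other pairs are irrelevant. -/
structure IsEvolutionFamily (I : Set ℝ) (U : ℝ → ℝ → X →L[ℂ] X) : Prop where
  comp : ∀ t ∈ I, ∀ r ∈ I, ∀ s ∈ I, s ≤ r → r ≤ t → U t r ∘L U r s = U t s
  refl : ∀ t ∈ I, U t t = 1
  strongly_continuous : ∀ x : X, ContinuousOn (fun z : ℝ × ℝ => U z.1 z.2 x)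
    {z | z.1 ∈ I ∧ z.2 ∈ I ∧ z.2 ≤ z.1}
  exp_bounded : ∃ M w : ℝ, ∀ t ∈ I, ∀ s ∈ I, s ≤ t → ‖U t s‖ ≤ M * Real.exp (w * (t - s))

/-- The graph of `G₀ = -d/dt + A(·)` with domain `F_p`, as a subset of `L^p(I, X) × L^p(I, X)`. -/
def G0Graph (I : Set ℝ) (p : ℝ≥0∞) (A : ℝ → X →ₗ.[ℂ] X) :
    Set (Lp X p (volume.restrict I) × Lp X p (volume.restrict I)) :=
  {fg | ∃ u u' w : ℝ → X, MemF I p A u u' w ∧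
    fg.1 =ᵐ[volume.restrict I] u ∧ fg.2 =ᵐ[volume.restrict I] fun t => -u' t + w t}

/-- The operator `G₀` with domain `F_p` has a closure in `L^p(I, X)`, and this closure generates
the evolution semigroup `(T(σ)f)(t) = U(t, t - σ) f(t - σ)` if `t - σ ∈ I`, and `0` otherwise,
given by the evolution family `U`. -/
def IsGeneratedBy (I : Set ℝ) (p : ℝ≥0∞) [Fact (1 ≤ p)] (A : ℝ → X →ₗ.[ℂ] X)
    (U : ℝ → ℝ → X →L[ℂ] X) : Prop :=
  IsEvolutionFamily I U ∧
  ∃ T : ℝ → Lp X p (volume.restrict I) →L[ℂ] Lp X p (volume.restrict I),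
    IsC0Semigroup T ∧
    (∀ σ : ℝ, 0 ≤ σ → ∀ f : Lp X p (volume.restrict I),
      T σ f =ᵐ[volume.restrict I] fun t => I.indicator (fun r => U t r (f r)) (t - σ)) ∧
    ∀ f g : Lp X p (volume.restrict I), (f, g) ∈ closure (G0Graph I p A) ↔ GeneratorRel T f g

/-- The evolution family is invertible. -/
def IsInvertibleFamily (I : Set ℝ) (U : ℝ → ℝ → X →L[ℂ] X) : Prop :=
  ∀ t ∈ I, ∀ s ∈ I, s ≤ t → IsUnit (U t s)

/-- The extension of an invertible evolution family to all pairs of times: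
`U(t, s) = U(s, t)⁻¹` for `t < s`. -/
def twoSided (U : ℝ → ℝ → X →L[ℂ] X) (t s : ℝ) : X →L[ℂ] X :=
  if s ≤ t then U t s else Ring.inverse (U s t)

/-- `u ∈ C([s, b], X)`, `u(s) = x`, and
`∫_s^b (u(τ), v'(τ) + A(τ)* v(τ)) dτ = -(x, v(s))` for all `v ∈ F'_q`. -/
def IsWeakSolution (I : Set ℝ) (q : ℝ≥0∞) (A : ℝ → X →ₗ.[ℂ] X) (s b : ℝ) (x : X)
    (u : ℝ → X) : Prop :=
  ContinuousOn u (Icc s b) ∧ u s = x ∧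
    ∀ v v' w : ℝ → StrongDual ℂ X, MemFBackward I q (fun t => adjoint (A t)) v v' w →
      ∫ τ in s..b, (v' τ + w τ) (u τ) = -(v s x)

/-- `u ∈ C(ℝ, X)`, `u(s) = x`, and `∫_ℝ (u(τ), v'(τ) + A(τ)* v(τ)) dτ = 0` for all `v ∈ F'_q`
with compact support (time interval `ℝ`). -/
def IsWeakSolutionOnLine (q : ℝ≥0∞) (A : ℝ → X →ₗ.[ℂ] X) (s : ℝ) (x : X)
    (u : ℝ → X) : Prop :=
  Continuous u ∧ u s = x ∧
    ∀ v v' w : ℝ → StrongDual ℂ X, MemFBackward univ q (fun t => adjoint (A t)) v v' w →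
      HasCompactSupport v → ∫ τ, (v' τ + w τ) (u τ) = 0

end EvolutionFamilies

end EvolutionEquation

end

namespace EvolutionEquation

/-! ### Integration by parts for absolutely continuous functions; Riemann sums on well-chosen grids
-/

section Calculus

variable {E F G : Type*} [NormedAddCommGroup E] [NormedSpace ℝ E] [NormedAddCommGroup F]
  [NormedSpace ℝ F] [NormedAddCommGroup G] [NormedSpace ℝ G]

/-! Everything rests on one a priori estimate. If `u' = A(r)u - w u + g` almost everywhere, sampling
`u` on a fine grid turns the equation into an implicit Euler scheme whose steps are scaled
resolvents `h⁻¹ R(h⁻¹ + w, A(T k))`. Kato stability bounds all time-ordered products of them by `M`,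
so that `‖u t‖ ≤ M (‖u s‖ + ∫ ‖g‖)` (`KatoStable.norm_le_integral`); an exponential weight gives the
version with decay rate `c - w`.

By Hölder's inequality the supremum of `u ∈ F_p` is then controlled by the `L^p` norm of `(c -
G₀)u`. Since the range of `c - G₀` is dense, every `f ∈ L^p` has a mild solution `v` of `(c - G)v =
f`, a uniform limit of elements of `F_p`, and the estimate makes it causal. As long as `f` vanishes,
`v s` determines `v t` boundedly; this defines a propagator `V`, and `U(t, s) = exp (c (t - s)) V(t,
s)` is the evolution family. Its evolution semigroup has a generator which extends `G₀`
(`IsPropagator.norm_quotient_le` compares the difference quotient with a cut-off element of `F_p`),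
and the two closed operators agree because `c - G₀` has dense range while `c` minus the generator is
bounded below. A semigroup is determined by its generator, so any other `U` generated by the closure
of `G₀` is the same.

That `U(·, s)x` is a weak solution follows from the identity `v t (U t s x) - v s x = ∫ (v' + A*v)(U
r s x)` for `v ∈ F'_q`: it is the product rule for elements of `F_p`, and survives the uniform limit
(`IsGeneratedBy.duality`).

Uniqueness is the dual argument. The difference `e` of two solutions is annihilated by the functions
`(c - G₀')v`, up to an exponential weight and a boundary term. By density of the range of `c - G₀'`
it is annihilated by all `g` supported in the interval, hence `e = 0`. On `(a, b]` the boundary term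
vanishes since `v b = 0`. On `ℝ` the weak formulation is first localized by cut-off functions; the
boundary term is then small by the a priori estimate for the time-reflected adjoint family. For
times before `s`, invertibility of `U` gives the conclusion. -/

theorem integrable_bilin_prod {μ ν : Measure ℝ} [SFinite μ] [SFinite ν] (L : E →L[ℝ] F →L[ℝ] G)
    {f : ℝ → E} {g : ℝ → F} (hf : Integrable f μ) (hg : Integrable g ν) :
    Integrable (fun z : ℝ × ℝ => L (f z.1) (g z.2)) (μ.prod ν) := by
  refine Integrable.mono' ((hf.norm.mul_prod hg.norm).const_mul ‖L‖)
    (L.aestronglyMeasurable_comp₂ hf.aestronglyMeasurable.comp_fst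
      hg.aestronglyMeasurable.comp_snd) (ae_of_all _ fun z => ?_)
  simpa [mul_assoc] using L.le_opNorm₂ (f z.1) (g z.2)

/-- Fubini on the two triangles `y ≤ x` and `x ≤ y`: they cover the plane and overlap only in the
diagonal, which is null because `μ` has no atoms. This replaces the product rule when derivatives
exist only as `L¹` functions. -/
theorem integral_bilin_triangle [CompleteSpace E] [CompleteSpace F] [CompleteSpace G]
    (L : E →L[ℝ] F →L[ℝ] G)
    {f : ℝ → E} {g : ℝ → F} {μ : Measure ℝ} [SFinite μ] [NullSingletonClass μ]
    (hf : Integrable f μ) (hg : Integrable g μ) :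
    (∫ x, L (f x) (∫ y in Iic x, g y ∂μ) ∂μ) + ∫ y, L (∫ x in Iic y, f x ∂μ) (g y) ∂μ
      = L (∫ x, f x ∂μ) (∫ y, g y ∂μ) := by
  have hH := integrable_bilin_prod L hf hg
  have hT : MeasurableSet {z : ℝ × ℝ | z.2 ≤ z.1} := measurableSet_le measurable_snd measurable_fst
  have hT' : MeasurableSet {z : ℝ × ℝ | z.1 ≤ z.2} := measurableSet_le measurable_fst measurable_snd
  have h1 : ∫ x, L (f x) (∫ y in Iic x, g y ∂μ) ∂μ
      = ∫ x, ∫ y, {z : ℝ × ℝ | z.2 ≤ z.1}.indicator (fun z => L (f z.1) (g z.2)) (x, y) ∂μ ∂μ := by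
    refine integral_congr_ae (ae_of_all _ fun x => ?_)
    have e : (fun y => {z : ℝ × ℝ | z.2 ≤ z.1}.indicator (fun z => L (f z.1) (g z.2)) (x, y))
        = (Iic x).indicator fun y => L (f x) (g y) := by
      ext y; simp [indicator]
    simp only
    rw [e, integral_indicator measurableSet_Iic,
      ContinuousLinearMap.integral_comp_comm _ hg.integrableOn]
  have h2 : ∫ y, L (∫ x in Iic y, f x ∂μ) (g y) ∂μ
      = ∫ y, ∫ x, {z : ℝ × ℝ | z.1 ≤ z.2}.indicator (fun z => L (f z.1) (g z.2)) (x, y) ∂μ ∂μ := by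
    refine integral_congr_ae (ae_of_all _ fun y => ?_)
    have e : (fun x => {z : ℝ × ℝ | z.1 ≤ z.2}.indicator (fun z => L (f z.1) (g z.2)) (x, y))
        = (Iic y).indicator fun x => L.flip (g y) (f x) := by
      ext x; simp [indicator]
    simp only
    rw [e, integral_indicator measurableSet_Iic,
      ContinuousLinearMap.integral_comp_comm _ hf.integrableOn]
    simp
  rw [h1, h2, ← integral_integral_swap (f := fun x y =>
    {z : ℝ × ℝ | z.1 ≤ z.2}.indicator (fun z => L (f z.1) (g z.2)) (x, y)) (hH.indicator hT'),
    ← integral_prod _ (hH.indicator hT), ← integral_prod _ (hH.indicator hT'),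
    ← integral_add (hH.indicator hT) (hH.indicator hT')]
  have h3 : ∀ᵐ z ∂(μ.prod μ), z.1 ≠ z.2 := by
    have hm : MeasurableSet {z : ℝ × ℝ | z.1 = z.2} :=
      measurableSet_eq_fun measurable_fst measurable_snd
    rw [ae_iff]
    simp only [ne_eq, not_not]
    rw [Measure.prod_apply hm]
    simp
  have h4 : ∫ z, {z : ℝ × ℝ | z.2 ≤ z.1}.indicator (fun z => L (f z.1) (g z.2)) z
      + {z : ℝ × ℝ | z.1 ≤ z.2}.indicator (fun z => L (f z.1) (g z.2)) z ∂(μ.prod μ)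
      = ∫ z, L (f z.1) (g z.2) ∂(μ.prod μ) := by
    refine integral_congr_ae ?_
    filter_upwards [h3] with z hz
    rcases lt_or_gt_of_ne hz with h | h
    · simp [indicator, h.le, not_le.2 h]
    · simp [indicator, h.le, not_le.2 h]
  rw [h4, integral_prod _ hH]
  have h5 : ∀ x, ∫ y, L (f x) (g y) ∂μ = L (f x) (∫ y, g y ∂μ) := fun x =>
    ContinuousLinearMap.integral_comp_comm _ hg
  simp only [h5]
  exact ContinuousLinearMap.integral_comp_comm (L.flip (∫ y, g y ∂μ)) hf

/-- `f` is a primitive of the integrable function `f'` on `[s, t]`. -/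
def IsPrimitiveOn (f f' : ℝ → E) (s t : ℝ) : Prop :=
  IntervalIntegrable f' volume s t ∧ ∀ x ∈ Icc s t, f x - f s = ∫ r in s..x, f' r

theorem IsPrimitiveOn.continuousOn {f f' : ℝ → E} {s t : ℝ} (hst : s ≤ t)
    (h : IsPrimitiveOn f f' s t) : ContinuousOn f (Icc s t) := by
  have h1 : ContinuousOn (fun x => f s + ∫ r in s..x, f' r) (Icc s t) := by
    refine continuousOn_const.add ?_
    have := intervalIntegral.continuousOn_primitive_interval' h.1 (left_mem_uIcc)
    rwa [uIcc_of_le hst] at this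
  refine h1.congr fun x hx => ?_
  simp only [← h.2 x hx]; abel

theorem intervalIntegrable_bilin {L : E →L[ℝ] F →L[ℝ] G} {a : ℝ → E} {b : ℝ → F} {s t : ℝ}
    (hst : s ≤ t) (ha : IntervalIntegrable a volume s t) (hb : ContinuousOn b (Icc s t)) :
    IntervalIntegrable (fun r => L (a r) (b r)) volume s t := by
  obtain ⟨C, hC⟩ := isCompact_Icc.exists_bound_of_continuousOn hb
  rw [intervalIntegrable_iff_integrableOn_Ioc_of_le hst] at ha ⊢
  have hb' : AEStronglyMeasurable b (volume.restrict (Ioc s t)) :=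
    (hb.mono Ioc_subset_Icc_self).aestronglyMeasurable measurableSet_Ioc
  refine Integrable.mono' (ha.norm.const_mul (‖L‖ * C))
    (L.aestronglyMeasurable_comp₂ ha.aestronglyMeasurable hb') ?_
  filter_upwards [ae_restrict_mem measurableSet_Ioc] with r hr
  calc ‖L (a r) (b r)‖ ≤ ‖L‖ * ‖a r‖ * ‖b r‖ := L.le_opNorm₂ _ _
    _ ≤ ‖L‖ * ‖a r‖ * C := by gcongr; exact hC r (Ioc_subset_Icc_self hr)
    _ = ‖L‖ * C * ‖a r‖ := by ring

theorem IsPrimitiveOn.setIntegral_Iic {a a' : ℝ → E} {s t : ℝ} (ha : IsPrimitiveOn a a' s t)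
    {x : ℝ} (hx : x ∈ Ioc s t) :
    ∫ y in Iic x, a' y ∂(volume.restrict (Ioc s t)) = a x - a s := by
  rw [ha.2 x (Ioc_subset_Icc_self hx), intervalIntegral.integral_of_le hx.1.le,
    Measure.restrict_restrict measurableSet_Iic]
  congr 2
  ext y; simp only [mem_inter_iff, mem_Iic, mem_Ioc]
  exact ⟨fun h => ⟨h.2.1, h.1⟩, fun h => ⟨h.2, h.1, h.2.trans hx.2⟩⟩

theorem IsPrimitiveOn.bilin [CompleteSpace E] [CompleteSpace F] [CompleteSpace G]
    (L : E →L[ℝ] F →L[ℝ] G) {f f' : ℝ → E}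
    {g g' : ℝ → F} {s t : ℝ} (hst : s ≤ t)
    (hf : IsPrimitiveOn f f' s t) (hg : IsPrimitiveOn g g' s t) :
    L (f t) (g t) - L (f s) (g s) = ∫ r in s..t, (L (f' r) (g r) + L (f r) (g' r)) := by
  have h1 : IntervalIntegrable (fun r => L (f' r) (g r)) volume s t :=
    intervalIntegrable_bilin hst hf.1 (hg.continuousOn hst)
  have h2 : IntervalIntegrable (fun r => L (f r) (g' r)) volume s t :=
    intervalIntegrable_bilin (L := L.flip) hst hg.1 (hf.continuousOn hst)
  have hf1 := (intervalIntegrable_iff_integrableOn_Ioc_of_le hst).1 hf.1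
  have hg1 := (intervalIntegrable_iff_integrableOn_Ioc_of_le hst).1 hg.1
  have key := integral_bilin_triangle L hf1 hg1
  have e1 : ∫ x, L (f' x) (∫ y in Iic x, g' y ∂(volume.restrict (Ioc s t)))
      ∂(volume.restrict (Ioc s t)) = ∫ x in s..t, L (f' x) (g x - g s) := by
    rw [intervalIntegral.integral_of_le hst]
    refine setIntegral_congr_fun measurableSet_Ioc fun x hx => ?_
    simp only [hg.setIntegral_Iic hx]
  have e2 : ∫ y, L (∫ x in Iic y, f' x ∂(volume.restrict (Ioc s t))) (g' y)
      ∂(volume.restrict (Ioc s t)) = ∫ x in s..t, L (f x - f s) (g' x) := by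
    rw [intervalIntegral.integral_of_le hst]
    refine setIntegral_congr_fun measurableSet_Ioc fun x hx => ?_
    simp only [hf.setIntegral_Iic hx]
  have i3 : IntervalIntegrable (fun x => L (f' x) (g s)) volume s t :=
    ⟨(L.flip (g s)).integrable_comp hf.1.1, (L.flip (g s)).integrable_comp hf.1.2⟩
  have i4 : IntervalIntegrable (fun x => L (f s) (g' x)) volume s t :=
    ⟨(L (f s)).integrable_comp hg.1.1, (L (f s)).integrable_comp hg.1.2⟩
  have e3 : ∫ x in s..t, L (f' x) (g s) = L (f t - f s) (g s) := by
    have := (L.flip (g s)).intervalIntegral_comp_comm hf.1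
    rw [← hf.2 t (right_mem_Icc.2 hst)] at this
    simpa using this
  have e4 : ∫ x in s..t, L (f s) (g' x) = L (f s) (g t - g s) := by
    have := (L (f s)).intervalIntegral_comp_comm hg.1
    rwa [← hg.2 t (right_mem_Icc.2 hst)] at this
  rw [e1, e2, ← intervalIntegral.integral_of_le hst, ← intervalIntegral.integral_of_le hst,
    ← hf.2 t (right_mem_Icc.2 hst), ← hg.2 t (right_mem_Icc.2 hst)] at key
  simp only [map_sub, sub_apply] at key e3 e4
  rw [intervalIntegral.integral_sub h1 i3, intervalIntegral.integral_sub h2 i4, e3, e4] at key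
  rw [intervalIntegral.integral_add h1 h2]
  have := sub_eq_zero.2 key
  rw [← sub_eq_zero, ← neg_eq_zero, ← this]
  abel

/-- A grid on which the Riemann sums of an integrable function are accurate, and which avoids a
given null set. -/
theorem exists_good_grid {f : ℝ → E} {s t : ℝ} (hst : s < t)
    (hf : IntervalIntegrable f volume s t) {P : ℝ → Prop}
    (hP : ∀ᵐ r ∂(volume.restrict (Ioc s t)), P r) {ε η : ℝ} (hε : 0 < ε) (hη : 0 < η) :
    ∃ (n : ℕ) (h τ : ℝ), 0 < h ∧ h ≤ η ∧ s < τ ∧ τ ≤ s + η ∧ t - η ≤ τ + n * h ∧ τ + n * h ≤ t ∧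
      (∀ k ≤ n, P (τ + k * h)) ∧
      ∑ k ∈ Finset.range n, ∫ r in (τ + k * h)..(τ + (k + 1 : ℕ) * h), ‖f r - f (τ + (k + 1 : ℕ) * h)‖
        ≤ ε := by
  have hfi : Integrable ((Ioc s t).indicator f) :=
    ((intervalIntegrable_iff_integrableOn_Ioc_of_le hst.le).1 hf).integrable_indicator
      measurableSet_Ioc
  -- The total error is three times `ε / 4`: the integral of `ρ = ‖f - a‖` over the cells, the
  -- oscillation of the continuous function `a` within the cells, and the sum of `h * ρ` over the
  -- nodes.
  obtain ⟨a, ha_supp, ha_le, ha_cont, ha_int⟩ :=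
    hfi.exists_hasCompactSupport_integral_sub_le (ε := ε / 4) (by positivity)
  set φ : ℝ → E := (Ioc s t).indicator f with hφ
  set ρ : ℝ → ℝ := fun r => ‖φ r - a r‖ with hρ
  have hρi : Integrable ρ := (hfi.sub ha_int).norm
  have hρ0 : ∀ r, 0 ≤ ρ r := fun r => norm_nonneg _
  have hL : 0 < t - s := sub_pos.2 hst
  obtain ⟨κ, hκ, hκ'⟩ := Metric.uniformContinuous_iff.1
    (ha_supp.uniformContinuous_of_continuous ha_cont) (ε / (4 * (t - s))) (by positivity)
  obtain ⟨m, hm⟩ := exists_nat_gt ((t - s) / min (κ / 2) η)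
  have hmin : 0 < min (κ / 2) η := lt_min (by positivity) hη
  -- `N = m + 1` cells of length `h` fill `(s, t]`. After a shift by an offset `θ ∈ (0, h]` only the
  -- nodes with `k ≤ m` are sure to stay inside, so the final grid has `m` steps.
  set N : ℕ := m + 1 with hN
  set h : ℝ := (t - s) / N with hh
  have hNpos : (0 : ℝ) < N := by rw [hN]; positivity
  have hpos : 0 < h := div_pos hL hNpos
  have hNh : N * h = t - s := by rw [hh]; field_simp
  have hhmin : h ≤ min (κ / 2) η := by
    rw [hh, div_le_iff₀ hNpos]
    rw [div_lt_iff₀ hmin] at hm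
    have : (N : ℝ) = m + 1 := by rw [hN]; push_cast; ring
    rw [this]; nlinarith
  have hhη : h ≤ η := hhmin.trans (min_le_right _ _)
  have hhκ : h < κ := by linarith [hhmin.trans (min_le_left _ _)]
  have hii : ∀ x y, IntervalIntegrable ρ volume x y := fun x y => hρi.intervalIntegrable
  have hsub : ∀ k : ℕ, IntervalIntegrable (fun θ => ρ (s + k * h + θ)) volume 0 h := by
    intro k
    have := (hii (s + k * h) (s + k * h + h)).comp_add_left (s + k * h)
    simpa using this
  have hsum : ∫ θ in (0:ℝ)..h, ∑ k ∈ Finset.range N, ρ (s + k * h + θ) ≤ ε / 4 := by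
    rw [intervalIntegral.integral_finsetSum fun k _ => hsub k]
    have : ∀ k ∈ Finset.range N, ∫ θ in (0:ℝ)..h, ρ (s + k * h + θ)
        = ∫ r in (fun k : ℕ => s + k * h) k..(fun k : ℕ => s + k * h) (k + 1), ρ r := by
      intro k _
      rw [intervalIntegral.integral_comp_add_left (fun r => ρ r)]
      simp only
      congr 1
      · ring
      · push_cast; ring
    rw [Finset.sum_congr rfl this, intervalIntegral.sum_integral_adjacent_intervals fun k _ => hii _ _]
    have e : (s + ((N:ℕ):ℝ) * h) = t := by rw [hNh]; ring
    simp only [e, Nat.cast_zero, zero_mul, add_zero]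
    rw [intervalIntegral.integral_of_le hst.le]
    exact (setIntegral_le_integral hρi (ae_of_all _ hρ0)).trans ha_le
  have hnull : volume {r | ¬ (r ∈ Ioc s t → P r)} = 0 := by
    rw [← ae_iff]; exact (ae_restrict_iff' measurableSet_Ioc).1 hP
  set Nul : Set ℝ := ⋃ k : ℕ, (fun θ => s + k * h + θ) ⁻¹' {r | ¬ (r ∈ Ioc s t → P r)} with hNul
  have hNul0 : volume Nul = 0 := by
    refine measure_iUnion_null fun k => ?_
    exact (measure_preimage_add volume (s + k * h) _).trans hnull
  have hvol : volume (Ioc (0:ℝ) h) ≠ 0 := by simp [hpos]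
  have hFi : IntegrableOn (fun θ => ∑ k ∈ Finset.range N, ρ (s + k * h + θ)) (Ioc 0 h) := by
    refine integrable_finsetSum _ fun k _ => ?_
    exact (intervalIntegrable_iff_integrableOn_Ioc_of_le hpos.le).1 (hsub k)
  -- The mean over `θ` of the node sums of `ρ` is `h⁻¹` times the integral of `ρ` over `(s, t]`.
  -- Some offset does not exceed this mean, and it may be chosen outside the null set `Nul` of
  -- offsets that put a node where `P` fails.
  obtain ⟨θ, hθN, hθle⟩ : ∃ θ, θ ∉ Nul ∪ (Ioc 0 h)ᶜ ∧ ∑ k ∈ Finset.range N, ρ (s + k * h + θ)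
      ≤ ⨍ x in Ioc 0 h, ∑ k ∈ Finset.range N, ρ (s + k * h + x) := by
    refine exists_notMem_null_le_average (μ := volume.restrict (Ioc 0 h))
      (by simpa [Measure.restrict_eq_zero] using hpos) hFi ?_
    refine measure_union_null ?_ ?_
    · exact Measure.absolutelyContinuous_of_le Measure.restrict_le_self hNul0
    · rw [Measure.restrict_apply measurableSet_Ioc.compl]; simp
  rw [mem_union, not_or, mem_compl_iff, not_not] at hθN
  obtain ⟨hθN, hθ0, hθh⟩ := hθN
  rw [setAverage_eq, ← intervalIntegral.integral_of_le hpos.le] at hθle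
  have hθle' : h * ∑ k ∈ Finset.range N, ρ (s + k * h + θ) ≤ ε / 4 := by
    have hr : volume.real (Ioc 0 h) = h := by simp [Measure.real, hpos.le]
    rw [hr, smul_eq_mul] at hθle
    calc _ ≤ h * (h⁻¹ * ∫ θ in (0:ℝ)..h, ∑ k ∈ Finset.range N, ρ (s + k * h + θ)) := by gcongr
      _ = ∫ θ in (0:ℝ)..h, ∑ k ∈ Finset.range N, ρ (s + k * h + θ) := by field_simp
      _ ≤ _ := hsum
  have hτ : ∀ k : ℕ, k ≤ m → s + θ + k * h ∈ Ioc s t := by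
    intro k hk
    have : (k : ℝ) ≤ m := by exact_mod_cast hk
    have hNm : (N : ℝ) = m + 1 := by rw [hN]; push_cast; ring
    constructor
    · have : 0 ≤ (k : ℝ) * h := by positivity
      linarith
    · rw [hNm] at hNh
      nlinarith
  refine ⟨m, h, s + θ, hpos, hhη, by linarith, by linarith, ?_, (hτ m le_rfl).2, ?_, ?_⟩
  · have hNm : (N : ℝ) = m + 1 := by rw [hN]; push_cast; ring
    rw [hNm] at hNh
    nlinarith
  · intro k hk
    have h1 := mt (fun hx => mem_iUnion.2 ⟨k, hx⟩) hθN
    simp only [mem_preimage, mem_ofPred_eq, not_not] at h1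
    have e : s + θ + k * h = s + k * h + θ := by ring
    have h2 := hτ k hk
    rw [e] at h2 ⊢
    exact h1 h2
  · set τ : ℕ → ℝ := fun k => s + θ + k * h with hτd
    have hstep : ∀ k : ℕ, τ (k + 1) = τ k + h := fun k => by simp only [hτd]; push_cast; ring
    have hle : ∀ k ∈ Finset.range m, ∫ r in τ k..τ (k + 1), ‖f r - f (τ (k + 1))‖
        ≤ (∫ r in τ k..τ (k + 1), ρ r) + h * (ε / (4 * (t - s))) + h * ρ (τ (k + 1)) := by
      intro k hk
      have hk' := Finset.mem_range.1 hk
      have hkk : τ k ≤ τ (k + 1) := by rw [hstep]; linarith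
      have m1 := hτ k hk'.le
      have m2 := hτ (k + 1) hk'
      have hsub : Ioc (τ k) (τ (k + 1)) ⊆ Ioc s t := Ioc_subset_Ioc m1.1.le m2.2
      have hmain : ∀ r ∈ Ioc (τ k) (τ (k + 1)),
          ‖f r - f (τ (k + 1))‖ ≤ ρ r + (ε / (4 * (t - s)) + ρ (τ (k + 1))) := by
        intro r hr
        have e1 : f r = φ r := by rw [hφ, indicator_of_mem (hsub hr)]
        have e2 : f (τ (k + 1)) = φ (τ (k + 1)) := by rw [hφ, indicator_of_mem m2]
        have d : ‖a r - a (τ (k + 1))‖ ≤ ε / (4 * (t - s)) := by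
          rw [← dist_eq_norm]
          refine (hκ' ?_).le
          rw [Real.dist_eq, abs_lt]
          have := hstep k
          constructor <;> linarith [hr.1, hr.2]
        calc ‖f r - f (τ (k + 1))‖ = ‖(φ r - a r) + (a r - a (τ (k + 1)))
              - (φ (τ (k + 1)) - a (τ (k + 1)))‖ := by rw [e1, e2]; congr 1; abel
          _ ≤ ‖φ r - a r‖ + ‖a r - a (τ (k + 1))‖ + ‖φ (τ (k + 1)) - a (τ (k + 1))‖ := by
              refine (norm_sub_le _ _).trans ?_
              gcongr
              exact norm_add_le _ _
          _ ≤ _ := by simp only [hρ]; linarith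
      have hint : IntervalIntegrable (fun r => ‖f r - f (τ (k + 1))‖) volume (τ k) (τ (k + 1)) := by
        refine IntervalIntegrable.norm (IntervalIntegrable.sub (hf.mono_set ?_)
          intervalIntegrable_const)
        rw [uIcc_of_le hkk, uIcc_of_le hst.le]
        exact Icc_subset_Icc m1.1.le m2.2
      calc _ ≤ ∫ r in τ k..τ (k + 1), (ρ r + (ε / (4 * (t - s)) + ρ (τ (k + 1)))) :=
            intervalIntegral.integral_mono_on_of_le_Ioo hkk hint
              ((hii _ _).add intervalIntegrable_const)
              fun r hr => hmain r (Ioo_subset_Ioc_self hr)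
        _ = _ := by
            rw [intervalIntegral.integral_add (hii _ _) intervalIntegrable_const,
              intervalIntegral.integral_const, hstep]
            simp only [add_sub_cancel_left, smul_eq_mul]; ring
    refine (Finset.sum_le_sum hle).trans ?_
    rw [Finset.sum_add_distrib, Finset.sum_add_distrib,
      intervalIntegral.sum_integral_adjacent_intervals fun k _ => hii _ _, Finset.sum_const,
      Finset.card_range, ← Finset.mul_sum]
    have b1 : ∫ r in τ 0..τ m, ρ r ≤ ε / 4 := by
      rw [intervalIntegral.integral_of_le]
      · exact (setIntegral_le_integral hρi (ae_of_all _ hρ0)).trans ha_le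
      · simp only [hτd]; push_cast
        have : 0 ≤ (m : ℝ) * h := by positivity
        linarith
    have b2 : m • (h * (ε / (4 * (t - s)))) ≤ ε / 4 := by
      rw [nsmul_eq_mul]
      have hNm : (N : ℝ) = m + 1 := by rw [hN]; push_cast; ring
      rw [hNm] at hNh
      have : (m : ℝ) * h ≤ t - s := by nlinarith
      calc (m : ℝ) * (h * (ε / (4 * (t - s)))) = (m * h) * (ε / (4 * (t - s))) := by ring
        _ ≤ (t - s) * (ε / (4 * (t - s))) := by gcongr
        _ = ε / 4 := by field_simp
    have b3 : h * ∑ k ∈ Finset.range m, ρ (τ (k + 1)) ≤ ε / 4 := by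
      refine le_trans ?_ hθle'
      gcongr
      rw [hN, Finset.sum_range_succ']
      have : ∀ k : ℕ, ρ (τ (k + 1)) = ρ (s + (k + 1 : ℕ) * h + θ) := fun k => by
        simp only [hτd]; congr 1; push_cast; ring
      simp only [this]
      exact le_add_of_nonneg_right (hρ0 _)
    linarith

end Calculus

/-! ### The a priori estimate from Kato stability -/

section APriori

variable {Y : Type*} [NormedAddCommGroup Y] [NormedSpace ℂ Y]

theorem KatoStable.nonneg {r : ℝ → ℝ → Prop} {I : Set ℝ} {B : ℝ → Y →ₗ.[ℂ] Y} {M w : ℝ}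
    (hK : KatoStable r I B M w) : 0 ≤ M := by
  have := hK.2 [] (by simp) List.Pairwise.nil (w + 1) (by linarith)
  simp only [List.map_nil, List.prod_nil, List.length_nil, pow_zero, inv_one, mul_one] at this
  exact (norm_nonneg _).trans this

theorem graph_real_smul {B : Y →ₗ.[ℂ] Y} {y z : Y} (h : (y, z) ∈ B.graph) (φ : ℝ) :
    (φ • y, φ • z) ∈ B.graph := by
  have := B.graph.smul_mem (φ : ℂ) h
  rwa [Prod.smul_mk, Complex.coe_smul, Complex.coe_smul] at this

/-- A perturbed implicit Euler scheme. Estimating step by step would produce powers of `M`; instead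
the induction carries the list `l` of resolvents already standing on the left, so that the initial
value and each perturbation `d k` are hit by a single time-ordered product, which costs the factor
`M` once. -/
theorem KatoStable.norm_iterate_le {I : Set ℝ} {B : ℝ → Y →ₗ.[ℂ] Y} {M w : ℝ}
    (hK : KatoStable (· ≥ ·) I B M w) {h : ℝ} (hh : 0 < h) {τ : ℕ → ℝ} (hτ : Monotone τ)
    {y d : ℕ → Y} (n : ℕ) (hI : ∀ k ≤ n, τ k ∈ I)
    (hy : ∀ k < n, y (k + 1) =
      (h : ℂ)⁻¹ • resolvent ((h⁻¹ + w : ℝ) : ℂ) (B (τ (k + 1))) (y k + d k))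
    (l : List ℝ) (hlI : ∀ t ∈ l, t ∈ I) (hl : l.Pairwise (· ≥ ·)) (hln : ∀ t ∈ l, τ n ≤ t) :
    ‖(l.map fun t => resolvent ((h⁻¹ + w : ℝ) : ℂ) (B t)).prod (y n)‖
      ≤ M * h ^ l.length * (‖y 0‖ + ∑ k ∈ Finset.range n, ‖d k‖) := by
  have hK2 : ∀ l : List ℝ, (∀ t ∈ l, t ∈ I) → l.Pairwise (· ≥ ·) → ∀ v : Y,
      ‖(l.map fun t => resolvent ((h⁻¹ + w : ℝ) : ℂ) (B t)).prod v‖ ≤ M * h ^ l.length * ‖v‖ := by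
    intro l h1 h2 v
    have := hK.2 l h1 h2 (h⁻¹ + w) (by have := inv_pos.2 hh; linarith)
    rw [add_sub_cancel_right, inv_pow, inv_inv] at this
    exact (ContinuousLinearMap.le_opNorm _ _).trans (by gcongr)
  induction n generalizing l with
  | zero => simpa using hK2 l hlI hl (y 0)
  | succ n ih =>
    rw [hy n (Nat.lt_succ_self n), map_smul]
    have hl' : (l ++ [τ (n + 1)]).Pairwise (· ≥ ·) := by
      rw [List.pairwise_append]
      refine ⟨hl, List.pairwise_singleton _ _, fun a ha b hb => ?_⟩
      rw [List.mem_singleton] at hb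
      rw [hb]; exact hln a ha
    have hlI' : ∀ t ∈ l ++ [τ (n + 1)], t ∈ I := by
      intro t ht
      rcases List.mem_append.1 ht with h | h
      · exact hlI t h
      · rw [List.mem_singleton.1 h]; exact hI _ le_rfl
    have e : ∀ v, (l.map fun t => resolvent ((h⁻¹ + w : ℝ) : ℂ) (B t)).prod
        (resolvent ((h⁻¹ + w : ℝ) : ℂ) (B (τ (n + 1))) v)
        = ((l ++ [τ (n + 1)]).map fun t => resolvent ((h⁻¹ + w : ℝ) : ℂ) (B t)).prod v := by
      intro v; simp
    have h1 := ih (fun k hk => hI k (hk.trans (Nat.le_succ n)))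
      (fun k hk => hy k (hk.trans (Nat.lt_succ_self n))) (l ++ [τ (n + 1)]) hlI' hl' (by
        intro t ht
        rcases List.mem_append.1 ht with h | h
        · exact (hτ (Nat.le_succ n)).trans (hln t h)
        · rw [List.mem_singleton.1 h]; exact hτ (Nat.le_succ n))
    have h2 := hK2 _ hlI' hl' (d n)
    rw [e, map_add, norm_smul, norm_inv, Complex.norm_real, Real.norm_of_nonneg hh.le,
      Finset.sum_range_succ]
    simp only [List.length_append, List.length_singleton] at h1 h2
    calc _ ≤ h⁻¹ * (M * h ^ (l.length + 1) * (‖y 0‖ + ∑ k ∈ Finset.range n, ‖d k‖)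
          + M * h ^ (l.length + 1) * ‖d n‖) := by
          gcongr
          exact (norm_add_le _ _).trans (add_le_add h1 h2)
      _ = _ := by field_simp; ring

variable [CompleteSpace Y]

/-- At grid points where `(u r, z r)` lies in the graph, `u` satisfies an implicit Euler scheme
exactly, with perturbation `h g` plus a consistency error. Taking the resolvents at `h⁻¹ + w` makes
the stability bound independent of the number of steps. A grid that is good for the pair `(u', g)`
makes the sum of the perturbations close to `∫ ‖g‖`. -/
theorem KatoStable.norm_le_integral {I : Set ℝ} {B : ℝ → Y →ₗ.[ℂ] Y} {M w : ℝ}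
    (hK : KatoStable (· ≥ ·) I B M w) {s t : ℝ} (hst : s < t) (hI : Ioc s t ⊆ I) {u u' z : ℝ → Y}
    (hu : IsPrimitiveOn u u' s t) (hz : IntervalIntegrable z volume s t)
    (hgr : ∀ᵐ r ∂(volume.restrict (Ioc s t)), (u r, z r) ∈ (B r).graph) :
    ‖u t‖ ≤ M * (‖u s‖ + ∫ r in s..t, ‖(w : ℂ) • u r + u' r - z r‖) := by
  have hM := hK.nonneg
  have hcu := hu.continuousOn hst.le
  set g : ℝ → Y := fun r => (w : ℂ) • u r + u' r - z r with hg
  have hgi : IntervalIntegrable g volume s t := by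
    refine (IntervalIntegrable.add ?_ hu.1).sub hz
    refine ContinuousOn.intervalIntegrable ?_
    rw [uIcc_of_le hst.le]; exact continuousOn_const.smul hcu
  have hfi : IntervalIntegrable (fun r => (u' r, g r)) volume s t :=
    ⟨hu.1.1.prodMk hgi.1, hu.1.2.prodMk hgi.2⟩
  refine le_of_forall_pos_le_add fun ε hε => ?_
  -- The errors are `δ` at the right end and, multiplied by `M`, `δ` at the left end and `2 * δ`
  -- from the perturbations.
  set δ : ℝ := ε / (1 + 3 * M) with hδ
  have hδpos : 0 < δ := by positivity
  obtain ⟨η₁, hη₁, h₁⟩ := Metric.continuousWithinAt_iff.1 (hcu s (left_mem_Icc.2 hst.le)) δ hδpos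
  obtain ⟨η₂, hη₂, h₂⟩ := Metric.continuousWithinAt_iff.1 (hcu t (right_mem_Icc.2 hst.le)) δ hδpos
  obtain ⟨n, h, τ, hh, -, hτs, hτη, htη, hτt, hP, hsum⟩ := exists_good_grid hst hfi hgr hδpos
    (η := min (η₁ / 2) (η₂ / 2)) (by positivity)
  have hm1 := min_le_left (η₁ / 2) (η₂ / 2)
  have hm2 := min_le_right (η₁ / 2) (η₂ / 2)
  set T : ℕ → ℝ := fun k => τ + k * h with hT
  have hTmono : Monotone T := by
    intro a b hab
    have : (a : ℝ) ≤ b := by exact_mod_cast hab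
    simp only [hT]; nlinarith
  have hT0 : T 0 = τ := by simp [hT]
  have hTs : ∀ k, s < T k := fun k => by
    have := hTmono (Nat.zero_le k); rw [hT0] at this; linarith
  have hTt : ∀ k ≤ n, T k ≤ t := fun k hk => (hTmono hk).trans hτt
  have hstep : ∀ k : ℕ, T (k + 1) = T k + h := fun k => by simp only [hT]; push_cast; ring
  have hsubi : ∀ k < n, uIcc (T k) (T (k + 1)) ⊆ uIcc s t := by
    intro k hk
    rw [uIcc_of_le (hTmono (Nat.le_succ k)), uIcc_of_le hst.le]
    exact Icc_subset_Icc (hTs k).le (hTt _ hk)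
  have hui : ∀ k < n, u (T (k + 1)) - u (T k) = ∫ r in T k..T (k + 1), u' r := by
    intro k hk
    have a1 := hu.2 (T k) ⟨(hTs k).le, hTt k hk.le⟩
    have a2 := hu.2 (T (k + 1)) ⟨(hTs _).le, hTt _ hk⟩
    have i1 : IntervalIntegrable u' volume s (T k) := hu.1.mono_set (by
      rw [uIcc_of_le (hTs k).le, uIcc_of_le hst.le]; exact Icc_subset_Icc le_rfl (hTt k hk.le))
    have := intervalIntegral.integral_add_adjacent_intervals i1 (hu.1.mono_set (hsubi k hk))
    rw [← a1, ← a2] at this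
    rw [← sub_eq_iff_eq_add'.2 this.symm]; abel
  -- Chosen so that `u (T k) + d k` is exactly `h` times `(h⁻¹ + w) u - z` at `T (k + 1)`, to which
  -- the resolvent applies. The second summand is the consistency error.
  set d : ℕ → Y := fun k => (h : ℂ) • g (T (k + 1))
    + (u (T (k + 1)) - u (T k) - (h : ℂ) • u' (T (k + 1))) with hd
  have hh0 : (h : ℂ) ≠ 0 := by exact_mod_cast hh.ne'
  have hit := hK.norm_iterate_le hh hTmono (y := fun k => u (T k)) (d := d) n
    (fun k hk => hI ⟨hTs k, hTt k hk⟩) (by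
      intro k hk
      have hres := isResolvent_resolvent (hK.1 (T (k + 1)) (hI ⟨hTs _, hTt _ hk⟩) (h⁻¹ + w)
        (by have := inv_pos.2 hh; linarith))
      have h3 := hres.2 _ _ (hP (k + 1) hk)
      have h4 : u (T k) + d k = (h : ℂ) • (((h⁻¹ + w : ℝ) : ℂ) • u (T (k + 1)) - z (T (k + 1))) := by
        have e : (h : ℂ) • (((h⁻¹ + w : ℝ) : ℂ) • u (T (k + 1))) = u (T (k + 1))
            + (h : ℂ) • (w : ℂ) • u (T (k + 1)) := by
          push_cast
          rw [add_smul, smul_add, smul_smul, mul_inv_cancel₀ hh0, one_smul]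
        rw [smul_sub, e]
        simp only [hd, hg, smul_sub, smul_add]
        abel
      rw [h4, map_smul, smul_smul, inv_mul_cancel₀ hh0, one_smul]
      exact h3.symm) [] (by simp) List.Pairwise.nil (by simp)
  simp only [List.map_nil, List.prod_nil, List.length_nil, pow_zero, mul_one,
    one_apply_eq_self] at hit
  have hdle : ∀ k ∈ Finset.range n, ‖d k‖ ≤ (∫ r in T k..T (k + 1), ‖g r‖)
      + 2 * ∫ r in T k..T (k + 1), ‖(u' r, g r) - (u' (T (k + 1)), g (T (k + 1)))‖ := by
    intro k hk
    have hk' := Finset.mem_range.1 hk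
    have hkk := hTmono (Nat.le_succ k)
    have i1 := hgi.mono_set (hsubi k hk')
    have i2 := hu.1.mono_set (hsubi k hk')
    have i3 := ((hfi.mono_set (hsubi k hk')).sub
      (intervalIntegrable_const (c := (u' (T (k + 1)), g (T (k + 1)))))).norm
    have hlen : T (k + 1) - T k = h := by rw [hstep]; ring
    have b1 : ‖(h : ℂ) • g (T (k + 1))‖ ≤ (∫ r in T k..T (k + 1), ‖g r‖)
        + ∫ r in T k..T (k + 1), ‖(u' r, g r) - (u' (T (k + 1)), g (T (k + 1)))‖ := by
      rw [← intervalIntegral.integral_add i1.norm i3]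
      have : ‖(h : ℂ) • g (T (k + 1))‖ = ∫ r in T k..T (k + 1), ‖g (T (k + 1))‖ := by
        rw [intervalIntegral.integral_const, hlen, norm_smul, Complex.norm_real,
          Real.norm_of_nonneg hh.le, smul_eq_mul]
      rw [this]
      refine intervalIntegral.integral_mono_on hkk intervalIntegrable_const (i1.norm.add i3) ?_
      intro r _
      have := norm_snd_le ((u' r, g r) - (u' (T (k + 1)), g (T (k + 1))))
      simp only [Prod.snd_sub] at this
      have h5 := norm_sub_norm_le (g (T (k + 1))) (g r)
      rw [norm_sub_rev (g (T (k + 1)))] at h5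
      linarith
    have b2 : ‖u (T (k + 1)) - u (T k) - (h : ℂ) • u' (T (k + 1))‖
        ≤ ∫ r in T k..T (k + 1), ‖(u' r, g r) - (u' (T (k + 1)), g (T (k + 1)))‖ := by
      have e : u (T (k + 1)) - u (T k) - (h : ℂ) • u' (T (k + 1))
          = ∫ r in T k..T (k + 1), (u' r - u' (T (k + 1))) := by
        rw [intervalIntegral.integral_sub i2 intervalIntegrable_const,
          intervalIntegral.integral_const, hlen, hui k hk']
        rfl
      rw [e]
      refine intervalIntegral.norm_integral_le_of_norm_le hkk (ae_of_all _ fun r _ => ?_) i3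
      exact norm_fst_le ((u' r, g r) - (u' (T (k + 1)), g (T (k + 1))))
    calc ‖d k‖ ≤ _ := norm_add_le _ _
      _ ≤ _ := by linarith
  have hS : ∑ k ∈ Finset.range n, ‖d k‖ ≤ (∫ r in s..t, ‖g r‖) + 2 * δ := by
    refine (Finset.sum_le_sum hdle).trans ?_
    rw [Finset.sum_add_distrib, ← Finset.mul_sum,
      intervalIntegral.sum_integral_adjacent_intervals
        fun k hk => (hgi.mono_set (hsubi k hk)).norm]
    gcongr
    refine intervalIntegral.integral_mono_interval (hTs 0).le (hTmono (Nat.zero_le n))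
      (hTt n le_rfl) (ae_of_all _ fun r => norm_nonneg _) hgi.norm
  have hus : ‖u (T 0)‖ ≤ ‖u s‖ + δ := by
    have := h₁ (x := T 0) ⟨(hTs 0).le, hTt 0 (Nat.zero_le n)⟩ (by
      rw [Real.dist_eq, abs_lt]; rw [hT0]; constructor <;> linarith)
    rw [dist_eq_norm] at this
    have h5 := norm_sub_norm_le (u (T 0)) (u s)
    linarith
  have hut : ‖u t‖ ≤ ‖u (T n)‖ + δ := by
    have := h₂ (x := T n) ⟨(hTs n).le, hTt n le_rfl⟩ (by
      have e1 : t - min (η₁ / 2) (η₂ / 2) ≤ T n := htη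
      have e2 : T n ≤ t := hτt
      rw [Real.dist_eq, abs_lt]; constructor <;> linarith)
    rw [dist_eq_norm] at this
    have h5 := norm_sub_norm_le (u t) (u (T n))
    rw [norm_sub_rev] at h5
    linarith
  calc ‖u t‖ ≤ ‖u (T n)‖ + δ := hut
    _ ≤ M * ((‖u s‖ + δ) + ((∫ r in s..t, ‖g r‖) + 2 * δ)) + δ := by
        gcongr
        refine hit.trans ?_
        gcongr
    _ = M * (‖u s‖ + ∫ r in s..t, ‖g r‖) + (1 + 3 * M) * δ := by ring
    _ = M * (‖u s‖ + ∫ r in s..t, ‖g r‖) + ε := by rw [hδ]; field_simp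

theorem isPrimitiveOn_exp (δ s t : ℝ) :
    IsPrimitiveOn (fun r => Real.exp (δ * r)) (fun r => δ * Real.exp (δ * r)) s t := by
  have hc : Continuous fun r => δ * Real.exp (δ * r) := by fun_prop
  refine ⟨hc.intervalIntegrable _ _, fun x _ => ?_⟩
  rw [intervalIntegral.integral_eq_sub_of_hasDerivAt (f := fun r => Real.exp (δ * r))
    (fun r _ => ?_) (hc.intervalIntegrable _ _)]
  have := ((hasDerivAt_id r).const_mul δ).exp
  simpa [mul_comm] using this

theorem IsPrimitiveOn.mono {E : Type*} [NormedAddCommGroup E] [NormedSpace ℝ E] {f f' : ℝ → E}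
    {s t r : ℝ} (h : IsPrimitiveOn f f' s t) (hr : r ∈ Icc s t) : IsPrimitiveOn f f' s r := by
  refine ⟨h.1.mono_set ?_, fun x hx => h.2 x ⟨hx.1, hx.2.trans hr.2⟩⟩
  rw [uIcc_of_le hr.1, uIcc_of_le (hr.1.trans hr.2)]
  exact Icc_subset_Icc le_rfl hr.2

theorem IsPrimitiveOn.smul {E : Type*} [NormedAddCommGroup E] [NormedSpace ℝ E] [CompleteSpace E]
    {φ φ' : ℝ → ℝ} {f f' : ℝ → E} {s t : ℝ} (hst : s ≤ t)
    (hφ : IsPrimitiveOn φ φ' s t) (hf : IsPrimitiveOn f f' s t) :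
    IsPrimitiveOn (fun r => φ r • f r) (fun r => φ' r • f r + φ r • f' r) s t := by
  have i1 := intervalIntegrable_bilin (L := ContinuousLinearMap.lsmul ℝ ℝ (E := E)) hst hφ.1
    (hf.continuousOn hst)
  have i2 := intervalIntegrable_bilin (L := (ContinuousLinearMap.lsmul ℝ ℝ (E := E)).flip) hst hf.1
    (hφ.continuousOn hst)
  exact ⟨i1.add i2, fun x hx => (hφ.mono hx).bilin (ContinuousLinearMap.lsmul ℝ ℝ (E := E)) hx.1
    (hf.mono hx)⟩

/-- The basic a priori estimate: solutions of `u' = A(t)u - (w + δ)u + f` decay at the rate `δ`,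
up to the forcing `f`. -/
theorem KatoStable.norm_le_exp {I : Set ℝ} {B : ℝ → Y →ₗ.[ℂ] Y} {M w : ℝ}
    (hK : KatoStable (· ≥ ·) I B M w) {s t : ℝ} (hst : s < t) (hI : Ioc s t ⊆ I) {u u' z : ℝ → Y}
    (hu : IsPrimitiveOn u u' s t) (hz : IntervalIntegrable z volume s t)
    (hgr : ∀ᵐ r ∂(volume.restrict (Ioc s t)), (u r, z r) ∈ (B r).graph) (c : ℝ) :
    ‖u t‖ ≤ M * (Real.exp (-(c - w) * (t - s)) * ‖u s‖
      + ∫ r in s..t, Real.exp (-(c - w) * (t - r)) * ‖(c : ℂ) • u r + u' r - z r‖) := by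
  -- Multiplication by `exp (δ r)` stays in the domain of `B r` by linearity and replaces `w` by `c`
  -- in the equation.
  set δ := c - w with hδ
  have hexp := (isPrimitiveOn_exp δ s t).smul hst.le hu
  have hz' : IntervalIntegrable (fun r => Real.exp (δ * r) • z r) volume s t :=
    intervalIntegrable_bilin (L := (ContinuousLinearMap.lsmul ℝ ℝ (E := Y)).flip) hst.le hz
      ((isPrimitiveOn_exp δ s t).continuousOn hst.le)
  have hgr' : ∀ᵐ r ∂(volume.restrict (Ioc s t)),
      (Real.exp (δ * r) • u r, Real.exp (δ * r) • z r) ∈ (B r).graph := by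
    filter_upwards [hgr] with r hr
    exact graph_real_smul hr _
  have key := hK.norm_le_integral hst hI hexp hz' hgr'
  have e : ∀ r, ‖(w : ℂ) • Real.exp (δ * r) • u r + ((δ * Real.exp (δ * r)) • u r
      + Real.exp (δ * r) • u' r) - Real.exp (δ * r) • z r‖
      = Real.exp (δ * t) * (Real.exp (-δ * (t - r)) * ‖(c : ℂ) • u r + u' r - z r‖) := by
    intro r
    have e1 : (w : ℂ) • Real.exp (δ * r) • u r + ((δ * Real.exp (δ * r)) • u r
      + Real.exp (δ * r) • u' r) - Real.exp (δ * r) • z r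
      = Real.exp (δ * r) • ((c : ℂ) • u r + u' r - z r) := by
      have hc : (c : ℂ) • u r = (w : ℂ) • u r + δ • u r := by
        rw [← Complex.coe_smul, ← add_smul]; congr 1; rw [hδ]; push_cast; ring
      rw [hc, smul_comm (w : ℂ), mul_comm δ (Real.exp _), mul_smul (Real.exp (δ * r))]
      simp only [smul_sub, smul_add]
      abel
    rw [e1, norm_smul, Real.norm_of_nonneg (Real.exp_pos _).le, ← mul_assoc, ← Real.exp_add]
    congr 2; ring
  simp only [e] at key
  rw [intervalIntegral.integral_const_mul, norm_smul, norm_smul,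
    Real.norm_of_nonneg (Real.exp_pos _).le, Real.norm_of_nonneg (Real.exp_pos _).le] at key
  have e3 : Real.exp (δ * s) = Real.exp (δ * t) * Real.exp (-δ * (t - s)) := by
    rw [← Real.exp_add]; congr 1; ring
  rw [e3] at key
  have := Real.exp_pos (δ * t)
  refine le_of_mul_le_mul_left (key.trans (le_of_eq ?_)) this
  ring

end APriori

/-! ### Time intervals and scalar multipliers -/

section Intervals

variable {I : Set ℝ}

theorem IsTimeInterval.ordConnected (hI : IsTimeInterval I) : I.OrdConnected := by
  rcases hI with ⟨a, b, _, rfl⟩ | ⟨b, rfl⟩ | rfl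
  · exact ordConnected_Ioc
  · exact ordConnected_Iic
  · exact ordConnected_univ

theorem IsTimeInterval.measurableSet (hI : IsTimeInterval I) : MeasurableSet I :=
  hI.ordConnected.measurableSet

theorem IsTimeInterval.exists_Icc_subset (hI : IsTimeInterval I) {t : ℝ} (ht : t ∈ I) :
    ∃ η > 0, Icc (t - η) t ⊆ I := by
  rcases hI with ⟨a, b, _, rfl⟩ | ⟨b, rfl⟩ | rfl
  · exact ⟨(t - a) / 2, by linarith [ht.1], fun x hx => ⟨by linarith [hx.1, ht.1], hx.2.trans ht.2⟩⟩
  · exact ⟨1, one_pos, fun x hx => hx.2.trans ht⟩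
  · exact ⟨1, one_pos, fun x _ => mem_univ _⟩

theorem IsTimeInterval.Ioc_subset (hI : IsTimeInterval I) {s t : ℝ} (hs : s ∈ I) (ht : t ∈ I) :
    Ioc s t ⊆ I := Ioc_subset_Icc_self.trans (hI.ordConnected.out hs ht)

/-- A bounded Lipschitz function `φ` with derivative `φ'`. -/
structure IsMultiplier (φ φ' : ℝ → ℝ) : Prop where
  measurable : Measurable φ
  measurable_deriv : Measurable φ'
  bounded : ∃ C, ∀ x, |φ x| ≤ C
  bounded_deriv : ∃ C, ∀ x, |φ' x| ≤ C
  primitive : ∀ x y, φ y - φ x = ∫ r in x..y, φ' r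

theorem IsMultiplier.isPrimitiveOn {φ φ' : ℝ → ℝ} (h : IsMultiplier φ φ') (s t : ℝ) :
    IsPrimitiveOn φ φ' s t := by
  refine ⟨?_, fun x _ => h.primitive s x⟩
  obtain ⟨C, hC⟩ := h.bounded_deriv
  exact (intervalIntegrable_const (c := C)).mono_fun h.measurable_deriv.aestronglyMeasurable
    (ae_of_all _ fun x => by
      simpa only [Real.norm_eq_abs] using (hC x).trans (le_abs_self C))

theorem IsMultiplier.sub {φ φ' ψ ψ' : ℝ → ℝ} (h : IsMultiplier φ φ') (h2 : IsMultiplier ψ ψ') :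
    IsMultiplier (fun x => φ x - ψ x) (fun x => φ' x - ψ' x) := by
  obtain ⟨C, hC⟩ := h.bounded
  obtain ⟨D, hD⟩ := h2.bounded
  obtain ⟨C', hC'⟩ := h.bounded_deriv
  obtain ⟨D', hD'⟩ := h2.bounded_deriv
  refine ⟨h.measurable.sub h2.measurable, h.measurable_deriv.sub h2.measurable_deriv,
    ⟨C + D, fun x => (abs_sub _ _).trans (add_le_add (hC x) (hD x))⟩,
    ⟨C' + D', fun x => (abs_sub _ _).trans (add_le_add (hC' x) (hD' x))⟩, fun x y => ?_⟩
  rcases le_total x y with hxy | hxy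
  · rw [intervalIntegral.integral_sub (h.isPrimitiveOn x y).1 (h2.isPrimitiveOn x y).1,
      ← h.primitive, ← h2.primitive]; ring
  · rw [intervalIntegral.integral_sub (h.isPrimitiveOn x y).1 (h2.isPrimitiveOn x y).1,
      ← h.primitive, ← h2.primitive]; ring

/-- Freezing a continuously differentiable function outside `[a, b]` makes it bounded with bounded
derivative and changes nothing inside. Ramps and truncated exponentials arise this way, and they
preserve `F_p` and `F'_q` even on unbounded intervals. -/
theorem isMultiplier_clamp {G G' : ℝ → ℝ} {a b : ℝ} (hab : a ≤ b)
    (hG : ∀ r, HasDerivAt G (G' r) r) (hG' : Continuous G') :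
    IsMultiplier (fun r => G (max a (min b r))) ((Ioc a b).indicator G') := by
  have hGc : Continuous G := continuous_iff_continuousAt.2 fun r => (hG r).continuousAt
  obtain ⟨C, hC⟩ := (isCompact_Icc (a := a) (b := b)).exists_bound_of_continuousOn hGc.continuousOn
  obtain ⟨D, hD⟩ := (isCompact_Icc (a := a) (b := b)).exists_bound_of_continuousOn hG'.continuousOn
  refine ⟨(hGc.comp (by fun_prop)).measurable, hG'.measurable.indicator measurableSet_Ioc,
    ⟨C, fun x => hC _ ⟨le_max_left _ _, max_le hab (min_le_left _ _)⟩⟩, ⟨|D|, fun x => ?_⟩, ?_⟩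
  · by_cases hx : x ∈ Ioc a b
    · rw [indicator_of_mem hx]
      exact (hD x (Ioc_subset_Icc_self hx)).trans (le_abs_self D)
    · rw [indicator_of_notMem hx]; simp
  have key : ∀ x y, x ≤ y → G (max a (min b y)) - G (max a (min b x))
      = ∫ r in x..y, (Ioc a b).indicator G' r := by
    intro x y hxy
    rw [intervalIntegral.integral_of_le hxy, integral_indicator measurableSet_Ioc,
      Measure.restrict_restrict measurableSet_Ioc, Ioc_inter_Ioc]
    have hFTC : ∀ l u, l ≤ u → ∫ r in Ioc l u, G' r = G u - G l := fun l u hlu => by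
      rw [← intervalIntegral.integral_of_le hlu]
      exact intervalIntegral.integral_eq_sub_of_hasDerivAt (fun r _ => hG r)
        (hG'.intervalIntegrable _ _)
    change _ = ∫ r in Ioc (max a x) (min b y), G' r
    rcases le_total (max a x) (min b y) with h | h
    · rw [hFTC _ _ h]
      have h1 := le_max_left a x
      have h2 := min_le_left b y
      have h3 := le_max_right a x
      rw [max_eq_right (h1.trans h), min_eq_right ((h3.trans h).trans h2)]
    · rw [Ioc_eq_empty (not_lt.2 h), setIntegral_empty]
      have : max a (min b y) = max a (min b x) := by
        rcases le_total a x with h1 | h1 <;> rcases le_total b y with h2 | h2 <;>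
          simp only [h1, h2, max_eq_left, max_eq_right, min_eq_left, min_eq_right] at h ⊢
        · rw [min_eq_left h]
        · have : x = y := le_antisymm hxy h
          rw [this, min_eq_right h2]
        · have : a = b := le_antisymm hab h
          subst this
          rw [max_self, max_eq_left (min_le_left _ _)]
        · rw [min_eq_right (hxy.trans h2), max_eq_left h, max_eq_left h1]
      rw [this, sub_self]
  intro x y
  rcases le_total x y with h | h
  · exact key x y h
  · rw [intervalIntegral.integral_symm, ← key y x h]; ring

/-- The multiplier which is `0` up to `a`, `1` from `a + h` on and affine in between. -/
noncomputable def ramp (a h r : ℝ) : ℝ := (max a (min (a + h) r) - a) / h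

theorem isMultiplier_ramp (a : ℝ) {h : ℝ} (hh : 0 < h) :
    IsMultiplier (ramp a h) ((Ioc a (a + h)).indicator fun _ => h⁻¹) := by
  refine isMultiplier_clamp (G := fun r => (r - a) / h) (by linarith) (fun r => ?_)
    continuous_const
  have := ((hasDerivAt_id r).sub_const a).div_const h
  simpa using this

theorem ramp_nonneg {a h : ℝ} (hh : 0 < h) (r : ℝ) : 0 ≤ ramp a h r :=
  div_nonneg (sub_nonneg.2 (le_max_left _ _)) hh.le

theorem ramp_le_one {a h : ℝ} (hh : 0 < h) (r : ℝ) : ramp a h r ≤ 1 := by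
  rw [ramp, div_le_one hh, sub_le_iff_le_add']
  exact max_le (by linarith) (min_le_left _ _)

theorem ramp_of_le {a h r : ℝ} (hh : 0 < h) (hr : r ≤ a) : ramp a h r = 0 := by
  rw [ramp, min_eq_right (by linarith), max_eq_left hr]; simp

theorem ramp_of_ge {a h r : ℝ} (hh : 0 < h) (hr : a + h ≤ r) : ramp a h r = 1 := by
  rw [ramp, min_eq_left hr, max_eq_right (by linarith)]; simp [hh.ne']

end Intervals

/-! ### Algebra of Sobolev functions, of `F_p` and `F'_q`, and of the equation `(c - G₀)u = f` -/

section Sobolev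

theorem MemLp.intervalIntegrable {Y : Type*} [NormedAddCommGroup Y] {I : Set ℝ} {p : ℝ≥0∞}
    (hp : 1 ≤ p) (hI : I.OrdConnected) {f : ℝ → Y}
    (h : MemLp f p (volume.restrict I)) {s t : ℝ} (hs : s ∈ I) (ht : t ∈ I) (hst : s ≤ t) :
    IntervalIntegrable f volume s t := by
  rw [intervalIntegrable_iff_integrableOn_Ioc_of_le hst]
  exact (h.mono_measure
    (Measure.restrict_mono (Ioc_subset_Icc_self.trans (hI.out hs ht)) le_rfl)).integrable hp

variable {Y : Type*} [NormedAddCommGroup Y] [NormedSpace ℂ Y] {I : Set ℝ} {p : ℝ≥0∞}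

theorem IsSobolev.isPrimitiveOn (hp : 1 ≤ p) (hI : I.OrdConnected) {f f' : ℝ → Y}
    (h : IsSobolev I p f f') {s t : ℝ} (hs : s ∈ I) (ht : t ∈ I) (hst : s ≤ t) :
    IsPrimitiveOn f f' s t := by
  refine ⟨?_, fun x hx => h.2.2 s hs x (hI.out hs ht hx)⟩
  rw [intervalIntegrable_iff_integrableOn_Ioc_of_le hst]
  exact (h.2.1.mono_measure
    (Measure.restrict_mono (Ioc_subset_Icc_self.trans (hI.out hs ht)) le_rfl)).integrable hp

theorem IsSobolev.continuousOn (hp : 1 ≤ p) (hI : I.OrdConnected) {f f' : ℝ → Y}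
    (h : IsSobolev I p f f') : ContinuousOn f I := by
  rcases I.eq_empty_or_nonempty with rfl | ⟨s, hs⟩
  · exact continuousOn_empty f
  have hL : LocallyIntegrable (I.indicator f') :=
    ((memLp_indicator_iff_restrict hI.measurableSet).2 h.2.1).locallyIntegrable hp
  have hc : Continuous fun x => f s + ∫ r in s..x, I.indicator f' r :=
    continuous_const.add (intervalIntegral.continuous_primitive
      (fun a b => (hL.integrableOn_isCompact isCompact_uIcc).intervalIntegrable) s)
  refine hc.continuousOn.congr fun x hx => ?_
  have : ∫ r in s..x, I.indicator f' r = ∫ r in s..x, f' r :=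
    intervalIntegral.integral_congr fun r hr => indicator_of_mem (hI.uIcc_subset hs hx hr) _
  simp only [this, ← h.2.2 s hs x hx]; abel

theorem IsSobolev.add (hp : 1 ≤ p) (hI : I.OrdConnected) {f f' g g' : ℝ → Y}
    (hf : IsSobolev I p f f') (hg : IsSobolev I p g g') :
    IsSobolev I p (fun t => f t + g t) (fun t => f' t + g' t) := by
  refine ⟨hf.1.add hg.1, hf.2.1.add hg.2.1, fun s hs t ht => ?_⟩
  have hi : IntervalIntegrable f' volume s t ∧ IntervalIntegrable g' volume s t := by
    rcases le_total s t with h | h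
    · exact ⟨(hf.isPrimitiveOn hp hI hs ht h).1, (hg.isPrimitiveOn hp hI hs ht h).1⟩
    · exact ⟨(hf.isPrimitiveOn hp hI ht hs h).1.symm, (hg.isPrimitiveOn hp hI ht hs h).1.symm⟩
  rw [intervalIntegral.integral_add hi.1 hi.2, ← hf.2.2 s hs t ht, ← hg.2.2 s hs t ht]
  exact add_sub_add_comm _ _ _ _

theorem IsSobolev.const_smul {f f' : ℝ → Y} (hf : IsSobolev I p f f') (c : ℂ) :
    IsSobolev I p (fun t => c • f t) (fun t => c • f' t) := by
  refine ⟨hf.1.const_smul c, hf.2.1.const_smul c, fun s hs t ht => ?_⟩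
  rw [intervalIntegral.integral_smul, ← hf.2.2 s hs t ht, smul_sub]

theorem IsMultiplier.memLp_smul {φ : ℝ → ℝ} (hφ : Measurable φ) (hb : ∃ C, ∀ x, |φ x| ≤ C)
    {f : ℝ → Y} {μ : Measure ℝ} (hf : MemLp f p μ) : MemLp (fun t => φ t • f t) p μ := by
  obtain ⟨C, hC⟩ := hb
  refine hf.of_le_mul (c := C) (hφ.aestronglyMeasurable.smul hf.1) (ae_of_all _ fun x => ?_)
  rw [norm_smul]
  exact mul_le_mul_of_nonneg_right (hC x) (norm_nonneg _)

theorem IsSobolev.smul [CompleteSpace Y] (hp : 1 ≤ p) (hI : I.OrdConnected) {f f' : ℝ → Y}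
    (hf : IsSobolev I p f f') {φ φ' : ℝ → ℝ} (hφ : IsMultiplier φ φ') :
    IsSobolev I p (fun t => φ t • f t) (fun t => φ' t • f t + φ t • f' t) := by
  refine ⟨IsMultiplier.memLp_smul hφ.measurable hφ.bounded hf.1,
    (IsMultiplier.memLp_smul hφ.measurable_deriv hφ.bounded_deriv hf.1).add
      (IsMultiplier.memLp_smul hφ.measurable hφ.bounded hf.2.1), fun s hs t ht => ?_⟩
  rcases le_total s t with h | h
  · exact ((hφ.isPrimitiveOn s t).smul h (hf.isPrimitiveOn hp hI hs ht h)).2 t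
      (right_mem_Icc.2 h)
  · rw [intervalIntegral.integral_symm,
      ← ((hφ.isPrimitiveOn t s).smul h (hf.isPrimitiveOn hp hI ht hs h)).2 s (right_mem_Icc.2 h)]
    abel

variable {A : ℝ → Y →ₗ.[ℂ] Y}

theorem MemF.add (hp : 1 ≤ p) (hI : I.OrdConnected) {u u' z v v' y : ℝ → Y}
    (hu : MemF I p A u u' z) (hv : MemF I p A v v' y) :
    MemF I p A (fun t => u t + v t) (fun t => u' t + v' t) (fun t => z t + y t) where
  sobolev := hu.sobolev.add hp hI hv.sobolev
  left_zero a ha := by simpa using (hu.left_zero a ha).add (hv.left_zero a ha)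
  memLp := hu.memLp.add hv.memLp
  graph := by
    filter_upwards [hu.graph, hv.graph] with t h1 h2
    exact (A t).graph.add_mem h1 h2

theorem MemF.const_smul {u u' z : ℝ → Y} (hu : MemF I p A u u' z) (c : ℂ) :
    MemF I p A (fun t => c • u t) (fun t => c • u' t) (fun t => c • z t) where
  sobolev := hu.sobolev.const_smul c
  left_zero a ha := by simpa using (hu.left_zero a ha).const_smul c
  memLp := hu.memLp.const_smul c
  graph := by
    filter_upwards [hu.graph] with t h1
    exact (A t).graph.smul_mem c h1

theorem MemF.smul [CompleteSpace Y] (hp : 1 ≤ p) (hI : I.OrdConnected) {u u' z : ℝ → Y}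
    (hu : MemF I p A u u' z) {φ φ' : ℝ → ℝ} (hφ : IsMultiplier φ φ') :
    MemF I p A (fun t => φ t • u t) (fun t => φ' t • u t + φ t • u' t) (fun t => φ t • z t) where
  sobolev := hu.sobolev.smul hp hI hφ
  left_zero a ha := by
    obtain ⟨C, hC⟩ := hφ.bounded
    have h1 := ((hu.left_zero a ha).norm).const_mul C
    rw [norm_zero, mul_zero] at h1
    refine squeeze_zero_norm (fun t => ?_) h1
    rw [norm_smul]
    exact mul_le_mul_of_nonneg_right (hC t) (norm_nonneg _)
  memLp := IsMultiplier.memLp_smul hφ.measurable hφ.bounded hu.memLp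
  graph := by
    filter_upwards [hu.graph] with t h1
    exact graph_real_smul h1 _

theorem MemFBackward.smul [CompleteSpace Y] (hp : 1 ≤ p) (hI : I.OrdConnected) {u u' z : ℝ → Y}
    (hu : MemFBackward I p A u u' z) {φ φ' : ℝ → ℝ} (hφ : IsMultiplier φ φ') :
    MemFBackward I p A (fun t => φ t • u t) (fun t => φ' t • u t + φ t • u' t)
      (fun t => φ t • z t) where
  sobolev := hu.sobolev.smul hp hI hφ
  right_zero b hb := by rw [hu.right_zero b hb, smul_zero]
  memLp := IsMultiplier.memLp_smul hφ.measurable hφ.bounded hu.memLp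
  graph := by
    filter_upwards [hu.graph] with t h1
    exact graph_real_smul h1 _

/-- To the left of any time `u` takes arbitrarily small values: at a finite left end point by the
boundary condition, on a half-line because otherwise a superlevel set of an `L^p` function would
have infinite measure. -/
theorem MemF.exists_norm_le (hI : IsTimeInterval I) (hp0 : p ≠ 0) (hp : p ≠ ⊤) {u u' z : ℝ → Y}
    (hu : MemF I p A u u' z) {t : ℝ} (ht : t ∈ I) {ε : ℝ} (hε : 0 < ε) :
    ∃ s ∈ I, s < t ∧ ‖u s‖ ≤ ε := by
  have unbdd : Iic t ⊆ I → ∃ s ∈ I, s < t ∧ ‖u s‖ ≤ ε := by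
    intro hsub
    by_contra! hcon
    have h1 := (hu.sobolev.1.mono_measure
      (Measure.restrict_mono hsub le_rfl)).meas_ge_lt_top hp0 hp (ε := ⟨ε, hε.le⟩)
        (fun h => hε.ne' (congrArg NNReal.toReal h))
    have h2 : volume (Iio t) ≤ (volume.restrict (Iic t)) {x | (⟨ε, hε.le⟩ : NNReal) ≤ ‖u x‖₊} := by
      rw [Measure.restrict_apply' measurableSet_Iic]
      refine measure_mono fun s (hs : s < t) => ?_
      exact ⟨(hcon s (hsub hs.le) hs).le, hs.le⟩
    rw [Real.volume_Iio] at h2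
    exact absurd (h2.trans_lt h1) (lt_irrefl _)
  rcases hI with ⟨a, b, hab, rfl⟩ | ⟨b, rfl⟩ | rfl
  · have h1 := hu.left_zero a (isGLB_Ioc hab)
    have h2 : ∀ᶠ s in 𝓝[Ioc a b] a, ‖u s‖ < ε := by
      have := h1.norm
      rw [norm_zero] at this
      exact this.eventually_lt_const hε
    have h3 : ∀ᶠ s in 𝓝[Ioc a b] a, s < t := mem_nhdsWithin_of_mem_nhds (Iio_mem_nhds ht.1)
    have : (𝓝[Ioc a b] a).NeBot := by
      rw [nhdsWithin_Ioc_eq_nhdsGT hab]; infer_instance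
    obtain ⟨s, hs⟩ := (h2.and (h3.and self_mem_nhdsWithin)).exists
    exact ⟨s, hs.2.2, hs.2.1, hs.1.le⟩
  · exact unbdd (Iic_subset_Iic.2 ht)
  · exact unbdd (subset_univ _)

/-- `u ∈ F_p` and `f = (c - G₀)u` almost everywhere. -/
def ResolventPair (I : Set ℝ) (p : ℝ≥0∞) (A : ℝ → Y →ₗ.[ℂ] Y) (c : ℝ) (f u : ℝ → Y) : Prop :=
  ∃ u' z : ℝ → Y, MemF I p A u u' z ∧
    f =ᵐ[volume.restrict I] fun t => (c : ℂ) • u t - (-u' t + z t)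

variable {c : ℝ}

theorem ResolventPair.memLp {f u : ℝ → Y} (h : ResolventPair I p A c f u) :
    MemLp f p (volume.restrict I) := by
  obtain ⟨u', z, hu, hf⟩ := h
  exact (memLp_congr_ae hf).2
    ((hu.sobolev.1.const_smul (c : ℂ)).sub (hu.sobolev.2.1.neg.add hu.memLp))

theorem ResolventPair.memLp_right {f u : ℝ → Y} (h : ResolventPair I p A c f u) :
    MemLp u p (volume.restrict I) := by
  obtain ⟨u', z, hu, hf⟩ := h
  exact hu.sobolev.1

theorem ResolventPair.add (hp : 1 ≤ p) (hI : I.OrdConnected) {f u g v : ℝ → Y}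
    (hu : ResolventPair I p A c f u) (hv : ResolventPair I p A c g v) :
    ResolventPair I p A c (fun t => f t + g t) (fun t => u t + v t) := by
  obtain ⟨u', z, hu, hf⟩ := hu
  obtain ⟨v', y, hv, hg⟩ := hv
  refine ⟨_, _, hu.add hp hI hv, ?_⟩
  filter_upwards [hf, hg] with t h1 h2
  rw [h1, h2, smul_add]; abel

theorem ResolventPair.const_smul {f u : ℝ → Y}
    (hu : ResolventPair I p A c f u) (k : ℂ) :
    ResolventPair I p A c (fun t => k • f t) (fun t => k • u t) := by
  obtain ⟨u', z, hu, hf⟩ := hu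
  refine ⟨_, _, hu.const_smul k, ?_⟩
  filter_upwards [hf] with t h1
  rw [h1, smul_sub, smul_add, smul_neg, smul_comm]

theorem ResolventPair.sub (hp : 1 ≤ p) (hI : I.OrdConnected) {f u g v : ℝ → Y}
    (hu : ResolventPair I p A c f u) (hv : ResolventPair I p A c g v) :
    ResolventPair I p A c (fun t => f t - g t) (fun t => u t - v t) := by
  have := hu.add hp hI (hv.const_smul (-1))
  simpa [sub_eq_add_neg] using this

theorem ResolventPair.smul [CompleteSpace Y] (hp : 1 ≤ p) (hI : I.OrdConnected) {f u : ℝ → Y}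
    (hu : ResolventPair I p A c f u) {φ φ' : ℝ → ℝ} (hφ : IsMultiplier φ φ') :
    ResolventPair I p A c (fun t => φ t • f t + φ' t • u t) (fun t => φ t • u t) := by
  obtain ⟨u', z, hu, hf⟩ := hu
  refine ⟨_, _, hu.smul hp hI hφ, ?_⟩
  filter_upwards [hf] with t h1
  rw [h1, smul_sub, smul_add, smul_neg, smul_comm]
  abel

theorem ResolventPair.continuousOn (hp : 1 ≤ p) (hI : I.OrdConnected) {f u : ℝ → Y}
    (hu : ResolventPair I p A c f u) : ContinuousOn u I := by
  obtain ⟨u', z, hu, hf⟩ := hu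
  exact hu.sobolev.continuousOn hp hI

theorem ResolventPair.norm_le [CompleteSpace Y] (hp : 1 ≤ p) (hI : I.OrdConnected) {M w : ℝ}
    (hK : KatoStable (· ≥ ·) I A M w) {f u : ℝ → Y} (hu : ResolventPair I p A c f u)
    {s t : ℝ} (hs : s ∈ I) (ht : t ∈ I) (hst : s ≤ t) (hM1 : s = t → 1 ≤ M) :
    ‖u t‖ ≤ M * (Real.exp (-(c - w) * (t - s)) * ‖u s‖
      + ∫ r in Ioc s t, Real.exp (-(c - w) * (t - r)) * ‖f r‖) := by
  obtain ⟨u', z, hu, hf⟩ := hu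
  rcases hst.eq_or_lt with rfl | hst'
  · simpa using le_mul_of_one_le_left (norm_nonneg _) (hM1 rfl)
  have hsub : Ioc s t ⊆ I := Ioc_subset_Icc_self.trans (hI.out hs ht)
  have hmono : volume.restrict (Ioc s t) ≤ volume.restrict I := Measure.restrict_mono hsub le_rfl
  have := hK.norm_le_exp hst' hsub (hu.sobolev.isPrimitiveOn hp hI hs ht hst)
    (MemLp.intervalIntegrable hp hI hu.memLp hs ht hst) (hmono.absolutelyContinuous.ae_le hu.graph) c
  rw [intervalIntegral.integral_of_le hst] at this
  convert this using 3
  refine integral_congr_ae ?_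
  filter_upwards [hmono.absolutelyContinuous.ae_le hf] with r hr
  rw [hr]; congr 2; abel

end Sobolev

/-! ### The exponentially weighted norm of the forcing -/

section Decay

/-- The convolution kernel `exp (-δ x)` on `[0, ∞)`. -/
noncomputable def decayKernel (δ : ℝ) : ℝ → ℝ := (Ici 0).indicator fun x => Real.exp (-δ * x)

theorem decayKernel_nonneg (δ x : ℝ) : 0 ≤ decayKernel δ x :=
  indicator_nonneg (fun _ _ => (Real.exp_pos _).le) x

theorem decayKernel_of_nonneg {δ x : ℝ} (hx : 0 ≤ x) : decayKernel δ x = Real.exp (-δ * x) :=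
  indicator_of_mem (mem_Ici.2 hx) _

theorem decayKernel_of_neg {δ x : ℝ} (hx : x < 0) : decayKernel δ x = 0 :=
  indicator_of_notMem (by simpa using hx) _

theorem decayKernel_le_one {δ : ℝ} (hδ : 0 < δ) (x : ℝ) : decayKernel δ x ≤ 1 := by
  rcases lt_or_ge x 0 with h | h
  · rw [decayKernel_of_neg h]; exact zero_le_one
  · rw [decayKernel_of_nonneg h, Real.exp_le_one_iff]; nlinarith

theorem memLp_decayKernel {δ : ℝ} (hδ : 0 < δ) {q : ℝ≥0∞} (hq0 : q ≠ 0) (hq : q ≠ ⊤) :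
    MemLp (decayKernel δ) q := by
  have hq' : 0 < q.toReal := ENNReal.toReal_pos hq0 hq
  have hm : AEStronglyMeasurable (decayKernel δ) volume :=
    ((by fun_prop : Continuous fun x => Real.exp (-δ * x)).measurable.indicator
      measurableSet_Ici).aestronglyMeasurable
  rw [← integrable_norm_rpow_iff hm hq0 hq]
  have h1 := (integrable_indicator_iff measurableSet_Ici).2
    ((integrableOn_Ici_iff_integrableOn_Ioi).2
      (exp_neg_integrableOn_Ioi 0 (b := δ * q.toReal) (by positivity)))
  refine h1.congr (ae_of_all _ fun x => ?_)
  beta_reduce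
  rcases lt_or_ge x 0 with h | h
  · rw [decayKernel_of_neg h, norm_zero, Real.zero_rpow hq'.ne',
      indicator_of_notMem (by simpa using h)]
  · rw [decayKernel_of_nonneg h, indicator_of_mem (mem_Ici.2 h),
      Real.norm_of_nonneg (Real.exp_pos _).le, ← Real.exp_mul]
    congr 1; ring

theorem exists_holderConjugate {p : ℝ≥0∞} (hp : 1 < p) : ∃ q : ℝ≥0∞, p.HolderConjugate q ∧ q ≠ ⊤ := by
  have h : p.HolderConjugate (1 - p⁻¹)⁻¹ := by
    rw [ENNReal.holderConjugate_iff, inv_inv]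
    exact add_tsub_cancel_of_le (ENNReal.inv_le_one.2 hp.le)
  refine ⟨_, h, fun hq => ?_⟩
  rw [ENNReal.inv_eq_top, tsub_eq_zero_iff_le] at hq
  exact absurd hp (not_lt.2 (ENNReal.one_le_inv.1 hq))

variable {Y : Type*} [NormedAddCommGroup Y] {I : Set ℝ}

/-- The exponentially weighted `L¹` norm of `f` on `I ∩ (-∞, t]`. -/
noncomputable def decayNorm (δ : ℝ) (I : Set ℝ) (f : ℝ → Y) (t : ℝ) : ℝ :=
  ∫ r in I, decayKernel δ (t - r) * ‖f r‖

/-- Hölder's inequality with the kernel in the conjugate space; translation invariance makes the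
constant independent of `t`. This is how `L^p` control of the forcing becomes uniform control of the
solution. -/
theorem exists_decayNorm_le (Y : Type*) [NormedAddCommGroup Y] {p : ℝ≥0∞} (hp : 1 < p)
    {δ : ℝ} (hδ : 0 < δ) (I : Set ℝ) :
    ∃ C : ℝ, 0 ≤ C ∧ ∀ (t : ℝ) (f : ℝ → Y), MemLp f p (volume.restrict I) →
      IntegrableOn (fun r => decayKernel δ (t - r) * ‖f r‖) I ∧
      decayNorm δ I f t ≤ C * (eLpNorm f p (volume.restrict I)).toReal := by
  obtain ⟨q, hpq, hq⟩ := exists_holderConjugate hp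
  have := hpq
  have hq0 : q ≠ 0 := ENNReal.HolderConjugate.ne_zero q p
  have hK := memLp_decayKernel hδ hq0 hq
  refine ⟨(eLpNorm (decayKernel δ) q volume).toReal, ENNReal.toReal_nonneg, fun t f hf => ?_⟩
  have hmp : MeasurePreserving (fun r : ℝ => t - r) volume volume :=
    Measure.measurePreserving_sub_left volume t
  have hKt : MemLp (fun r => decayKernel δ (t - r)) q (volume.restrict I) :=
    (hK.comp_measurePreserving hmp).restrict I
  have hle : eLpNorm (fun r => decayKernel δ (t - r)) q (volume.restrict I)
      ≤ eLpNorm (decayKernel δ) q volume :=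
    (eLpNorm_mono_measure _ Measure.restrict_le_self).trans_eq
      (eLpNorm_comp_measurePreserving hK.1 hmp)
  have hint : Integrable (fun r => decayKernel δ (t - r) * ‖f r‖) (volume.restrict I) :=
    hKt.integrable_mul hf.norm
  refine ⟨hint, ?_⟩
  have h1 : decayNorm δ I f t
      = (eLpNorm ((fun r => decayKernel δ (t - r)) • fun r => ‖f r‖) 1 (volume.restrict I)).toReal := by
    rw [eLpNorm_one_eq_lintegral_enorm, decayNorm]
    refine Eq.trans ?_ (integral_norm_eq_lintegral_enorm hint.1)
    refine integral_congr_ae (ae_of_all _ fun r => ?_)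
    exact (Real.norm_of_nonneg (mul_nonneg (decayKernel_nonneg _ _) (norm_nonneg _))).symm
  rw [h1, ← ENNReal.toReal_mul]
  refine ENNReal.toReal_mono (ENNReal.mul_ne_top hK.2.ne hf.2.ne) ?_
  refine (eLpNorm_smul_le_mul_eLpNorm (p := q) (q := p) (r := 1) hf.norm.1 hKt.1).trans ?_
  rw [eLpNorm_norm]
  gcongr

end Decay

/-! ### Mild solutions of `(c - G)v = f`: existence, estimates, causality -/

section Mild

variable {Y : Type*} [NormedAddCommGroup Y] [NormedSpace ℂ Y] {I : Set ℝ} {p : ℝ≥0∞}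
  {A : ℝ → Y →ₗ.[ℂ] Y} {M w c : ℝ}

/-- The part of `ForwardAssumptions` that is needed to construct the evolution family, with fixed
constants and the density of `F_p` in `C₀(I, Y)` replaced by that of the values at each time. -/
structure IsSolvable (I : Set ℝ) (p : ℝ≥0∞) (A : ℝ → Y →ₗ.[ℂ] Y) (M w c : ℝ) : Prop where
  interval : IsTimeInterval I
  one_lt : 1 < p
  ne_top : p ≠ ⊤
  kato : KatoStable (· ≥ ·) I A M w
  lt : w < c
  dense_range : ∀ g : ℝ → Y, MemLp g p (volume.restrict I) → ∀ ε : ℝ≥0∞, 0 < ε →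
    ∃ f u : ℝ → Y, ResolventPair I p A c f u ∧
      eLpNorm (fun t => f t - g t) p (volume.restrict I) ≤ ε
  dense : ∀ g : ℝ → Y, MemLp g p (volume.restrict I) → ∀ ε : ℝ≥0∞, 0 < ε →
    ∃ f u : ℝ → Y, ResolventPair I p A c f u ∧
      eLpNorm (fun t => u t - g t) p (volume.restrict I) ≤ ε
  dense_values : ∀ t ∈ I, ∀ y : Y, ∀ ε : ℝ, 0 < ε →
    ∃ f u : ℝ → Y, ResolventPair I p A c f u ∧ ‖u t - y‖ < ε

/-- The a priori estimate on `(s, t]`, with `s` chosen further left where `u s` is negligible, so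
that only the forcing term remains. -/
theorem ResolventPair.norm_le_decayNorm [CompleteSpace Y] (hI : IsTimeInterval I) (hp : 1 < p) (hp' : p ≠ ⊤)
    (hK : KatoStable (· ≥ ·) I A M w) (hc : w < c) {f u : ℝ → Y}
    (hu : ResolventPair I p A c f u) {t : ℝ} (ht : t ∈ I) :
    ‖u t‖ ≤ M * decayNorm (c - w) I f t := by
  have hM := hK.nonneg
  obtain ⟨C, -, hC⟩ := exists_decayNorm_le Y hp (sub_pos.2 hc) I
  have hint := (hC t f hu.memLp).1
  refine le_of_forall_pos_le_add fun ε hε => ?_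
  obtain ⟨u', z, huF, hf⟩ := id hu
  obtain ⟨s, hs, hst, hus⟩ := huF.exists_norm_le hI (by positivity) hp' ht
    (ε := ε / (M + 1)) (by positivity)
  have h1 := hu.norm_le hp.le hI.ordConnected hK hs ht hst.le (fun h => absurd h hst.ne)
  have h2 : ∫ r in Ioc s t, Real.exp (-(c - w) * (t - r)) * ‖f r‖ ≤ decayNorm (c - w) I f t := by
    have e : ∫ r in Ioc s t, Real.exp (-(c - w) * (t - r)) * ‖f r‖
        = ∫ r in Ioc s t, decayKernel (c - w) (t - r) * ‖f r‖ :=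
      setIntegral_congr_fun measurableSet_Ioc fun r hr => by
        simp only [decayKernel_of_nonneg (sub_nonneg.2 hr.2)]
    rw [e]
    exact setIntegral_mono_set hint
      (ae_of_all _ fun r => mul_nonneg (decayKernel_nonneg _ _) (norm_nonneg _))
      (hI.Ioc_subset hs ht).eventuallyLE
  have h3 : Real.exp (-(c - w) * (t - s)) * ‖u s‖ ≤ ε / (M + 1) := by
    have : Real.exp (-(c - w) * (t - s)) ≤ 1 := by
      rw [Real.exp_le_one_iff]; nlinarith
    exact (mul_le_of_le_one_left (norm_nonneg _) this).trans hus
  calc ‖u t‖ ≤ M * (ε / (M + 1) + decayNorm (c - w) I f t) := h1.trans (by gcongr)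
    _ = M * decayNorm (c - w) I f t + ε * (M / (M + 1)) := by ring
    _ ≤ _ := by
      have : M / (M + 1) ≤ 1 := by rw [div_le_one (by positivity)]; linarith
      nlinarith

/-- `v` is the (mild) solution of `(c - G)v = f`, where `G` is the closure of `G₀`. -/
def IsMild (I : Set ℝ) (p : ℝ≥0∞) (A : ℝ → Y →ₗ.[ℂ] Y) (c : ℝ) (f v : ℝ → Y) : Prop :=
  MemLp f p (volume.restrict I) ∧ ∀ ε : ℝ, 0 < ε → ∃ g u : ℝ → Y, ResolventPair I p A c g u ∧
    (eLpNorm (fun t => g t - f t) p (volume.restrict I)).toReal ≤ ε ∧ ∀ t ∈ I, ‖u t - v t‖ ≤ ε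

theorem ResolventPair.isMild {f u : ℝ → Y} (h : ResolventPair I p A c f u) :
    IsMild I p A c f u :=
  ⟨h.memLp, fun ε hε => ⟨f, u, h, by simpa using hε.le, fun t _ => by simpa using hε.le⟩⟩

theorem IsMild.const_smul {f v : ℝ → Y} (h : IsMild I p A c f v) (k : ℂ) :
    IsMild I p A c (fun t => k • f t) (fun t => k • v t) := by
  refine ⟨h.1.const_smul k, fun ε hε => ?_⟩
  obtain ⟨g, u, h1, h2, h3⟩ := h.2 (ε / (‖k‖ + 1)) (by positivity)
  have hk : ‖k‖ * (ε / (‖k‖ + 1)) ≤ ε := by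
    rw [← mul_div_assoc, div_le_iff₀ (by positivity)]; nlinarith [norm_nonneg k]
  refine ⟨_, _, h1.const_smul k, ?_, fun t ht => ?_⟩
  · have : (fun t => k • g t - k • f t) = k • fun t => g t - f t := by
      ext t; simp [smul_sub]
    rw [this, eLpNorm_const_smul, ENNReal.toReal_mul]
    refine le_trans ?_ hk
    simp only [toReal_enorm]
    gcongr
  · rw [← smul_sub, norm_smul]
    exact (mul_le_mul_of_nonneg_left (h3 t ht) (norm_nonneg _)).trans hk

theorem IsMild.add (hp : 1 ≤ p) (hI : I.OrdConnected) {f v g y : ℝ → Y}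
    (h : IsMild I p A c f v) (h' : IsMild I p A c g y) :
    IsMild I p A c (fun t => f t + g t) (fun t => v t + y t) := by
  refine ⟨h.1.add h'.1, fun ε hε => ?_⟩
  obtain ⟨a, u, h1, h2, h3⟩ := h.2 (ε / 2) (by positivity)
  obtain ⟨a', u', h1', h2', h3'⟩ := h'.2 (ε / 2) (by positivity)
  refine ⟨_, _, h1.add hp hI h1', ?_, fun t ht => ?_⟩
  · have e : (fun t => a t + a' t - (f t + g t)) = (fun t => a t - f t) + fun t => a' t - g t := by
      ext t; simp only [Pi.add_apply]; abel
    have m1 : MemLp (fun t => a t - f t) p (volume.restrict I) := h1.memLp.sub h.1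
    have m2 : MemLp (fun t => a' t - g t) p (volume.restrict I) := h1'.memLp.sub h'.1
    rw [e]
    calc _ ≤ (eLpNorm (fun t => a t - f t) p (volume.restrict I)
          + eLpNorm (fun t => a' t - g t) p (volume.restrict I)).toReal :=
          ENNReal.toReal_mono (ENNReal.add_ne_top.2 ⟨m1.2.ne, m2.2.ne⟩)
            (eLpNorm_add_le m1.1 m2.1 hp)
      _ ≤ _ := by
          rw [ENNReal.toReal_add m1.2.ne m2.2.ne]
          linarith
  · have := norm_add_le (u t - v t) (u' t - y t)
    rw [add_sub_add_comm]
    linarith [h3 t ht, h3' t ht]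

theorem IsMild.sub (hp : 1 ≤ p) (hI : I.OrdConnected) {f v g y : ℝ → Y}
    (h : IsMild I p A c f v) (h' : IsMild I p A c g y) :
    IsMild I p A c (fun t => f t - g t) (fun t => v t - y t) := by
  have := h.add hp hI (h'.const_smul (-1))
  simpa [sub_eq_add_neg] using this

theorem IsMild.continuousOn (hp : 1 ≤ p) (hI : I.OrdConnected) {f v : ℝ → Y}
    (h : IsMild I p A c f v) : ContinuousOn v I := by
  refine continuousOn_of_uniform_approx_of_continuousOn fun U hU => ?_
  obtain ⟨ε, hε, hεU⟩ := Metric.mem_uniformity_dist.1 hU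
  obtain ⟨g, u, h1, -, h3⟩ := h.2 (ε / 2) (by positivity)
  refine ⟨u, h1.continuousOn hp hI, fun t ht => hεU ?_⟩
  rw [dist_eq_norm, norm_sub_rev]
  linarith [h3 t ht]

variable [CompleteSpace Y]

theorem IsMild.norm_le (hS : IsSolvable I p A M w c) {f v : ℝ → Y} (h : IsMild I p A c f v)
    {t : ℝ} (ht : t ∈ I) : ‖v t‖ ≤ M * decayNorm (c - w) I f t := by
  have hM := hS.kato.nonneg
  obtain ⟨C, hC0, hC⟩ := exists_decayNorm_le Y hS.one_lt (sub_pos.2 hS.lt) I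
  refine le_of_forall_pos_le_add fun ε hε => ?_
  obtain ⟨g, u, h1, h2, h3⟩ := h.2 (ε / (1 + M * C)) (by positivity)
  have hd : MemLp (fun r => g r - f r) p (volume.restrict I) := h1.memLp.sub h.1
  have hgf : decayNorm (c - w) I g t ≤ decayNorm (c - w) I f t
      + decayNorm (c - w) I (fun r => g r - f r) t := by
    rw [decayNorm, decayNorm, decayNorm,
      ← integral_add (hC t f h.1).1 (hC t (fun r => g r - f r) hd).1]
    refine integral_mono (hC t g h1.memLp).1 ((hC t f h.1).1.add (hC t _ hd).1) fun r => ?_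
    have := norm_add_le (f r) (g r - f r)
    rw [add_sub_cancel] at this
    simp only [← mul_add]
    exact mul_le_mul_of_nonneg_left this (decayKernel_nonneg _ _)
  have h4 := h1.norm_le_decayNorm hS.interval hS.one_lt hS.ne_top hS.kato hS.lt ht
  have h5 : decayNorm (c - w) I (fun r => g r - f r) t ≤ C * (ε / (1 + M * C)) :=
    (hC t _ hd).2.trans (by gcongr)
  have h6 : ‖v t‖ ≤ ‖u t‖ + ‖u t - v t‖ := by
    have := norm_sub_le (u t) (u t - v t)
    rwa [sub_sub_cancel] at this
  calc ‖v t‖ ≤ M * (decayNorm (c - w) I f t + C * (ε / (1 + M * C))) + ε / (1 + M * C) := by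
        refine h6.trans (add_le_add (h4.trans ?_) (h3 t ht))
        gcongr
        exact hgf.trans (by gcongr)
    _ = M * decayNorm (c - w) I f t + (1 + M * C) * (ε / (1 + M * C)) := by ring
    _ = _ := by field_simp

/-- Without forcing on `(s, t]` the past acts on `v t` only through `v s`; this is what makes the
map `v s ↦ v t` well defined and bounded. -/
theorem IsMild.norm_le_of_ae_zero (hS : IsSolvable I p A M w c) {f v : ℝ → Y}
    (h : IsMild I p A c f v) {s t : ℝ} (hs : s ∈ I) (ht : t ∈ I) (hst : s < t)
    (hf : ∀ᵐ r ∂(volume.restrict I), r ∈ Ioc s t → f r = 0) :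
    ‖v t‖ ≤ M * (Real.exp (-(c - w) * (t - s)) * ‖v s‖) := by
  have hM := hS.kato.nonneg
  obtain ⟨C, hC0, hC⟩ := exists_decayNorm_le Y hS.one_lt (sub_pos.2 hS.lt) I
  have hexp : Real.exp (-(c - w) * (t - s)) ≤ 1 := by
    rw [Real.exp_le_one_iff]; nlinarith [hS.lt]
  refine le_of_forall_pos_le_add fun ε hε => ?_
  obtain ⟨g, u, h1, h2, h3⟩ := h.2 (ε / (1 + M + M * C)) (by positivity)
  set κ := ε / (1 + M + M * C) with hκ
  have hκ0 : 0 < κ := by positivity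
  have hd : MemLp (fun r => g r - f r) p (volume.restrict I) := h1.memLp.sub h.1
  have h4 := h1.norm_le hS.one_lt.le hS.interval.ordConnected hS.kato hs ht hst.le
    (fun e => absurd e hst.ne)
  have hsub := hS.interval.Ioc_subset hs ht
  have h5 : ∫ r in Ioc s t, Real.exp (-(c - w) * (t - r)) * ‖g r‖ ≤ C * κ := by
    have e : ∫ r in Ioc s t, Real.exp (-(c - w) * (t - r)) * ‖g r‖
        = ∫ r in Ioc s t, decayKernel (c - w) (t - r) * ‖g r - f r‖ := by
      refine integral_congr_ae ?_
      have := (Measure.restrict_mono hsub (le_refl volume)).absolutelyContinuous.ae_le hf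
      filter_upwards [this, ae_restrict_mem measurableSet_Ioc] with r h1 h2
      rw [h1 h2, sub_zero, decayKernel_of_nonneg (sub_nonneg.2 h2.2)]
    rw [e]
    refine (setIntegral_mono_set (hC t _ hd).1
      (ae_of_all _ fun r => mul_nonneg (decayKernel_nonneg _ _) (norm_nonneg _))
      hsub.eventuallyLE).trans ((hC t _ hd).2.trans ?_)
    gcongr
  have h6 : ‖v t‖ ≤ ‖u t‖ + κ := by
    have := norm_sub_le (u t) (u t - v t)
    rw [sub_sub_cancel] at this
    linarith [h3 t ht]
  have h7 : ‖u s‖ ≤ ‖v s‖ + κ := by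
    have := norm_add_le (v s) (u s - v s)
    rw [add_sub_cancel] at this
    linarith [h3 s hs]
  have h8 : Real.exp (-(c - w) * (t - s)) * ‖u s‖
      ≤ Real.exp (-(c - w) * (t - s)) * ‖v s‖ + κ := by
    have := Real.exp_pos (-(c - w) * (t - s))
    nlinarith
  calc ‖v t‖ ≤ M * ((Real.exp (-(c - w) * (t - s)) * ‖v s‖ + κ) + C * κ) + κ := by
        refine h6.trans ?_
        gcongr
        refine h4.trans ?_
        gcongr
    _ = M * (Real.exp (-(c - w) * (t - s)) * ‖v s‖) + (1 + M + M * C) * κ := by ring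
    _ = _ := by rw [hκ]; field_simp

theorem IsMild.norm_le_setIntegral (hS : IsSolvable I p A M w c) {f v : ℝ → Y}
    (h : IsMild I p A c f v) {s t : ℝ} (ht : t ∈ I)
    (hf : ∀ᵐ r ∂(volume.restrict I), r ≤ s → f r = 0) :
    ‖v t‖ ≤ M * ∫ r in Ioc s t, ‖I.indicator f r‖ := by
  have hM := hS.kato.nonneg
  obtain ⟨C, hC0, hC⟩ := exists_decayNorm_le Y hS.one_lt (sub_pos.2 hS.lt) I
  refine (h.norm_le hS ht).trans (mul_le_mul_of_nonneg_left ?_ hM)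
  have hm := hS.interval.measurableSet
  have hint : Integrable ((Ioc s t).indicator fun r => ‖I.indicator f r‖) := by
    refine (integrable_indicator_iff measurableSet_Ioc).2 (Integrable.norm ?_)
    exact (((memLp_indicator_iff_restrict hm).2 h.1).restrict (Ioc s t)).integrable hS.one_lt.le
  rw [decayNorm, ← integral_indicator measurableSet_Ioc, ← integral_indicator hm]
  refine integral_mono_ae ((integrable_indicator_iff hm).2 (hC t f h.1).1) hint ?_
  filter_upwards [(ae_restrict_iff' hm).1 hf] with r hr
  by_cases hrI : r ∈ I
  · rw [indicator_of_mem hrI]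
    rcases le_or_gt r s with h1 | h1
    · rw [hr hrI h1, norm_zero, mul_zero]
      exact indicator_nonneg (fun _ _ => norm_nonneg _) r
    · rcases le_or_gt r t with h2 | h2
      · rw [indicator_of_mem (mem_Ioc.2 ⟨h1, h2⟩), indicator_of_mem hrI]
        exact mul_le_of_le_one_left (norm_nonneg _) (decayKernel_le_one (sub_pos.2 hS.lt) _)
      · rw [decayKernel_of_neg (sub_neg.2 h2), zero_mul]
        exact indicator_nonneg (fun _ _ => norm_nonneg _) r
  · rw [indicator_of_notMem hrI]
    exact indicator_nonneg (fun _ _ => norm_nonneg _) r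

/-- Causality: the bounding integral extends over the empty interval `(t, t]`. -/
theorem IsMild.eq_zero (hS : IsSolvable I p A M w c) {f v : ℝ → Y}
    (h : IsMild I p A c f v) {t : ℝ} (ht : t ∈ I)
    (hf : ∀ᵐ r ∂(volume.restrict I), r ≤ t → f r = 0) : v t = 0 := by
  have := h.norm_le_setIntegral hS ht hf
  simpa using this

theorem IsMild.eq_of_ae_eq (hS : IsSolvable I p A M w c) {f g v y : ℝ → Y}
    (h : IsMild I p A c f v) (h' : IsMild I p A c g y) {t : ℝ} (ht : t ∈ I)
    (hf : ∀ᵐ r ∂(volume.restrict I), r ≤ t → f r = g r) : v t = y t := by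
  have := (h.sub hS.one_lt.le hS.interval.ordConnected h').eq_zero hS ht
    (hf.mono fun r hr hrt => sub_eq_zero.2 (hr hrt))
  exact sub_eq_zero.1 this

/-- Forcings in the dense range of `c - G₀` that converge to `f` in `L^p` have uniformly Cauchy
solutions, by the weighted estimate applied to differences. -/
theorem IsSolvable.exists_isMild (hS : IsSolvable I p A M w c) {f : ℝ → Y}
    (hf : MemLp f p (volume.restrict I)) : ∃ v, IsMild I p A c f v := by
  have hM := hS.kato.nonneg
  obtain ⟨C, hC0, hC⟩ := exists_decayNorm_le Y hS.one_lt (sub_pos.2 hS.lt) I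
  have hpos : ∀ n : ℕ, (0 : ℝ) < 1 / (n + 1) := fun n => by positivity
  choose g u hgu hg using fun n : ℕ => hS.dense_range f hf (ENNReal.ofReal (1 / (n + 1)))
    (by simpa using hpos n)
  have hg' : ∀ n, (eLpNorm (fun t => g n t - f t) p (volume.restrict I)).toReal
      ≤ 1 / ((n : ℝ) + 1) := fun n => ENNReal.toReal_le_of_le_ofReal (hpos n).le (hg n)
  have key : ∀ n m t, t ∈ I → ‖u n t - u m t‖ ≤ M * C * (1 / ((n : ℝ) + 1) + 1 / ((m : ℝ) + 1)) := by
    intro n m t ht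
    have hd := (hgu n).sub hS.one_lt.le hS.interval.ordConnected (hgu m)
    have h1 := hd.norm_le_decayNorm hS.interval hS.one_lt hS.ne_top hS.kato hS.lt ht
    have h2 := (hC t _ hd.memLp).2
    have m1 : MemLp (fun t => g n t - f t) p (volume.restrict I) := (hgu n).memLp.sub hf
    have m2 : MemLp (fun t => g m t - f t) p (volume.restrict I) := (hgu m).memLp.sub hf
    have h3 : (eLpNorm (fun t => g n t - g m t) p (volume.restrict I)).toReal
        ≤ 1 / ((n : ℝ) + 1) + 1 / ((m : ℝ) + 1) := by
      have e : (fun t => g n t - g m t) = (fun t => g n t - f t) - fun t => g m t - f t := by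
        ext t; simp
      rw [e]
      calc _ ≤ (eLpNorm (fun t => g n t - f t) p (volume.restrict I)
            + eLpNorm (fun t => g m t - f t) p (volume.restrict I)).toReal :=
            ENNReal.toReal_mono (ENNReal.add_ne_top.2 ⟨m1.2.ne, m2.2.ne⟩)
              (eLpNorm_sub_le m1.1 m2.1 hS.one_lt.le)
        _ ≤ _ := by
            rw [ENNReal.toReal_add m1.2.ne m2.2.ne]
            exact add_le_add (hg' n) (hg' m)
    calc _ ≤ M * (C * (1 / ((n : ℝ) + 1) + 1 / ((m : ℝ) + 1))) := by
          refine h1.trans ?_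
          gcongr
          exact h2.trans (by gcongr)
      _ = _ := by ring
  have hlim : ∀ t, ∃ y, t ∈ I → Tendsto (fun n => u n t) atTop (𝓝 y) := by
    intro t
    by_cases ht : t ∈ I
    · have hcs : CauchySeq fun n => u n t := by
        refine cauchySeq_of_le_tendsto_0 (fun N : ℕ => M * C * (1 / ((N : ℝ) + 1) + 1 / ((N : ℝ) + 1)))
          (fun n m N hn hm => ?_) ?_
        · rw [dist_eq_norm]
          refine (key n m t ht).trans ?_
          gcongr
        · have := tendsto_one_div_add_atTop_nhds_zero_nat (𝕜 := ℝ)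
          simpa using (this.add this).const_mul (M * C)
      obtain ⟨y, hy⟩ := cauchySeq_tendsto_of_complete hcs
      exact ⟨y, fun _ => hy⟩
    · exact ⟨0, fun h => absurd h ht⟩
  choose v hv using hlim
  have hclose : ∀ n t, t ∈ I → ‖u n t - v t‖ ≤ M * C * (1 / ((n : ℝ) + 1)) := by
    intro n t ht
    have h1 : Tendsto (fun m => ‖u n t - u m t‖) atTop (𝓝 ‖u n t - v t‖) :=
      (tendsto_const_nhds.sub (hv t ht)).norm
    have h2 : Tendsto (fun m : ℕ => M * C * (1 / ((n : ℝ) + 1) + 1 / ((m : ℝ) + 1))) atTop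
        (𝓝 (M * C * (1 / ((n : ℝ) + 1) + 0))) :=
      (tendsto_const_nhds.add tendsto_one_div_add_atTop_nhds_zero_nat).const_mul _
    rw [add_zero] at h2
    exact le_of_tendsto_of_tendsto' h1 h2 fun m => key n m t ht
  refine ⟨v, hf, fun ε hε => ?_⟩
  obtain ⟨n, hn⟩ := exists_nat_one_div_lt (K := ℝ) (ε := ε / (1 + M * C)) (by positivity)
  rw [lt_div_iff₀ (by positivity)] at hn
  have hpn := hpos n
  have hMC : 0 ≤ M * C := by positivity
  refine ⟨g n, u n, hgu n, (hg' n).trans (by nlinarith), fun t ht => (hclose n t ht).trans ?_⟩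
  nlinarith

end Mild

/-! ### Construction of the evolution family -/

section Propagator

variable {X : Type*} [NormedAddCommGroup X] [NormedSpace ℂ X] [CompleteSpace X]

/-- The bound makes the relation single-valued and continuous on its domain; density of the domain
and completeness then allow an extension to all of `X`. -/
theorem exists_clm_of_dense_relation (Γ : Submodule ℂ (X × X)) {C : ℝ}
    (hC : ∀ z ∈ Γ, ‖z.2‖ ≤ C * ‖z.1‖)
    (hd : ∀ x : X, ∀ ε : ℝ, 0 < ε → ∃ z ∈ Γ, ‖z.1 - x‖ < ε) :
    ∃ T : X →L[ℂ] X, (∀ z ∈ Γ, T z.1 = z.2) ∧ ∀ x, ‖T x‖ ≤ C * ‖x‖ := by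
  have hfun : ∀ x ∈ Γ, x.1 = 0 → x.2 = 0 := by
    intro z hz h0
    have := hC z hz
    rw [h0, norm_zero, mul_zero] at this
    exact norm_le_zero_iff.1 this
  have hgr : Γ.toLinearPMap.graph = Γ := Γ.toLinearPMap_graph_eq hfun
  set L := Γ.toLinearPMap with hL
  have hmem : ∀ x : L.domain, ((x : X), L x) ∈ Γ := fun x => by
    rw [← hgr]; exact L.mem_graph x
  have hdense : DenseRange L.domain.subtypeL := by
    intro x
    rw [Metric.mem_closure_iff]
    intro ε hε
    obtain ⟨z, hz, hzx⟩ := hd x ε hε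
    rw [← hgr, LinearPMap.mem_graph_iff] at hz
    obtain ⟨y, hy, -⟩ := hz
    refine ⟨z.1, ⟨y, hy⟩, ?_⟩
    rwa [dist_comm, dist_eq_norm]
  let f : L.domain →L[ℂ] X := L.toFun.mkContinuous C fun x => hC _ (hmem x)
  have hui : IsUniformInducing L.domain.subtypeL := isUniformEmbedding_subtype_val.isUniformInducing
  have hext : ∀ x : L.domain, f.extend L.domain.subtypeL (x : X) = L x := fun x =>
    f.extend_eq hdense hui x
  refine ⟨f.extend L.domain.subtypeL, fun z hz => ?_, fun x => ?_⟩
  · rw [← hgr, LinearPMap.mem_graph_iff] at hz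
    obtain ⟨y, hy, hy'⟩ := hz
    rw [← hy, hext, hy']
  · refine hdense.induction_on (p := fun x => ‖f.extend L.domain.subtypeL x‖ ≤ C * ‖x‖) x ?_ ?_
    · exact isClosed_le (ContinuousLinearMap.continuous _).norm (continuous_const.mul continuous_norm)
    · intro y
      have := hext y
      simp only [Submodule.subtypeL_apply] at this ⊢
      rw [this]
      exact hC _ (hmem y)

variable {I : Set ℝ} {p : ℝ≥0∞} {A : ℝ → X →ₗ.[ℂ] X} {M w c : ℝ}

theorem KatoStable.norm_le_mul {Y : Type*} [NormedAddCommGroup Y] [NormedSpace ℂ Y]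
    {r : ℝ → ℝ → Prop} {B : ℝ → Y →ₗ.[ℂ] Y} (hK : KatoStable r I B M w) (y : Y) :
    ‖y‖ ≤ M * ‖y‖ := by
  have := hK.2 [] (by simp) List.Pairwise.nil (w + 1) (by linarith)
  simp only [List.map_nil, List.prod_nil, List.length_nil, pow_zero, inv_one, mul_one] at this
  have h := ((1 : Y →L[ℂ] Y).le_opNorm y).trans
    (mul_le_mul_of_nonneg_right this (norm_nonneg y))
  simpa using h

/-- Cutting the forcing off after `s` does not change the value at `s`, by causality. Hence almost
every initial direction is reached, up to `ε`, by solutions that run free after `s`. -/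
theorem IsSolvable.exists_isMild_near (hS : IsSolvable I p A M w c) {s : ℝ} (hs : s ∈ I) (x : X)
    {ε : ℝ} (hε : 0 < ε) : ∃ f v : ℝ → X, IsMild I p A c f v ∧ (∀ r, s < r → f r = 0) ∧
      ‖v s - x‖ < ε := by
  obtain ⟨f, u, hu, hux⟩ := hS.dense_values s hs x ε hε
  have hm : MemLp ((Iic s).indicator f) p (volume.restrict I) := hu.memLp.indicator measurableSet_Iic
  obtain ⟨v, hv⟩ := hS.exists_isMild hm
  refine ⟨_, v, hv, fun r hr => indicator_of_notMem (by simpa using hr) _, ?_⟩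
  rwa [hv.eq_of_ae_eq hS hu.isMild hs
    (ae_of_all _ fun r hr => indicator_of_mem (mem_Iic.2 hr) _)]

/-- `V(t, s)` propagates mild solutions of `(c - G)v = f` as long as `f` vanishes. -/
structure IsPropagator (I : Set ℝ) (p : ℝ≥0∞) (A : ℝ → X →ₗ.[ℂ] X) (M w c : ℝ)
    (V : ℝ → ℝ → X →L[ℂ] X) : Prop where
  map : ∀ s ∈ I, ∀ t ∈ I, s ≤ t → ∀ f v : ℝ → X, IsMild I p A c f v →
    (∀ᵐ r ∂(volume.restrict I), r ∈ Ioc s t → f r = 0) → V t s (v s) = v t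
  norm_le : ∀ s ∈ I, ∀ t ∈ I, s ≤ t → ∀ x, ‖V t s x‖ ≤ M * Real.exp (-(c - w) * (t - s)) * ‖x‖

/-- `V t s` extends the relation `v s ↦ v t` over all mild solutions whose forcing vanishes on `(s,
t]`: it is bounded by `IsMild.norm_le_of_ae_zero` and densely defined by
`IsSolvable.exists_isMild_near`. -/
theorem IsSolvable.exists_isPropagator (hS : IsSolvable I p A M w c) :
    ∃ V, IsPropagator I p A M w c V := by
  have key : ∀ s t : ℝ, ∃ T : X →L[ℂ] X, s ∈ I → t ∈ I → s ≤ t →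
      (∀ f v : ℝ → X, IsMild I p A c f v →
        (∀ᵐ r ∂(volume.restrict I), r ∈ Ioc s t → f r = 0) → T (v s) = v t) ∧
      ∀ x, ‖T x‖ ≤ M * Real.exp (-(c - w) * (t - s)) * ‖x‖ := by
    intro s t
    by_cases h : s ∈ I ∧ t ∈ I ∧ s ≤ t
    swap
    · exact ⟨0, fun h1 h2 h3 => absurd ⟨h1, h2, h3⟩ h⟩
    obtain ⟨hs, ht, hst⟩ := h
    let Γ : Submodule ℂ (X × X) :=
      { carrier := {z | ∃ f v : ℝ → X, IsMild I p A c f v ∧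
          (∀ᵐ r ∂(volume.restrict I), r ∈ Ioc s t → f r = 0) ∧ z = (v s, v t)}
        add_mem' := by
          rintro _ _ ⟨f, v, h1, h2, rfl⟩ ⟨g, y, h1', h2', rfl⟩
          refine ⟨_, _, h1.add hS.one_lt.le hS.interval.ordConnected h1', ?_, rfl⟩
          filter_upwards [h2, h2'] with r hr hr' hrm
          rw [hr hrm, hr' hrm, add_zero]
        zero_mem' := by
          obtain ⟨v, hv⟩ := hS.exists_isMild (f := 0) (MemLp.zero' (ε := X))
          have h0 : ∀ r ∈ I, v r = 0 := fun r hr => hv.eq_zero hS hr (ae_of_all _ fun _ _ => rfl)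
          exact ⟨_, v, hv, ae_of_all _ fun _ _ => rfl, by rw [h0 s hs, h0 t ht]; rfl⟩
        smul_mem' := by
          rintro k _ ⟨f, v, h1, h2, rfl⟩
          refine ⟨_, _, h1.const_smul k, ?_, rfl⟩
          filter_upwards [h2] with r hr hrm
          rw [hr hrm, smul_zero] }
    obtain ⟨T, hT1, hT2⟩ := exists_clm_of_dense_relation Γ
      (C := M * Real.exp (-(c - w) * (t - s))) (by
        rintro _ ⟨f, v, h1, h2, rfl⟩
        rcases hst.eq_or_lt with rfl | hlt
        · simpa using hS.kato.norm_le_mul (v s)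
        · simpa [mul_assoc] using h1.norm_le_of_ae_zero hS hs ht hlt h2) (by
        intro x ε hε
        obtain ⟨f, v, h1, h2, h3⟩ := hS.exists_isMild_near hs x hε
        exact ⟨_, ⟨f, v, h1, ae_of_all _ fun r hr => h2 r hr.1, rfl⟩, h3⟩)
    exact ⟨T, fun _ _ _ => ⟨fun f v h1 h2 => hT1 _ ⟨f, v, h1, h2, rfl⟩, hT2⟩⟩
  choose T hT using key
  exact ⟨fun t s => T s t, fun s hs t ht hst => (hT s t hs ht hst).1,
    fun s hs t ht hst => (hT s t hs ht hst).2⟩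

variable {V : ℝ → ℝ → X →L[ℂ] X}

theorem clm_eq_of_dense {X : Type*} [NormedAddCommGroup X] [NormedSpace ℂ X] {S T : X →L[ℂ] X} (h : ∀ x : X, ∀ ε : ℝ, 0 < ε → ∃ y, S y = T y ∧ ‖y - x‖ < ε) :
    S = T := by
  ext x
  have hd : x ∈ closure {y | S y = T y} := Metric.mem_closure_iff.2 fun ε hε => by
    obtain ⟨y, hy, hyx⟩ := h x ε hε
    exact ⟨y, hy, by rwa [dist_comm, dist_eq_norm]⟩
  rwa [(isClosed_eq S.continuous T.continuous).closure_eq] at hd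

theorem IsPropagator.comp (hS : IsSolvable I p A M w c) (hV : IsPropagator I p A M w c V) {s r t : ℝ}
    (hs : s ∈ I) (hr : r ∈ I) (ht : t ∈ I) (hsr : s ≤ r) (hrt : r ≤ t) :
    V t r ∘L V r s = V t s := by
  refine clm_eq_of_dense fun x ε hε => ?_
  obtain ⟨f, v, h1, h2, h3⟩ := hS.exists_isMild_near hs x hε
  refine ⟨v s, ?_, h3⟩
  rw [ContinuousLinearMap.comp_apply,
    hV.map s hs r hr hsr f v h1 (ae_of_all _ fun r hr => h2 r hr.1),
    hV.map r hr t ht hrt f v h1 (ae_of_all _ fun x hx => h2 x (hsr.trans_lt hx.1)),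
    hV.map s hs t ht (hsr.trans hrt) f v h1 (ae_of_all _ fun r hr => h2 r hr.1)]

theorem IsPropagator.refl (hS : IsSolvable I p A M w c) (hV : IsPropagator I p A M w c V) {s : ℝ}
    (hs : s ∈ I) : V s s = 1 := by
  refine clm_eq_of_dense fun x ε hε => ?_
  obtain ⟨f, v, h1, h2, h3⟩ := hS.exists_isMild_near hs x hε
  refine ⟨v s, ?_, h3⟩
  rw [hV.map s hs s hs le_rfl f v h1 (ae_of_all _ fun r hr => h2 r hr.1)]
  simp

theorem IsSolvable.integrable_indicator (hS : IsSolvable I p A M w c) {f : ℝ → X}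
    (hf : MemLp f p (volume.restrict I)) (s t : ℝ) : IntegrableOn (I.indicator f) (Ioc s t) :=
  (((memLp_indicator_iff_restrict hS.interval.measurableSet).2 hf).restrict (Ioc s t)).integrable
    hS.one_lt.le

/-- The Duhamel term, as the value at `t` of the mild solution with forcing cut off at `s`. -/
theorem IsPropagator.map_sub_eq (hS : IsSolvable I p A M w c) (hV : IsPropagator I p A M w c V)
    {s t : ℝ} (hs : s ∈ I) (ht : t ∈ I) (hst : s ≤ t) {f v y : ℝ → X} (hv : IsMild I p A c f v)
    (hy : IsMild I p A c ((Ioc s t).indicator f) y) : v t - V t s (v s) = y t := by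
  have h1 := hV.map s hs t ht hst _ _ (hv.sub hS.one_lt.le hS.interval.ordConnected hy)
    (ae_of_all _ fun r hr => by rw [indicator_of_mem hr, sub_self])
  have h2 : y s = 0 := hy.eq_zero hS hs
    (ae_of_all _ fun r hr => indicator_of_notMem (fun h => absurd h.1 (not_lt.2 hr)) _)
  simp only [h2, sub_zero] at h1
  rw [h1, sub_sub_cancel]

theorem IsMild.norm_le_of_indicator (hS : IsSolvable I p A M w c) {s t : ℝ} (ht : t ∈ I)
    {f y : ℝ → X} (hy : IsMild I p A c ((Ioc s t).indicator f) y) : ‖y t‖ ≤ M * ∫ r in Ioc s t, ‖I.indicator f r‖ := by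
  refine (hy.norm_le_setIntegral hS (s := s) ht (ae_of_all _ fun r hr =>
    indicator_of_notMem (fun h => absurd h.1 (not_lt.2 hr)) _)).trans_eq ?_
  congr 1
  refine setIntegral_congr_fun measurableSet_Ioc fun r hr => ?_
  by_cases hrI : r ∈ I
  · simp only [indicator_of_mem hrI, indicator_of_mem hr]
  · simp only [indicator_of_notMem hrI]

theorem IsPropagator.norm_sub_le (hS : IsSolvable I p A M w c) (hV : IsPropagator I p A M w c V)
    {s t : ℝ} (hs : s ∈ I) (ht : t ∈ I) (hst : s ≤ t) {f v : ℝ → X} (hv : IsMild I p A c f v) :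
    ‖v t - V t s (v s)‖ ≤ M * ∫ r in Ioc s t, ‖I.indicator f r‖ := by
  obtain ⟨y, hy⟩ := hS.exists_isMild (hv.1.indicator (measurableSet_Ioc (a := s) (b := t)))
  rw [hV.map_sub_eq hS hs ht hst hv hy]
  exact hy.norm_le_of_indicator hS ht

theorem IsPropagator.norm_le' (hS : IsSolvable I p A M w c) (hV : IsPropagator I p A M w c V)
    {s t : ℝ} (hs : s ∈ I) (ht : t ∈ I) (hst : s ≤ t) (x : X) : ‖V t s x‖ ≤ M * ‖x‖ := by
  refine (hV.norm_le s hs t ht hst x).trans ?_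
  have h1 := hS.kato.nonneg
  have : Real.exp (-(c - w) * (t - s)) ≤ 1 := by
    rw [Real.exp_le_one_iff]; nlinarith [hS.lt]
  have := mul_le_of_le_one_right h1 this
  gcongr

/-- Near `(t₀, s₀)` the vector `x` is replaced by `v s₀`, where `v` is a mild solution without
forcing after `s₀`. Then `V t s (v s)` differs from the continuous function `v t` at most by the
integral of the forcing over the part of `(s, t]` before `s₀`, which tends to `0`. -/
theorem IsPropagator.continuousOn (hS : IsSolvable I p A M w c) (hV : IsPropagator I p A M w c V)
    (x : X) : ContinuousOn (fun z : ℝ × ℝ => V z.1 z.2 x)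
      {z | z.1 ∈ I ∧ z.2 ∈ I ∧ z.2 ≤ z.1} := by
  have hM := hS.kato.nonneg
  rintro ⟨t₀, s₀⟩ ⟨ht₀, hs₀, hst₀⟩
  simp only at ht₀ hs₀ hst₀
  rw [ContinuousWithinAt, tendsto_iff_norm_sub_tendsto_zero]
  refine Metric.tendsto_nhds.2 fun ε hε => ?_
  set η := ε / (2 * (1 + 2 * M)) with hη
  have hη0 : 0 < η := by positivity
  obtain ⟨f, v, h1, h2, h3⟩ := hS.exists_isMild_near hs₀ x hη0
  have hvc := h1.continuousOn hS.one_lt.le hS.interval.ordConnected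
  set D := {z : ℝ × ℝ | z.1 ∈ I ∧ z.2 ∈ I ∧ z.2 ≤ z.1} with hD
  set F : ℝ → ℝ := fun r => ‖I.indicator f r‖ with hF
  have hFi : ∀ a b, IntervalIntegrable F volume a b := fun a b =>
    ⟨(hS.integrable_indicator h1.1 a b).norm, (hS.integrable_indicator h1.1 b a).norm⟩
  have hG : Tendsto (fun z : ℝ × ℝ => ∫ r in s₀..min z.2 s₀, F r) (𝓝[D] (t₀, s₀)) (𝓝 0) := by
    have hc : Continuous fun z : ℝ × ℝ => ∫ r in s₀..min z.2 s₀, F r :=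
      (intervalIntegral.continuous_primitive hFi s₀).comp (by fun_prop)
    have := (hc.tendsto (t₀, s₀)).mono_left (nhdsWithin_le_nhds (s := D))
    simpa using this
  have hv2 : Tendsto (fun z : ℝ × ℝ => ‖v z.2 - v s₀‖) (𝓝[D] (t₀, s₀)) (𝓝 0) := by
    have h : Tendsto (fun z : ℝ × ℝ => z.2) (𝓝[D] (t₀, s₀)) (𝓝[I] s₀) :=
      tendsto_nhdsWithin_iff.2 ⟨(continuous_snd.tendsto (t₀, s₀)).mono_left nhdsWithin_le_nhds,
        eventually_mem_nhdsWithin.mono fun z hz => hz.2.1⟩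
    exact tendsto_iff_norm_sub_tendsto_zero.1 ((hvc s₀ hs₀).tendsto.comp h)
  have hv1 : Tendsto (fun z : ℝ × ℝ => ‖v z.1 - v t₀‖) (𝓝[D] (t₀, s₀)) (𝓝 0) := by
    have h : Tendsto (fun z : ℝ × ℝ => z.1) (𝓝[D] (t₀, s₀)) (𝓝[I] t₀) :=
      tendsto_nhdsWithin_iff.2 ⟨(continuous_fst.tendsto (t₀, s₀)).mono_left nhdsWithin_le_nhds,
        eventually_mem_nhdsWithin.mono fun z hz => hz.1⟩
    exact tendsto_iff_norm_sub_tendsto_zero.1 ((hvc t₀ ht₀).tendsto.comp h)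
  have hB : Tendsto (fun z : ℝ × ℝ => M * (η + ‖v z.2 - v s₀‖)
      + M * -(∫ r in s₀..min z.2 s₀, F r) + ‖v z.1 - v t₀‖ + M * η) (𝓝[D] (t₀, s₀))
      (𝓝 (M * (η + 0) + M * -0 + 0 + M * η)) :=
    ((((hv2.const_add η).const_mul M).add (hG.neg.const_mul M)).add hv1).add_const _
  have hlt : M * (η + 0) + M * -0 + 0 + M * η < ε := by
    have : (1 + 2 * M) * η = ε / 2 := by rw [hη]; field_simp
    nlinarith
  filter_upwards [hB.eventually_lt_const hlt, self_mem_nhdsWithin] with z hz hzD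
  obtain ⟨hzt, hzs, hzst⟩ := hzD
  rw [Real.dist_eq, sub_zero, abs_of_nonneg (norm_nonneg _)]
  refine lt_of_le_of_lt ?_ hz
  have e : V z.1 z.2 x - V t₀ s₀ x = V z.1 z.2 (x - v z.2) + (V z.1 z.2 (v z.2) - v z.1)
      + (v z.1 - v t₀) + V t₀ s₀ (v s₀ - x) := by
    rw [map_sub, map_sub, hV.map s₀ hs₀ t₀ ht₀ hst₀ f v h1 (ae_of_all _ fun r hr => h2 r hr.1)]
    abel
  have b1 : ‖V z.1 z.2 (x - v z.2)‖ ≤ M * (η + ‖v z.2 - v s₀‖) := by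
    refine (hV.norm_le' hS hzs hzt hzst _).trans ?_
    gcongr
    have : x - v z.2 = -((v s₀ - x) + (v z.2 - v s₀)) := by abel
    rw [this, norm_neg]
    exact (norm_add_le _ _).trans (by gcongr)
  have b2 : ‖V z.1 z.2 (v z.2) - v z.1‖ ≤ M * -(∫ r in s₀..min z.2 s₀, F r) := by
    rw [norm_sub_rev]
    refine (hV.norm_sub_le hS hzs hzt hzst h1).trans ?_
    gcongr
    rw [intervalIntegral.integral_symm, neg_neg, intervalIntegral.integral_of_le (min_le_right _ _)]
    have e2 : ∫ r in Ioc z.2 z.1, ‖I.indicator f r‖ = ∫ r in Ioc z.2 z.1 ∩ Iic s₀, ‖I.indicator f r‖ := by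
      refine (setIntegral_eq_of_subset_of_forall_sdiff_eq_zero measurableSet_Ioc inter_subset_left
        fun r hr => ?_)
      have : s₀ < r := by
        by_contra hcon
        exact hr.2 ⟨hr.1, not_lt.1 hcon⟩
      by_cases hrI : r ∈ I
      · rw [indicator_of_mem hrI, h2 r this, norm_zero]
      · rw [indicator_of_notMem hrI, norm_zero]
    rw [e2]
    refine setIntegral_mono_set (hFi _ _).1 (ae_of_all _ fun r => norm_nonneg _)
      (HasSubset.Subset.eventuallyLE ?_)
    rintro r ⟨hr1, hr2⟩
    exact ⟨(min_le_left _ _).trans_lt hr1.1, hr2⟩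
  have b3 : ‖V t₀ s₀ (v s₀ - x)‖ ≤ M * η :=
    (hV.norm_le' hS hs₀ ht₀ hst₀ _).trans (by gcongr)
  rw [e]
  refine (norm_add_le _ _).trans (add_le_add ((norm_add_le _ _).trans (add_le_add
    ((norm_add_le _ _).trans (add_le_add b1 b2)) le_rfl)) b3)

/-- Removal of the shift by `c`. -/
noncomputable def shiftFamily (c : ℝ) (V : ℝ → ℝ → X →L[ℂ] X) (t s : ℝ) : X →L[ℂ] X :=
  (Real.exp (c * (t - s)) : ℂ) • V t s

theorem IsPropagator.isEvolutionFamily (hS : IsSolvable I p A M w c)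
    (hV : IsPropagator I p A M w c V) : IsEvolutionFamily I (shiftFamily c V) where
  comp t ht r hr s hs hsr hrt := by
    rw [shiftFamily, shiftFamily, shiftFamily, ← hV.comp hS hs hr ht hsr hrt]
    ext x
    simp only [ContinuousLinearMap.comp_apply, smul_apply, map_smul, smul_smul]
    congr 1
    rw [← Complex.ofReal_mul, ← Real.exp_add]
    congr 2; ring
  refl t ht := by simp [shiftFamily, hV.refl hS ht]
  strongly_continuous x := by
    have : Continuous fun z : ℝ × ℝ => (Real.exp (c * (z.1 - z.2)) : ℂ) := by fun_prop
    exact this.continuousOn.smul (hV.continuousOn hS x)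
  exp_bounded := by
    refine ⟨M, c, fun t ht s hs hst => ?_⟩
    have hM := hS.kato.nonneg
    refine ContinuousLinearMap.opNorm_le_bound _ (by positivity) fun x => ?_
    rw [shiftFamily, smul_apply, norm_smul, Complex.norm_real,
      Real.norm_of_nonneg (Real.exp_pos _).le]
    have := hV.norm_le' hS hs ht hst x
    calc _ ≤ Real.exp (c * (t - s)) * (M * ‖x‖) := by gcongr
      _ = _ := by ring

end Propagator

/-! ### Young's inequality for a sliding window -/

section Sliding

variable {Y : Type*} [NormedAddCommGroup Y]

/-- Convolution with the indicator function of an interval of length `h`. Hölder's inequality on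
each window gives the factor `h ^ (p - 1)` for the `p`-th powers, and Tonelli's theorem supplies the
remaining `h`. -/
theorem eLpNorm_sliding_le {p : ℝ≥0∞} (hp1 : 1 ≤ p) (hp : p ≠ ⊤) {F : ℝ → Y}
    (hF : MemLp F p volume) {h : ℝ} (hh : 0 < h) :
    eLpNorm (fun t => ∫ r in Ioc (t - h) t, ‖F r‖) p volume ≤ ENNReal.ofReal h * eLpNorm F p volume := by
  have hp0 : p ≠ 0 := (zero_lt_one.trans_le hp1).ne'
  have hP1 : 1 ≤ p.toReal := by
    rw [← ENNReal.toReal_one]; exact ENNReal.toReal_mono hp hp1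
  have hP0 : 0 < p.toReal := by linarith
  rw [eLpNorm_eq_lintegral_rpow_enorm_toReal hp0 hp, eLpNorm_eq_lintegral_rpow_enorm_toReal hp0 hp]
  have hh' : ENNReal.ofReal h ≠ ⊤ := ENNReal.ofReal_ne_top
  have hh0 : ENNReal.ofReal h ≠ 0 := by simpa using hh
  have hvol : ∀ t : ℝ, (volume.restrict (Ioc (t - h) t)) univ = ENNReal.ofReal h := fun t => by
    simp
  have hpt : ∀ t : ℝ, ‖∫ r in Ioc (t - h) t, ‖F r‖‖ₑ ^ p.toReal
      ≤ (∫⁻ r in Ioc (t - h) t, ‖F r‖ₑ ^ p.toReal) * ENNReal.ofReal h ^ (p.toReal - 1) := by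
    intro t
    have e1 : ‖∫ r in Ioc (t - h) t, ‖F r‖‖ₑ ≤ eLpNorm F 1 (volume.restrict (Ioc (t - h) t)) := by
      rw [eLpNorm_one_eq_lintegral_enorm]
      refine (enorm_integral_le_lintegral_enorm _).trans_eq ?_
      simp
    have e2 := e1.trans (eLpNorm_le_eLpNorm_mul_rpow_measure_univ hp1
      (hF.1.mono_measure Measure.restrict_le_self))
    rw [hvol, eLpNorm_eq_lintegral_rpow_enorm_toReal hp0 hp] at e2
    refine (ENNReal.rpow_le_rpow e2 hP0.le).trans_eq ?_
    rw [ENNReal.mul_rpow_of_nonneg _ _ hP0.le, ← ENNReal.rpow_mul, ← ENNReal.rpow_mul,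
      one_div_mul_cancel hP0.ne', ENNReal.rpow_one]
    congr 2
    simp only [ENNReal.toReal_one]
    field_simp
  have hswap : ∫⁻ t, ∫⁻ r in Ioc (t - h) t, ‖F r‖ₑ ^ p.toReal
      = ENNReal.ofReal h * ∫⁻ r, ‖F r‖ₑ ^ p.toReal := by
    have hm : MeasurableSet {z : ℝ × ℝ | z.2 ∈ Ioc (z.1 - h) z.1} :=
      (measurableSet_lt (by fun_prop) measurable_snd).inter
        (measurableSet_le measurable_snd measurable_fst)
    have hae : AEMeasurable (fun z : ℝ × ℝ =>
        {z : ℝ × ℝ | z.2 ∈ Ioc (z.1 - h) z.1}.indicator (fun z => ‖F z.2‖ₑ ^ p.toReal) z)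
        (volume.prod volume) := by
      refine AEMeasurable.indicator ?_ hm
      exact (hF.1.enorm.pow_const _).comp_snd
    have e1 : ∀ t, ∫⁻ r in Ioc (t - h) t, ‖F r‖ₑ ^ p.toReal = ∫⁻ r,
        {z : ℝ × ℝ | z.2 ∈ Ioc (z.1 - h) z.1}.indicator (fun z => ‖F z.2‖ₑ ^ p.toReal) (t, r) := by
      intro t
      rw [← lintegral_indicator measurableSet_Ioc]
      rfl
    simp only [e1]
    rw [lintegral_lintegral_swap hae, ← lintegral_const_mul' _ _ hh']
    refine lintegral_congr fun r => ?_
    have e2 : (fun t => {z : ℝ × ℝ | z.2 ∈ Ioc (z.1 - h) z.1}.indicator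
        (fun z => ‖F z.2‖ₑ ^ p.toReal) (t, r))
        = (Ico r (r + h)).indicator fun _ => ‖F r‖ₑ ^ p.toReal := by
      ext t
      have : (r ∈ Ioc (t - h) t) ↔ t ∈ Ico r (r + h) := by
        simp only [mem_Ioc, mem_Ico]
        constructor <;> rintro ⟨h1, h2⟩ <;> constructor <;> linarith
      by_cases ht : t ∈ Ico r (r + h)
      · rw [indicator_of_mem ht, indicator_of_mem (by exact this.2 ht)]
      · rw [indicator_of_notMem ht, indicator_of_notMem (by exact mt this.1 ht)]
    rw [e2, lintegral_indicator measurableSet_Ico, setLIntegral_const]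
    simp [mul_comm]
  calc (∫⁻ t, ‖∫ r in Ioc (t - h) t, ‖F r‖‖ₑ ^ p.toReal) ^ (1 / p.toReal)
      ≤ (∫⁻ t, (∫⁻ r in Ioc (t - h) t, ‖F r‖ₑ ^ p.toReal)
          * ENNReal.ofReal h ^ (p.toReal - 1)) ^ (1 / p.toReal) := by
        gcongr with t
        exact hpt t
    _ = (ENNReal.ofReal h ^ p.toReal * ∫⁻ r, ‖F r‖ₑ ^ p.toReal) ^ (1 / p.toReal) := by
        rw [lintegral_mul_const' _ _ (ENNReal.rpow_ne_top_of_nonneg (by linarith) hh'), hswap]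
        congr 1
        have : ENNReal.ofReal h ^ p.toReal = ENNReal.ofReal h * ENNReal.ofReal h ^ (p.toReal - 1) := by
          have := ENNReal.rpow_add 1 (p.toReal - 1) hh0 hh'
          rwa [add_sub_cancel, ENNReal.rpow_one] at this
        rw [this]; ring
    _ = _ := by
        rw [ENNReal.mul_rpow_of_nonneg _ _ (by positivity), ← ENNReal.rpow_mul,
          mul_one_div_cancel hP0.ne', ENNReal.rpow_one]

end Sliding

/-! ### The evolution semigroup on `L^p` -/

section Measurability

variable {X : Type*} [NormedAddCommGroup X] [NormedSpace ℂ X]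

/-- Only the orbits `t ↦ W t x` are measurable, not `W` in operator norm, so `f` is approximated
pointwise by simple functions, for which the claim reduces to constant vectors. -/
theorem aestronglyMeasurable_clm_apply {μ : Measure ℝ} {W : ℝ → X →L[ℂ] X}
    (hW : ∀ x, AEStronglyMeasurable (fun t => W t x) μ) {f : ℝ → X}
    (hf : AEStronglyMeasurable f μ) : AEStronglyMeasurable (fun t => W t (f t)) μ := by
  have hsimple : ∀ φ : SimpleFunc ℝ X, AEStronglyMeasurable (fun t => W t (φ t)) μ := by
    intro φ
    refine SimpleFunc.induction (motive := fun φ => AEStronglyMeasurable (fun t => W t (φ t)) μ)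
      (fun x s hs => ?_) (fun φ ψ _ h1 h2 => ?_) φ
    · have e : (fun t => W t ((SimpleFunc.piecewise s hs (SimpleFunc.const ℝ x)
          (SimpleFunc.const ℝ 0)) t)) = s.indicator fun t => W t x := by
        ext t
        by_cases ht : t ∈ s <;> simp [ht]
      rw [e]
      exact (hW x).indicator hs
    · have e : (fun t => W t ((φ + ψ) t)) = fun t => W t (φ t) + W t (ψ t) := by
        ext t; simp
      rw [e]
      exact h1.add h2
  have hg := hf.stronglyMeasurable_mk
  refine (aestronglyMeasurable_of_tendsto_ae (u := atTop) (f := fun n t => W t (hg.approx n t))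
    (fun n => hsimple _) (g := fun t => W t (hf.mk f t)) (ae_of_all _ fun t => ?_)).congr ?_
  · exact ((W t).continuous.tendsto _).comp (hg.tendsto_approx t)
  · filter_upwards [hf.ae_eq_mk] with t ht
    rw [ht]

theorem ae_shift {I : Set ℝ} (hI : MeasurableSet I) {P : ℝ → Prop}
    (h : ∀ᵐ r ∂(volume.restrict I), P r) (σ : ℝ) : ∀ᵐ t : ℝ, t - σ ∈ I → P (t - σ) :=
  (measurePreserving_sub_right volume σ).quasiMeasurePreserving.ae ((ae_restrict_iff' hI).1 h)

/-- The pointwise action of the evolution semigroup. -/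
noncomputable def shiftApply (I : Set ℝ) (U : ℝ → ℝ → X →L[ℂ] X) (σ : ℝ) (f : ℝ → X) (t : ℝ) : X :=
  I.indicator (fun r => U t r (f r)) (t - σ)

variable {I : Set ℝ} {p : ℝ≥0∞} {U : ℝ → ℝ → X →L[ℂ] X}

theorem shiftApply_congr (hI : MeasurableSet I) {f g : ℝ → X} (h : f =ᵐ[volume.restrict I] g)
    (σ : ℝ) : shiftApply I U σ f =ᵐ[volume.restrict I] shiftApply I U σ g := by
  filter_upwards [ae_restrict_of_ae (ae_shift hI h σ)] with t ht
  rw [shiftApply, shiftApply]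
  by_cases hm : t - σ ∈ I
  · rw [indicator_of_mem hm, indicator_of_mem hm, ht hm]
  · rw [indicator_of_notMem hm, indicator_of_notMem hm]

theorem aestronglyMeasurable_shiftApply (hI : MeasurableSet I)
    (hU : ∀ x : X, ContinuousOn (fun z : ℝ × ℝ => U z.1 z.2 x)
      {z | z.1 ∈ I ∧ z.2 ∈ I ∧ z.2 ≤ z.1}) {σ : ℝ} (hσ : 0 ≤ σ) {f : ℝ → X}
    (hf : AEStronglyMeasurable f (volume.restrict I)) :
    AEStronglyMeasurable (shiftApply I U σ f) (volume.restrict I) := by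
  set S : Set ℝ := {t | t - σ ∈ I} with hS
  have hSm : MeasurableSet S := (by fun_prop : Measurable fun t : ℝ => t - σ) hI
  have hg : AEStronglyMeasurable (fun t => I.indicator f (t - σ)) (volume.restrict I) :=
    (((aestronglyMeasurable_indicator_iff hI).2 hf).comp_measurePreserving
      (measurePreserving_sub_right volume σ)).mono_measure Measure.restrict_le_self
  have hW : ∀ x, AEStronglyMeasurable (fun t => S.indicator (fun t => U t (t - σ)) t x)
      (volume.restrict I) := by
    intro x
    have e : (fun t => S.indicator (fun t => U t (t - σ)) t x)
        = S.indicator fun t => U t (t - σ) x := by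
      ext t
      by_cases ht : t ∈ S <;> simp [ht]
    rw [e, aestronglyMeasurable_indicator_iff hSm, Measure.restrict_restrict hSm]
    refine ContinuousOn.aestronglyMeasurable ?_ (hSm.inter hI)
    refine (hU x).comp (f := fun t => (t, t - σ)) (by fun_prop) fun t ht => ?_
    exact ⟨ht.2, ht.1, by simpa using hσ⟩
  refine (aestronglyMeasurable_clm_apply hW hg).congr (ae_of_all _ fun t => ?_)
  beta_reduce
  rw [shiftApply]
  by_cases ht : t - σ ∈ I
  · rw [indicator_of_mem ht, indicator_of_mem (by exact ht), indicator_of_mem ht]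
  · rw [indicator_of_notMem ht, indicator_of_notMem (by exact ht)]
    simp [indicator_of_notMem ht]

theorem eLpNorm_shiftApply_le (hI : MeasurableSet I) {σ K : ℝ}
    (hK : ∀ t ∈ I, t - σ ∈ I → ∀ x, ‖U t (t - σ) x‖ ≤ K * ‖x‖) {f : ℝ → X}
    (hf : AEStronglyMeasurable f (volume.restrict I)) :
    eLpNorm (shiftApply I U σ f) p (volume.restrict I)
      ≤ ENNReal.ofReal K * eLpNorm f p (volume.restrict I) := by
  have h1 : eLpNorm (fun t => I.indicator f (t - σ)) p volume = eLpNorm f p (volume.restrict I) := by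
    rw [← eLpNorm_indicator_eq_eLpNorm_restrict hI]
    have hm : MeasurePreserving (fun t : ℝ => t - σ) volume volume :=
      measurePreserving_sub_right volume σ
    exact eLpNorm_comp_measurePreserving (p := p) (g := I.indicator f)
      ((aestronglyMeasurable_indicator_iff hI).2 hf) hm
  rw [← h1]
  refine (eLpNorm_le_mul_eLpNorm_of_ae_le_mul (g := fun t => I.indicator f (t - σ)) ?_ p).trans
    (by gcongr; exact Measure.restrict_le_self)
  filter_upwards [ae_restrict_mem hI] with t ht
  rw [shiftApply]
  by_cases hm : t - σ ∈ I
  · rw [indicator_of_mem hm, indicator_of_mem hm]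
    exact hK t ht hm _
  · rw [indicator_of_notMem hm, indicator_of_notMem hm]
    simp

theorem exists_evolutionSemigroup [Fact (1 ≤ p)] (hI : I.OrdConnected)
    (hU : IsEvolutionFamily I U) :
    ∃ T : ℝ → Lp X p (volume.restrict I) →L[ℂ] Lp X p (volume.restrict I),
      (∀ σ : ℝ, 0 ≤ σ → ∀ f : Lp X p (volume.restrict I),
        T σ f =ᵐ[volume.restrict I] shiftApply I U σ f) ∧
      T 0 = 1 ∧ ∀ s t : ℝ, 0 ≤ s → 0 ≤ t → T (s + t) = T s ∘L T t := by
  have hIm := hI.measurableSet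
  have key : ∀ σ : ℝ, ∃ T : Lp X p (volume.restrict I) →L[ℂ] Lp X p (volume.restrict I), 0 ≤ σ →
      ∀ f : Lp X p (volume.restrict I), T f =ᵐ[volume.restrict I] shiftApply I U σ f := by
    intro σ
    by_cases hσ : 0 ≤ σ
    swap
    · exact ⟨0, fun h => absurd h hσ⟩
    obtain ⟨M, w, hM⟩ := hU.exp_bounded
    set K := |M| * Real.exp (w * σ) with hK
    have hK0 : 0 ≤ K := by positivity
    have hb : ∀ t ∈ I, t - σ ∈ I → ∀ x, ‖U t (t - σ) x‖ ≤ K * ‖x‖ := by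
      intro t ht hm x
      refine ((U t (t - σ)).le_opNorm x).trans ?_
      gcongr
      refine (hM t ht _ hm (by linarith)).trans ?_
      rw [sub_sub_cancel, hK]
      gcongr
      exact le_abs_self M
    have hmem : ∀ f : Lp X p (volume.restrict I), MemLp (shiftApply I U σ f) p (volume.restrict I) :=
      fun f => ⟨aestronglyMeasurable_shiftApply hIm hU.strongly_continuous hσ (Lp.aestronglyMeasurable f),
        (eLpNorm_shiftApply_le hIm hb (Lp.aestronglyMeasurable f)).trans_lt
          (ENNReal.mul_lt_top ENNReal.ofReal_lt_top (Lp.eLpNorm_lt_top f))⟩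
    let L : Lp X p (volume.restrict I) →ₗ[ℂ] Lp X p (volume.restrict I) :=
      { toFun := fun f => (hmem f).toLp _
        map_add' := by
          intro f g
          refine Lp.ext ?_
          have h1 := shiftApply_congr (U := U) hIm (Lp.coeFn_add f g) σ
          filter_upwards [(hmem (f + g)).coeFn_toLp, (hmem f).coeFn_toLp, (hmem g).coeFn_toLp, h1,
            Lp.coeFn_add ((hmem f).toLp _) ((hmem g).toLp _)] with t a1 a2 a3 a4 a5
          rw [a1, a5, a4, Pi.add_apply, a2, a3]
          simp only [shiftApply]
          by_cases hm : t - σ ∈ I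
          · simp [indicator_of_mem hm]
          · simp [indicator_of_notMem hm]
        map_smul' := by
          intro k f
          refine Lp.ext ?_
          have h1 := shiftApply_congr (U := U) hIm (Lp.coeFn_smul k f) σ
          filter_upwards [(hmem (k • f)).coeFn_toLp, (hmem f).coeFn_toLp, h1,
            Lp.coeFn_smul k ((hmem f).toLp _)] with t a1 a2 a4 a5
          rw [a1, RingHom.id_apply, a5, a4, Pi.smul_apply, a2]
          simp only [shiftApply]
          by_cases hm : t - σ ∈ I
          · simp [indicator_of_mem hm]
          · simp [indicator_of_notMem hm] }
    refine ⟨L.mkContinuous K fun f => ?_, fun _ f => (hmem f).coeFn_toLp⟩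
    change ‖(hmem f).toLp _‖ ≤ _
    rw [Lp.norm_toLp, Lp.norm_def]
    refine (ENNReal.toReal_mono (ENNReal.mul_ne_top ENNReal.ofReal_ne_top (Lp.eLpNorm_ne_top f))
      (eLpNorm_shiftApply_le hIm hb (Lp.aestronglyMeasurable f))).trans_eq ?_
    rw [ENNReal.toReal_mul, ENNReal.toReal_ofReal hK0]
  choose T hT using key
  refine ⟨T, hT, ?_, fun s t hs ht => ?_⟩
  · ext1 f
    refine Lp.ext ?_
    filter_upwards [hT 0 le_rfl f, ae_restrict_mem hIm] with t h1 h2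
    rw [h1, shiftApply, sub_zero, indicator_of_mem h2, hU.refl t h2]
    simp
  · ext1 f
    refine Lp.ext ?_
    have h2 := shiftApply_congr (U := U) hIm (hT t ht f) s
    filter_upwards [hT (s + t) (add_nonneg hs ht) f, hT s hs (T t f), h2, ae_restrict_mem hIm]
      with r a1 a2 a3 hr
    rw [a1, ContinuousLinearMap.comp_apply, a2, a3]
    simp only [shiftApply]
    have e : r - (s + t) = r - s - t := by ring
    rw [e]
    by_cases hm : r - s - t ∈ I
    -- `I` has no gaps, so the intermediate time belongs to it and the evolution law applies.
    · have hm' : r - s ∈ I := hI.out hm hr ⟨by linarith, by linarith⟩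
      rw [indicator_of_mem hm, indicator_of_mem hm', indicator_of_mem hm,
        ← hU.comp r hr _ hm' _ hm (by linarith) (by linarith)]
      rfl
    · rw [indicator_of_notMem hm]
      by_cases hm' : r - s ∈ I
      · rw [indicator_of_mem hm', indicator_of_notMem hm, map_zero]
      · rw [indicator_of_notMem hm']

theorem norm_evolutionSemigroup_le [Fact (1 ≤ p)] (hI : MeasurableSet I)
    {T : Lp X p (volume.restrict I) →L[ℂ] Lp X p (volume.restrict I)} {σ K : ℝ} (hK0 : 0 ≤ K)
    (hT : ∀ f : Lp X p (volume.restrict I), T f =ᵐ[volume.restrict I] shiftApply I U σ f)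
    (hK : ∀ t ∈ I, t - σ ∈ I → ∀ x, ‖U t (t - σ) x‖ ≤ K * ‖x‖) (f : Lp X p (volume.restrict I)) :
    ‖T f‖ ≤ K * ‖f‖ := by
  rw [Lp.norm_def, Lp.norm_def, eLpNorm_congr_ae (hT f)]
  refine (ENNReal.toReal_mono (ENNReal.mul_ne_top ENNReal.ofReal_ne_top (Lp.eLpNorm_ne_top f))
    (eLpNorm_shiftApply_le hI hK (Lp.aestronglyMeasurable f))).trans_eq ?_
  rw [ENNReal.toReal_mul, ENNReal.toReal_ofReal hK0]

end Measurability

/-! ### General theory of strongly continuous semigroups -/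

section Semigroup

variable {Y : Type*} [NormedAddCommGroup Y] [NormedSpace ℂ Y] {T : ℝ → Y →L[ℂ] Y}

/-- The uniform bound spreads right continuity at `0` from a dense set to all vectors. At `t > 0`,
continuity from both sides follows because `T s y - T t y` is, up to sign, `T (min s t)` applied to
`T |s - t| y - y`. -/
theorem isC0Semigroup_of_tendsto (h0 : T 0 = 1)
    (hadd : ∀ s t : ℝ, 0 ≤ s → 0 ≤ t → T (s + t) = T s ∘L T t) {K w : ℝ} (hK : 0 ≤ K)
    (hb : ∀ r, 0 ≤ r → ∀ y, ‖T r y‖ ≤ K * Real.exp (w * r) * ‖y‖)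
    (hd : ∀ y : Y, ∀ ε : ℝ, 0 < ε → ∃ x, ‖x - y‖ < ε ∧ Tendsto (fun h => T h x) (𝓝[>] 0) (𝓝 x)) :
    IsC0Semigroup T := by
  have hb1 : ∀ R : ℝ, ∃ C : ℝ, 0 ≤ C ∧ ∀ r, 0 ≤ r → r ≤ R → ∀ y, ‖T r y‖ ≤ C * ‖y‖ := by
    intro R
    refine ⟨K * Real.exp (|w| * |R|), by positivity, fun r hr hrR y => (hb r hr y).trans ?_⟩
    gcongr
    · exact le_abs_self w
    · exact hrR.trans (le_abs_self R)
  have hright : ∀ y : Y, Tendsto (fun h => T h y) (𝓝[≥] 0) (𝓝 y) := by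
    intro y
    obtain ⟨C, hC0, hC⟩ := hb1 1
    rw [Metric.tendsto_nhds]
    intro ε hε
    obtain ⟨x, hx, hxt⟩ := hd y (ε / (2 * (C + 1))) (by positivity)
    have hev : ∀ᶠ h in 𝓝[>] (0:ℝ), dist (T h x) x < ε / 2 := Metric.tendsto_nhds.1 hxt _ (by positivity)
    have hev1 : ∀ᶠ h in 𝓝[>] (0:ℝ), h ≤ 1 :=
      mem_nhdsWithin_of_mem_nhds (Iic_mem_nhds zero_lt_one)
    have hpos : ∀ᶠ h in 𝓝[>] (0:ℝ), dist (T h y) y < ε := by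
      filter_upwards [hev, hev1, self_mem_nhdsWithin] with h a1 a2 a3
      rw [dist_eq_norm] at a1 ⊢
      have e : T h y - y = (T h x - x) - T h (x - y) + (x - y) := by rw [map_sub]; abel
      have b1 := hC h (le_of_lt a3) a2 (x - y)
      have b2 : C * ‖x - y‖ + ‖x - y‖ < ε / 2 := by
        rw [lt_div_iff₀ (by positivity)] at hx
        nlinarith
      have b3 := norm_add_le ((T h x - x) - T h (x - y)) (x - y)
      have b4 := norm_sub_le (T h x - x) (T h (x - y))
      rw [e]; linarith
    rw [← Ioi_insert, nhdsWithin_insert]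
    refine eventually_sup.2 ⟨?_, hpos⟩
    simp [h0, hε]
  refine ⟨h0, hadd, fun y t ht => ?_⟩
  have ht0 : (0 : ℝ) ≤ t := ht
  obtain ⟨C, hC0, hC⟩ := hb1 (t + 1)
  rw [ContinuousWithinAt, tendsto_iff_norm_sub_tendsto_zero]
  have hsq : Tendsto (fun s : ℝ => C * ‖T |s - t| y - y‖) (𝓝[Ici 0] t) (𝓝 0) := by
    have h1 : Tendsto (fun s : ℝ => |s - t|) (𝓝[Ici 0] t) (𝓝[≥] 0) := by
      refine tendsto_nhdsWithin_iff.2 ⟨?_, Eventually.of_forall fun s => mem_Ici.2 (abs_nonneg _)⟩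
      have : Continuous fun s : ℝ => |s - t| := by fun_prop
      have := (this.tendsto t).mono_left (nhdsWithin_le_nhds (s := Ici 0))
      simpa using this
    have := (tendsto_iff_norm_sub_tendsto_zero.1 (hright y)).comp h1
    simpa using this.const_mul C
  refine squeeze_zero' (Eventually.of_forall fun s => norm_nonneg _) ?_ hsq
  filter_upwards [self_mem_nhdsWithin, mem_nhdsWithin_of_mem_nhds (Iic_mem_nhds (lt_add_one t))]
    with s hs hs1
  have hs0 : (0 : ℝ) ≤ s := hs
  rcases le_total t s with h | h
  · have e : T s y - T t y = T t (T (s - t) y - y) := by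
      rw [map_sub, ← ContinuousLinearMap.comp_apply, ← hadd t (s - t) ht0 (sub_nonneg.2 h),
        add_sub_cancel]
    rw [abs_of_nonneg (sub_nonneg.2 h), e]
    exact hC t ht0 (by linarith) _
  · have e : T s y - T t y = -(T s (T (t - s) y - y)) := by
      rw [map_sub, ← ContinuousLinearMap.comp_apply, ← hadd s (t - s) hs0 (sub_nonneg.2 h),
        add_sub_cancel]
      abel
    rw [abs_sub_comm, abs_of_nonneg (sub_nonneg.2 h), e, norm_neg]
    exact hC s hs0 hs1 _

theorem generatorRel_iff {y z : Y} :
    GeneratorRel T y z ↔ Tendsto (fun h : ℝ => h⁻¹ • (T h y - y)) (𝓝[>] 0) (𝓝 z) := by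
  rw [GeneratorRel]
  refine tendsto_congr fun h => ?_
  rw [← Complex.ofReal_inv, Complex.coe_smul]

theorem hasDerivWithinAt_Ici_iff {f : ℝ → Y} {f' : Y} {r : ℝ} :
    HasDerivWithinAt f f' (Ici r) r ↔
      Tendsto (fun h : ℝ => h⁻¹ • (f (r + h) - f r)) (𝓝[>] 0) (𝓝 f') := by
  rw [hasDerivWithinAt_iff_tendsto_slope, Ici_sdiff_left]
  have e1 : Tendsto (fun h : ℝ => r + h) (𝓝[>] 0) (𝓝[>] r) := by
    refine tendsto_nhdsWithin_iff.2 ⟨?_, ?_⟩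
    · have : Continuous fun h : ℝ => r + h := by fun_prop
      have := (this.tendsto 0).mono_left (nhdsWithin_le_nhds (s := Ioi 0))
      simpa using this
    · filter_upwards [self_mem_nhdsWithin] with h hh
      exact mem_Ioi.2 (lt_add_of_pos_right r hh)
  have e2 : Tendsto (fun t : ℝ => t - r) (𝓝[>] r) (𝓝[>] 0) := by
    refine tendsto_nhdsWithin_iff.2 ⟨?_, ?_⟩
    · have : Continuous fun t : ℝ => t - r := by fun_prop
      have := (this.tendsto r).mono_left (nhdsWithin_le_nhds (s := Ioi r))
      simpa using this
    · filter_upwards [self_mem_nhdsWithin] with h hh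
      exact mem_Ioi.2 (sub_pos.2 hh)
  constructor <;> intro h
  · refine (h.comp e1).congr fun t => ?_
    simp [slope_def_module]
  · refine (h.comp e2).congr fun t => ?_
    simp [slope_def_module]

theorem IsC0Semigroup.hasDerivWithinAt (hT : IsC0Semigroup T) {y z : Y} (h : GeneratorRel T y z)
    {r : ℝ} (hr : 0 ≤ r) : HasDerivWithinAt (fun r => T r y) (T r z) (Ici r) r := by
  rw [hasDerivWithinAt_Ici_iff]
  have h1 := ((T r).continuous.tendsto z).comp (generatorRel_iff.1 h)
  refine h1.congr' ?_
  filter_upwards [self_mem_nhdsWithin] with s hs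
  rw [Function.comp_apply, hT.map_add r s hr (le_of_lt hs), ContinuousLinearMap.comp_apply,
    ← map_sub, ← Complex.coe_smul, map_smul, Complex.coe_smul]

theorem IsC0Semigroup.generatorRel_apply (hT : IsC0Semigroup T) {y z : Y} (h : GeneratorRel T y z)
    {r : ℝ} (hr : 0 ≤ r) : GeneratorRel T (T r y) (T r z) := by
  rw [generatorRel_iff]
  refine (hasDerivWithinAt_Ici_iff.1 (hT.hasDerivWithinAt h hr)).congr' ?_
  filter_upwards [self_mem_nhdsWithin] with s hs
  rw [← ContinuousLinearMap.comp_apply, ← hT.map_add s r (le_of_lt hs) hr, add_comm s r]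

/-- The generator is closed. -/
theorem IsC0Semigroup.isClosed_generatorRel (hT : IsC0Semigroup T) {K w : ℝ} (hK : 0 ≤ K)
    (hb : ∀ r, 0 ≤ r → ∀ y, ‖T r y‖ ≤ K * Real.exp (w * r) * ‖y‖) :
    IsClosed {yz : Y × Y | GeneratorRel T yz.1 yz.2} := by
  refine isClosed_of_closure_subset ?_
  rintro ⟨y, z⟩ hyz
  rw [mem_ofPred_eq, generatorRel_iff]
  simp only
  rw [Metric.tendsto_nhdsWithin_nhds]
  intro ε hε
  have hcz := hT.strongly_continuous z 0 self_mem_Ici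
  obtain ⟨δ, hδ, hδz⟩ := Metric.continuousWithinAt_iff.1 hcz (ε / 2) (by positivity)
  refine ⟨δ, hδ, fun h hh hhd => ?_⟩
  have hh0 : (0:ℝ) < h := hh
  rw [Real.dist_eq, sub_zero, abs_of_pos hh0] at hhd
  set C := K * Real.exp (|w| * h) + 1 with hC
  have hC0 : 0 ≤ C := by positivity
  have key : ‖T h y - y - h • z‖ ≤ ε / 2 * h := by
    -- The mean value inequality for `T r a - r • b` gives a bound on the difference quotient that
    -- is a closed condition on `(a, b)`. It therefore passes to the limit `(y, z)`, where the term
    -- with `‖b - z‖` disappears.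
    have hcl : ∀ yz ∈ {yz : Y × Y | GeneratorRel T yz.1 yz.2},
        ‖T h yz.1 - yz.1 - h • yz.2‖ ≤ (C * ‖yz.2 - z‖ + ε / 2) * h := by
      rintro ⟨a, b⟩ hab
      have hder : ∀ r ∈ Ico (0:ℝ) h, HasDerivWithinAt (fun r => T r a - r • b) (T r b - b)
          (Ici r) r := by
        intro r hr
        have := (hT.hasDerivWithinAt hab hr.1).fun_sub
          ((hasDerivWithinAt_id r (Ici r)).smul_const b)
        simpa using this
      have hcont : ContinuousOn (fun r => T r a - r • b) (Icc 0 h) :=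
        ((hT.strongly_continuous a).mono Icc_subset_Ici_self).sub (by fun_prop)
      have hbd : ∀ r ∈ Ico (0:ℝ) h, ‖T r b - b‖ ≤ C * ‖b - z‖ + ε / 2 := by
        intro r hr
        have e : T r b - b = T r (b - z) + (T r z - z) - (b - z) := by rw [map_sub]; abel
        have b1 : ‖T r (b - z)‖ ≤ K * Real.exp (|w| * h) * ‖b - z‖ := by
          refine (hb r hr.1 _).trans ?_
          gcongr
          · exact hr.1
          · exact le_abs_self w
          · exact hr.2.le
        have b2 : ‖T r z - z‖ ≤ ε / 2 := by
          have := hδz (x := r) hr.1 (by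
            rw [Real.dist_eq, sub_zero, abs_of_nonneg hr.1]; exact hr.2.trans hhd)
          rw [hT.map_zero, dist_eq_norm] at this
          exact this.le
        rw [e, hC]
        have := norm_sub_le (T r (b - z) + (T r z - z)) (b - z)
        have := norm_add_le (T r (b - z)) (T r z - z)
        linarith
      have := norm_image_sub_le_of_norm_deriv_right_le_segment hcont hder hbd h
        (right_mem_Icc.2 hh0.le)
      rw [hT.map_zero, sub_zero] at this
      convert this using 2
      simp; abel
    have hclosed : IsClosed {yz : Y × Y | ‖T h yz.1 - yz.1 - h • yz.2‖
        ≤ (C * ‖yz.2 - z‖ + ε / 2) * h} := by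
      refine isClosed_le ?_ (by fun_prop)
      have := (T h).continuous
      fun_prop
    have h1 : ‖T h y - y - h • z‖ ≤ (C * ‖z - z‖ + ε / 2) * h := closure_minimal hcl hclosed hyz
    simpa using h1
  rw [dist_eq_norm]
  have e : h⁻¹ • (T h y - y) - z = h⁻¹ • (T h y - y - h • z) := by
    rw [smul_sub h⁻¹ (T h y - y), smul_smul, inv_mul_cancel₀ hh0.ne', one_smul]
  rw [e, norm_smul, norm_inv, Real.norm_of_nonneg hh0.le]
  calc h⁻¹ * ‖T h y - y - h • z‖ ≤ h⁻¹ * (ε / 2 * h) := by gcongr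
    _ = ε / 2 := by field_simp
    _ < ε := by linarith

/-- `c - G` is bounded below if `c` is larger than the growth bound. -/
theorem IsC0Semigroup.norm_le_of_generatorRel (hT : IsC0Semigroup T) {K w c : ℝ} (hK : 0 ≤ K)
    (hb : ∀ r, 0 ≤ r → ∀ y, ‖T r y‖ ≤ K * Real.exp (w * r) * ‖y‖) (hc : w < c) {y z : Y}
    (h : GeneratorRel T y z) : ‖y‖ ≤ K / (c - w) * ‖(c : ℂ) • y - z‖ := by
  set δ := c - w with hδ
  have hδ0 : 0 < δ := sub_pos.2 hc
  set N := ‖(c : ℂ) • y - z‖ with hN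
  -- The orbit of the rescaled semigroup `exp (-c r) T r` has derivative `-exp (-c r) T r (c y -
  -- z)`, which decays at the rate `c - w`. Integrating up to `r` and letting `r → ∞` bounds `y`
  -- itself.
  have hder : ∀ r : ℝ, 0 ≤ r → HasDerivWithinAt (fun r => Real.exp (-c * r) • T r y - y)
      (Real.exp (-c * r) • T r (z - (c : ℂ) • y)) (Ici r) r := by
    intro r hr
    have h1 : HasDerivAt (fun r => Real.exp (-c * r)) (Real.exp (-c * r) * -c) r := by
      have := ((hasDerivAt_id r).const_mul (-c)).exp
      simpa using this
    have h2 := (h1.hasDerivWithinAt (s := Ici r)).smul (hT.hasDerivWithinAt h hr)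
    refine (h2.sub_const y).congr_deriv ?_
    rw [map_sub, map_smul, smul_sub, Complex.coe_smul, mul_smul, neg_smul]
    rw [smul_neg]; abel
  have hcont : ∀ R, ContinuousOn (fun r => Real.exp (-c * r) • T r y - y) (Icc 0 R) := by
    intro R
    have h1 : ContinuousOn (fun r : ℝ => Real.exp (-c * r)) (Icc 0 R) := by fun_prop
    have h2 := (hT.strongly_continuous y).mono (fun r (hr : r ∈ Icc 0 R) => mem_Ici.2 hr.1)
    exact (h1.smul h2).sub continuousOn_const
  have hB : ∀ r : ℝ, HasDerivAt (fun r => K * N / δ * (1 - Real.exp (-δ * r)))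
      (K * N * Real.exp (-δ * r)) r := by
    intro r
    have := (((hasDerivAt_id r).const_mul (-δ)).exp.const_sub 1).const_mul (K * N / δ)
    refine this.congr_deriv ?_
    simp only [id_eq, mul_one]
    field_simp
  have hbd : ∀ r : ℝ, 0 ≤ r → ‖Real.exp (-c * r) • T r (z - (c : ℂ) • y)‖
      ≤ K * N * Real.exp (-δ * r) := by
    intro r hr
    rw [norm_smul, Real.norm_of_nonneg (Real.exp_pos _).le]
    have e : Real.exp (-δ * r) = Real.exp (-c * r) * Real.exp (w * r) := by
      rw [← Real.exp_add]; congr 1; rw [hδ]; ring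
    have := hb r hr (z - (c : ℂ) • y)
    rw [norm_sub_rev, ← hN] at this
    rw [e]
    calc _ ≤ Real.exp (-c * r) * (K * Real.exp (w * r) * N) := by gcongr
      _ = _ := by ring
  have key : ∀ r : ℝ, 0 ≤ r → ‖y‖ ≤ K * N / δ + K * ‖y‖ * Real.exp (-δ * r) := by
    intro r hr
    have h1 := image_norm_le_of_norm_deriv_right_le_deriv_boundary (hcont r)
      (fun x hx => hder x hx.1) (B := fun r => K * N / δ * (1 - Real.exp (-δ * r)))
      (by simp [hT.map_zero]) hB (fun x hx => hbd x hx.1) (right_mem_Icc.2 hr)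
    have h2 : ‖Real.exp (-c * r) • T r y‖ ≤ K * ‖y‖ * Real.exp (-δ * r) := by
      rw [norm_smul, Real.norm_of_nonneg (Real.exp_pos _).le]
      have e : Real.exp (-δ * r) = Real.exp (-c * r) * Real.exp (w * r) := by
        rw [← Real.exp_add]; congr 1; rw [hδ]; ring
      rw [e]
      calc _ ≤ Real.exp (-c * r) * (K * Real.exp (w * r) * ‖y‖) := by gcongr; exact hb r hr y
        _ = _ := by ring
    have h3 : ‖y‖ ≤ ‖Real.exp (-c * r) • T r y - y‖ + ‖Real.exp (-c * r) • T r y‖ := by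
      have := norm_sub_le (Real.exp (-c * r) • T r y) (Real.exp (-c * r) • T r y - y)
      rw [sub_sub_cancel] at this
      linarith
    have h4 : K * N / δ * (1 - Real.exp (-δ * r)) ≤ K * N / δ :=
      mul_le_of_le_one_right (by positivity) (by linarith [Real.exp_pos (-δ * r)])
    linarith
  have hlim : Tendsto (fun r : ℝ => K * N / δ + K * ‖y‖ * Real.exp (-δ * r)) atTop
      (𝓝 (K * N / δ + K * ‖y‖ * 0)) := by
    refine ((Real.tendsto_exp_atBot.comp ?_).const_mul _).const_add _
    exact tendsto_id.const_mul_atTop_of_neg (neg_neg_iff_pos.2 hδ0)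
  rw [mul_zero, add_zero] at hlim
  have := ge_of_tendsto hlim ((eventually_ge_atTop 0).mono key)
  calc ‖y‖ ≤ K * N / δ := this
    _ = _ := by ring

/-- A semigroup is determined by its generator. -/
theorem IsC0Semigroup.eq_of_generatorRel_iff {S : ℝ → Y →L[ℂ] Y} (hT : IsC0Semigroup T)
    (hS : IsC0Semigroup S) {K w : ℝ} (hK : 0 ≤ K)
    (hb : ∀ r, 0 ≤ r → ∀ y, ‖T r y‖ ≤ K * Real.exp (w * r) * ‖y‖)
    (h : ∀ y z, GeneratorRel T y z ↔ GeneratorRel S y z)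
    (hd : ∀ y : Y, ∀ ε : ℝ, 0 < ε → ∃ x z, GeneratorRel T x z ∧ ‖x - y‖ < ε) {t : ℝ} (ht : 0 ≤ t) :
    T t = S t := by
  have hcore : ∀ y z, GeneratorRel T y z → T t y = S t y := by
    intro y z hyz
    have hbt : ∀ r ∈ Icc (0:ℝ) t, ∀ x, ‖T r x‖ ≤ K * Real.exp (|w| * t) * ‖x‖ := by
      intro r hr x
      refine (hb r hr.1 x).trans ?_
      gcongr
      · exact hr.1
      · exact le_abs_self w
      · exact hr.2
    set C := K * Real.exp (|w| * t) with hC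
    have hC0 : 0 ≤ C := by positivity
    -- joint limits of `T (t - r) (f r)`
    have hjoint : ∀ {l : Filter ℝ} {a : ℝ → ℝ} {f : ℝ → Y} {a₀ : ℝ} {f₀ : Y}, a₀ ∈ Icc (0:ℝ) t →
        Tendsto a l (𝓝 a₀) → (∀ᶠ r in l, a r ∈ Icc 0 t) → Tendsto f l (𝓝 f₀) →
        Tendsto (fun r => T (a r) (f r)) l (𝓝 (T a₀ f₀)) := by
      intro l a f a₀ f₀ ha₀ ha hmem hf
      rw [tendsto_iff_norm_sub_tendsto_zero]
      have h1 : Tendsto (fun r => T (a r) f₀) l (𝓝 (T a₀ f₀)) :=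
        (hT.strongly_continuous f₀ a₀ ha₀.1).tendsto.comp
          (tendsto_nhdsWithin_iff.2 ⟨ha, hmem.mono fun r hr => hr.1⟩)
      have h2 := ((tendsto_iff_norm_sub_tendsto_zero.1 hf).const_mul C).add
        (tendsto_iff_norm_sub_tendsto_zero.1 h1)
      rw [mul_zero, add_zero] at h2
      refine squeeze_zero' (Eventually.of_forall fun r => norm_nonneg _) ?_ h2
      filter_upwards [hmem] with r hr
      have e : T (a r) (f r) - T a₀ f₀ = T (a r) (f r - f₀) + (T (a r) f₀ - T a₀ f₀) := by
        rw [map_sub]; abel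
      rw [e]
      exact (norm_add_le _ _).trans (add_le_add (hbt _ hr _) le_rfl)
    -- This curve joins `T t y` to `S t y`. Its right derivative vanishes because `S r y` stays in
    -- the common domain, where both generators agree; a continuous curve with zero right derivative
    -- is constant.
    have hcont : ContinuousOn (fun r => T (t - r) (S r y)) (Icc 0 t) := by
      intro r hr
      refine hjoint ⟨sub_nonneg.2 hr.2, by linarith [hr.1]⟩ ?_ ?_ ?_
      · exact ((by fun_prop : Continuous fun r => t - r).tendsto r).mono_left nhdsWithin_le_nhds
      · filter_upwards [self_mem_nhdsWithin] with x hx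
        exact ⟨sub_nonneg.2 hx.2, by linarith [hx.1]⟩
      · exact (hS.strongly_continuous y r hr.1).mono Icc_subset_Ici_self
    have hder : ∀ r ∈ Ico (0:ℝ) t, HasDerivWithinAt (fun r => T (t - r) (S r y)) 0 (Ici r) r := by
      intro r hr
      rw [hasDerivWithinAt_Ici_iff]
      have hyz' : GeneratorRel S y z := (h y z).1 hyz
      have g1 := hasDerivWithinAt_Ici_iff.1 (hS.hasDerivWithinAt hyz' hr.1)
      have g2 := generatorRel_iff.1 ((h _ _).2 (hS.generatorRel_apply hyz' hr.1))
      have hlim : Tendsto (fun s : ℝ => s⁻¹ • (S (r + s) y - S r y) - s⁻¹ • (T s (S r y) - S r y))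
          (𝓝[>] 0) (𝓝 0) := by
        have := g1.sub g2
        rwa [sub_self] at this
      have hmem : ∀ᶠ s in 𝓝[>] (0:ℝ), t - (r + s) ∈ Icc 0 t := by
        filter_upwards [self_mem_nhdsWithin,
          mem_nhdsWithin_of_mem_nhds (Iic_mem_nhds (sub_pos.2 hr.2))] with s hs hs1
        have h1 : (0:ℝ) < s := hs
        have h2 : s ≤ t - r := hs1
        exact ⟨by linarith, by linarith [hr.1]⟩
      have h3 := hjoint (l := 𝓝[>] (0:ℝ)) (a := fun s => t - (r + s)) (a₀ := t - r)
        ⟨by linarith [hr.2], by linarith [hr.1]⟩ (by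
          have : Continuous fun s : ℝ => t - (r + s) := by fun_prop
          have := (this.tendsto 0).mono_left (nhdsWithin_le_nhds (s := Ioi 0))
          simpa using this) hmem hlim
      rw [_root_.map_zero] at h3
      refine h3.congr' ?_
      filter_upwards [self_mem_nhdsWithin, hmem] with s hs hm
      have e : T (t - r) (S r y) = T (t - (r + s)) (T s (S r y)) := by
        have e' : t - r = t - (r + s) + s := by ring
        conv_lhs => rw [e', hT.map_add _ _ hm.1 (le_of_lt hs)]
        rfl
      rw [e, ← smul_sub, ← Complex.coe_smul, map_smul, ← map_sub, ← Complex.coe_smul]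
      congr 2
      abel
    have := constant_of_has_deriv_right_zero hcont hder t (right_mem_Icc.2 ht)
    simp only [sub_self, sub_zero, hT.map_zero, hS.map_zero] at this
    simpa using this.symm
  refine clm_eq_of_dense fun y ε hε => ?_
  obtain ⟨x, z, hxz, hxy⟩ := hd y ε hε
  exact ⟨x, hcore x z hxz, hxy⟩

/-- Applying `T s - 1` leaves only the integral over `[h, h + s]` minus the one over `[0, s]`;
divided by `s` these tend to `T h y` and `y`. -/
theorem IsC0Semigroup.generatorRel_integral [CompleteSpace Y] (hT : IsC0Semigroup T) (y : Y)
    {h : ℝ} (hh : 0 < h) : GeneratorRel T (∫ r in (0:ℝ)..h, T r y) (T h y - y) := by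
  have hii : ∀ a b : ℝ, 0 ≤ a → 0 ≤ b → IntervalIntegrable (fun r => T r y) volume a b := by
    intro a b ha hb
    refine ((hT.strongly_continuous y).mono ?_).intervalIntegrable
    intro r hr
    exact (le_min ha hb).trans hr.1
  have hderiv : ∀ a : ℝ, 0 ≤ a → Tendsto (fun s : ℝ => s⁻¹ • ∫ r in a..(a + s), T r y) (𝓝[>] 0)
      (𝓝 (T a y)) := by
    intro a ha
    have h1 : HasDerivWithinAt (fun u => ∫ r in a..u, T r y) (T a y) (Ici a) a := by
      refine intervalIntegral.integral_hasDerivWithinAt_right (hii a a ha ha) (t := Ioi a) ?_ ?_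
      · have hm : StronglyMeasurableAtFilter (fun r => T r y) (𝓟 (Ici 0)) volume :=
          ⟨Ici 0, mem_principal_self _,
            (hT.strongly_continuous y).aestronglyMeasurable measurableSet_Ici⟩
        exact hm.filter_mono (nhdsWithin_le_of_mem (mem_of_superset self_mem_nhdsWithin
          fun r hr => ha.trans (le_of_lt hr)) |>.trans inf_le_right)
      · exact ((hT.strongly_continuous y) a ha).mono fun r hr => ha.trans (le_of_lt hr)
    simpa using hasDerivWithinAt_Ici_iff.1 h1
  rw [generatorRel_iff]
  have hlim := (hderiv h hh.le).sub (hderiv 0 le_rfl)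
  rw [hT.map_zero] at hlim
  refine hlim.congr' ?_
  filter_upwards [self_mem_nhdsWithin] with s hs
  have hs0 : (0:ℝ) < s := hs
  have e1 : T s (∫ r in (0:ℝ)..h, T r y) = ∫ r in s..(h + s), T r y := by
    rw [← ContinuousLinearMap.intervalIntegral_comp_comm _ (hii 0 h le_rfl hh.le)]
    have : ∀ r ∈ uIcc 0 h, T s (T r y) = T (r + s) y := by
      intro r hr
      rw [uIcc_of_le hh.le] at hr
      rw [add_comm, hT.map_add s r hs0.le hr.1]; rfl
    rw [intervalIntegral.integral_congr this,
      intervalIntegral.integral_comp_add_right (fun r => T r y), zero_add]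
  have e2 : (∫ r in (0:ℝ)..h, T r y) + ∫ r in h..(h + s), T r y
      = (∫ r in (0:ℝ)..s, T r y) + ∫ r in s..(h + s), T r y := by
    rw [intervalIntegral.integral_add_adjacent_intervals (hii 0 h le_rfl hh.le)
      (hii h (h + s) hh.le (by linarith)),
      intervalIntegral.integral_add_adjacent_intervals (hii 0 s le_rfl hs0.le)
      (hii s (h + s) hs0.le (by linarith))]
  rw [e1, ← smul_sub, zero_add]
  congr 1
  rw [sub_eq_sub_iff_add_eq_add, add_comm, e2, add_comm]

theorem IsC0Semigroup.dense_generatorRel [CompleteSpace Y] (hT : IsC0Semigroup T) (y : Y) {ε : ℝ}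
    (hε : 0 < ε) : ∃ x z, GeneratorRel T x z ∧ ‖x - y‖ < ε := by
  have h1 : Tendsto (fun s : ℝ => s⁻¹ • ∫ r in (0:ℝ)..s, T r y) (𝓝[>] 0) (𝓝 y) := by
    have h1 : HasDerivWithinAt (fun u => ∫ r in (0:ℝ)..u, T r y) (T 0 y) (Ici 0) 0 := by
      refine intervalIntegral.integral_hasDerivWithinAt_right (by simp) (t := Ioi 0) ?_ ?_
      · have hm : StronglyMeasurableAtFilter (fun r => T r y) (𝓟 (Ici 0)) volume :=
          ⟨Ici 0, mem_principal_self _,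
            (hT.strongly_continuous y).aestronglyMeasurable measurableSet_Ici⟩
        exact hm.filter_mono (inf_le_right.trans (principal_mono.2 Ioi_subset_Ici_self))
      · exact ((hT.strongly_continuous y) 0 self_mem_Ici).mono Ioi_subset_Ici_self
    have := hasDerivWithinAt_Ici_iff.1 h1
    simpa [hT.map_zero] using this
  obtain ⟨s, hs, hs0⟩ := ((Metric.tendsto_nhds.1 h1 ε hε).and self_mem_nhdsWithin).exists
  rw [dist_eq_norm] at hs
  refine ⟨_, (s : ℂ)⁻¹ • (T s y - y), ?_, hs⟩
  have h2 := hT.generatorRel_integral y (h := s) hs0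
  rw [GeneratorRel] at h2 ⊢
  refine (h2.const_smul ((s:ℂ)⁻¹)).congr fun h => ?_
  rw [← Complex.coe_smul, Complex.ofReal_inv, map_smul, ← smul_sub, smul_comm]

theorem IsGenerator.dense_domain [CompleteSpace Y] {B : Y →ₗ.[ℂ] Y} (hB : IsGenerator B) :
    Dense (B.domain : Set Y) := by
  obtain ⟨T, hT, h⟩ := hB
  refine Metric.dense_iff.2 fun y ε hε => ?_
  obtain ⟨x, z, hxz, hxy⟩ := hT.dense_generatorRel y hε
  refine ⟨x, mem_ball_iff_norm.2 hxy, ?_⟩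
  exact LinearPMap.mem_domain_of_mem_graph ((h x z).2 hxz)

end Semigroup

/-! ### From the forward assumptions to solvability -/

section Assumptions

variable {Y : Type*} [NormedAddCommGroup Y] [NormedSpace ℂ Y] {I : Set ℝ} {p : ℝ≥0∞}
  {A : ℝ → Y →ₗ.[ℂ] Y}

theorem IsTimeInterval.exists_isCompact_inter (hI : IsTimeInterval I) {t : ℝ} (ht : t ∈ I) :
    ∃ η > 0, IsCompact (I ∩ Icc (t - η) (t + η)) := by
  rcases hI with ⟨a, b, _, rfl⟩ | ⟨b, rfl⟩ | rfl
  · refine ⟨(t - a) / 2, by linarith [ht.1], ?_⟩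
    have : Ioc a b ∩ Icc (t - (t - a) / 2) (t + (t - a) / 2)
        = Iic b ∩ Icc (t - (t - a) / 2) (t + (t - a) / 2) := by
      ext x
      simp only [mem_inter_iff, mem_Ioc, mem_Iic, mem_Icc]
      constructor
      · rintro ⟨⟨-, h1⟩, h2⟩; exact ⟨h1, h2⟩
      · rintro ⟨h1, h2⟩; exact ⟨⟨by linarith [ht.1, h2.1], h1⟩, h2⟩
    rw [this]
    exact isCompact_Icc.inter_left isClosed_Iic
  · exact ⟨1, one_pos, isCompact_Icc.inter_left isClosed_Iic⟩
  · exact ⟨1, one_pos, isCompact_Icc.inter_left isClosed_univ⟩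

/-- A tent function around `t`, narrow enough to stay away from an excluded left end point. It turns
density of `F_p` in `C₀(I, Y)` into density of the values at a single time. -/
theorem IsTimeInterval.exists_zeroAtInfty (hI : IsTimeInterval I) {t : ℝ} (ht : t ∈ I) (y : Y) :
    ∃ g : C₀(I, Y), g ⟨t, ht⟩ = y := by
  obtain ⟨η, hη, hK⟩ := hI.exists_isCompact_inter ht
  have hK' : IsCompact ((↑) ⁻¹' (I ∩ Icc (t - η) (t + η)) : Set I) :=
    (IsInducing.subtypeVal.isCompact_preimage_iff (by
      rw [Subtype.range_coe]; exact inter_subset_left)).2 hK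
  refine ⟨⟨⟨fun r => max 0 (1 - |(r : ℝ) - t| / η) • y, by fun_prop⟩, ?_⟩, ?_⟩
  · refine tendsto_const_nhds.congr' ?_
    filter_upwards [hK'.compl_mem_cocompact] with r hr
    have h1 : η ≤ |(r : ℝ) - t| := by
      by_contra! hlt
      have h2 := abs_lt.1 hlt
      exact hr ⟨r.2, by linarith [h2.1], by linarith [h2.2]⟩
    have h2 : 1 - |(r : ℝ) - t| / η ≤ 0 := by
      rw [sub_nonpos, le_div_iff₀ hη]; linarith
    simp [max_eq_left h2]
  · change max 0 (1 - |t - t| / η) • y = y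
    simp

theorem ForwardAssumptions.exists_isSolvable (hI : IsTimeInterval I) (hp1 : 1 < p) (hp : p ≠ ⊤)
    (hA : ForwardAssumptions I p A) : ∃ M w c : ℝ, IsSolvable I p A M w c := by
  obtain ⟨M, w, c, hwc, -, hK, -, h1, h2, h3⟩ := hA
  refine ⟨M, w, c, hI, hp1, hp, hK, hwc, fun g hg ε hε => ?_, fun g hg ε hε => ?_,
    fun t ht y ε hε => ?_⟩
  · obtain ⟨u, u', z, hu, hug⟩ := h1 g hg ε hε
    exact ⟨_, u, ⟨u', z, hu, EventuallyEq.rfl⟩, hug.le⟩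
  · obtain ⟨u, u', z, hu, hug⟩ := h2 g hg ε hε
    exact ⟨_, u, ⟨u', z, hu, EventuallyEq.rfl⟩, hug.le⟩
  · obtain ⟨g, hg⟩ := hI.exists_zeroAtInfty ht y
    obtain ⟨u, u', z, hu, hug⟩ := h3 g ε hε
    refine ⟨_, u, ⟨u', z, hu, EventuallyEq.rfl⟩, ?_⟩
    have := hug ⟨t, ht⟩
    rwa [hg] at this

end Assumptions

/-! ### Identification of the generator with the closure of `G₀` -/

section Quotient

variable {X : Type*} [NormedAddCommGroup X] [NormedSpace ℂ X] {I : Set ℝ} {p : ℝ≥0∞}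
  {A : ℝ → X →ₗ.[ℂ] X} {M w c : ℝ} {V : ℝ → ℝ → X →L[ℂ] X}

theorem eLpNorm_sliding_restrict_le (hp1 : 1 ≤ p) (hp : p ≠ ⊤) (hI : MeasurableSet I) {f : ℝ → X}
    (hf : MemLp f p (volume.restrict I)) {h : ℝ} (hh : 0 < h) :
    eLpNorm (fun t => ∫ r in Ioc (t - h) t, ‖I.indicator f r‖) p (volume.restrict I)
      ≤ ENNReal.ofReal h * eLpNorm f p (volume.restrict I) := by
  have hF : MemLp (I.indicator f) p volume := (memLp_indicator_iff_restrict hI).2 hf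
  have h1 := eLpNorm_sliding_le hp1 hp hF hh
  rw [eLpNorm_indicator_eq_eLpNorm_restrict hI] at h1
  exact le_trans (eLpNorm_mono_measure _ Measure.restrict_le_self) h1

theorem continuous_sliding (hp1 : 1 ≤ p) (hI : MeasurableSet I) {f : ℝ → X}
    (hf : MemLp f p (volume.restrict I)) {h : ℝ} (hh : 0 < h) :
    Continuous fun t => ∫ r in Ioc (t - h) t, ‖I.indicator f r‖ := by
  have hL : LocallyIntegrable fun r => ‖I.indicator f r‖ :=
    ((memLp_indicator_iff_restrict hI).2 hf).norm.locallyIntegrable hp1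
  have hi : ∀ a b : ℝ, IntervalIntegrable (fun r => ‖I.indicator f r‖) volume a b := fun a b =>
    (hL.integrableOn_isCompact isCompact_uIcc).intervalIntegrable
  have hc := intervalIntegral.continuous_primitive hi 0
  have e : (fun t => ∫ r in Ioc (t - h) t, ‖I.indicator f r‖) = fun t =>
      (∫ r in (0:ℝ)..t, ‖I.indicator f r‖) - ∫ r in (0:ℝ)..(t - h), ‖I.indicator f r‖ := by
    ext t
    rw [intervalIntegral.integral_interval_sub_left (hi _ _) (hi _ _),
      intervalIntegral.integral_of_le (by linarith)]
  rw [e]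
  exact hc.sub (hc.comp (by fun_prop))

variable [CompleteSpace X]

/-- Duhamel's formula over the last time span `h`. If `t - h` lies outside `I`, the translated
function is `0`, and the window `(t - h, t]` contains all of `I` up to `t`, so causality gives the
same formula. -/
theorem IsPropagator.sub_shiftApply_eq (hS : IsSolvable I p A M w c)
    (hV : IsPropagator I p A M w c V) {f u y : ℝ → X} (hu : IsMild I p A c f u) {h t : ℝ}
    (hh : 0 < h) (ht : t ∈ I) (hy : IsMild I p A c ((Ioc (t - h) t).indicator f) y) :
    u t - shiftApply I V h u t = y t := by
  by_cases hm : t - h ∈ I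
  · rw [shiftApply, indicator_of_mem hm]
    exact hV.map_sub_eq hS hm ht (by linarith) hu hy
  · rw [shiftApply, indicator_of_notMem hm, sub_zero]
    refine hu.eq_of_ae_eq hS hy ht ?_
    filter_upwards [ae_restrict_mem hS.interval.measurableSet] with r hr hrt
    rw [indicator_of_mem]
    refine ⟨?_, hrt⟩
    by_contra! hle
    exact hm (hS.interval.ordConnected.out hr ht ⟨hle, by linarith⟩)

/-- The quantity `u t - V t (t - h) (u (t - h))` is the value at `t` of the solution forced by `f`
on the window of length `h`. It should be about `h f t`, but `f` is merely in `L^p`. Therefore `f`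
is compared with some `u₁ ∈ F_p`, whose multiple `h u₁ t` is the value at `t` of an explicit
solution with nearly the same forcing. -/
theorem IsPropagator.norm_quotient_le (hS : IsSolvable I p A M w c)
    (hV : IsPropagator I p A M w c V) {f u f₁ u₁ : ℝ → X} (hu : ResolventPair I p A c f u)
    (hu₁ : ResolventPair I p A c f₁ u₁) {h t : ℝ} (hh : 0 < h) (ht : t ∈ I) :
    ‖h⁻¹ • (shiftApply I V h u t - u t) + f t‖
      ≤ M * h⁻¹ * (∫ r in Ioc (t - h) t, ‖I.indicator (fun r => f r - u₁ r) r‖)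
        + M * (∫ r in Ioc (t - h) t, ‖I.indicator f₁ r‖) + ‖u₁ t - f t‖ := by
  have hM := hS.kato.nonneg
  have hp := hS.one_lt.le
  have hI := hS.interval.ordConnected
  obtain ⟨y, hy⟩ := hS.exists_isMild (hu.memLp.indicator (measurableSet_Ioc (a := t - h) (b := t)))
  have e1 := hV.sub_shiftApply_eq hS hu.isMild hh ht hy
  -- The function `h • ramp • u₁` starts from `0` at `t - h`, equals `h • u₁ t` at `t`, and has
  -- forcing `h • ramp • f₁` plus `u₁` on the window, since the ramp has slope `h⁻¹` there.
  have hr := ((hu₁.smul hp hI (isMultiplier_ramp (t - h) hh)).const_smul (h : ℂ)).isMild.sub hp hI hy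
  have h1 := hr.norm_le_setIntegral hS (s := t - h) ht (ae_of_all _ fun r hr => by
    rw [ramp_of_le hh hr, indicator_of_notMem (fun h => absurd h.1 (not_lt.2 hr)),
      indicator_of_notMem (fun h => absurd h.1 (not_lt.2 hr))]
    simp)
  rw [ramp_of_ge hh (by linarith), one_smul] at h1
  have i1 : IntegrableOn (fun r => ‖I.indicator (fun r => f r - u₁ r) r‖) (Ioc (t - h) t) :=
    (hS.integrable_indicator (hu.memLp.sub hu₁.memLp_right) _ _).norm
  have i2 : IntegrableOn (fun r => ‖I.indicator f₁ r‖) (Ioc (t - h) t) :=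
    (hS.integrable_indicator hu₁.memLp _ _).norm
  have h2 : (∫ r in Ioc (t - h) t, ‖I.indicator (fun r => (h : ℂ) • (ramp (t - h) h r • f₁ r
      + (Ioc (t - h) (t - h + h)).indicator (fun _ => h⁻¹) r • u₁ r)
      - (Ioc (t - h) t).indicator f r) r‖)
      ≤ (∫ r in Ioc (t - h) t, ‖I.indicator (fun r => f r - u₁ r) r‖)
        + h * ∫ r in Ioc (t - h) t, ‖I.indicator f₁ r‖ := by
    rw [← integral_const_mul, ← integral_add i1 (i2.const_mul h)]
    refine setIntegral_mono_on (hS.integrable_indicator hr.1 _ _).norm (i1.add (i2.const_mul h))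
      measurableSet_Ioc fun r hr => ?_
    by_cases hrI : r ∈ I
    · simp only [indicator_of_mem hrI, sub_add_cancel, indicator_of_mem hr]
      have e : (h : ℂ) • (ramp (t - h) h r • f₁ r + h⁻¹ • u₁ r) - f r
          = (h * ramp (t - h) h r) • f₁ r - (f r - u₁ r) := by
        rw [Complex.coe_smul, smul_add, smul_smul, smul_smul, mul_inv_cancel₀ hh.ne', one_smul]
        abel
      rw [e]
      refine (_root_.norm_sub_le _ _).trans ?_
      rw [norm_smul, Real.norm_of_nonneg (mul_nonneg hh.le (ramp_nonneg hh r)), add_comm]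
      gcongr
      exact mul_le_of_le_one_right hh.le (ramp_le_one hh r)
    · simp [indicator_of_notMem hrI]
  have e2 : h⁻¹ • (shiftApply I V h u t - u t) + f t
      = h⁻¹ • ((h : ℂ) • u₁ t - y t) - (u₁ t - f t) := by
    rw [← e1, Complex.coe_smul, smul_sub h⁻¹ (h • u₁ t), smul_smul, inv_mul_cancel₀ hh.ne', one_smul,
      ← neg_sub (shiftApply I V h u t) (u t), smul_neg]
    abel
  rw [e2]
  refine (_root_.norm_sub_le _ _).trans (add_le_add ?_ le_rfl)
  rw [norm_smul, Real.norm_of_nonneg (inv_nonneg.2 hh.le)]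
  calc _ ≤ h⁻¹ * (M * ((∫ r in Ioc (t - h) t, ‖I.indicator (fun r => f r - u₁ r) r‖)
        + h * ∫ r in Ioc (t - h) t, ‖I.indicator f₁ r‖)) := by
        gcongr
        exact h1.trans (by gcongr)
    _ = _ := by field_simp

theorem IsPropagator.eLpNorm_quotient_le (hS : IsSolvable I p A M w c)
    (hV : IsPropagator I p A M w c V) {f u f₁ u₁ : ℝ → X} (hu : ResolventPair I p A c f u)
    (hu₁ : ResolventPair I p A c f₁ u₁) {h : ℝ} (hh : 0 < h) :
    eLpNorm (fun t => h⁻¹ • (shiftApply I V h u t - u t) + f t) p (volume.restrict I)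
      ≤ ENNReal.ofReal M * eLpNorm (fun t => f t - u₁ t) p (volume.restrict I)
        + ENNReal.ofReal (M * h) * eLpNorm f₁ p (volume.restrict I)
        + eLpNorm (fun t => u₁ t - f t) p (volume.restrict I) := by
  have hM := hS.kato.nonneg
  have hp := hS.one_lt.le
  have hI := hS.interval.measurableSet
  have m1 : MemLp (fun t => f t - u₁ t) p (volume.restrict I) := hu.memLp.sub hu₁.memLp_right
  have m2 : MemLp (fun t => u₁ t - f t) p (volume.restrict I) := hu₁.memLp_right.sub hu.memLp
  have c1 := (continuous_sliding hp hI m1 hh).aestronglyMeasurable (μ := volume.restrict I)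
  have c2 := (continuous_sliding hp hI hu₁.memLp hh).aestronglyMeasurable (μ := volume.restrict I)
  refine (eLpNorm_mono_ae_real (g := fun t =>
    M * h⁻¹ * (∫ r in Ioc (t - h) t, ‖I.indicator (fun r => f r - u₁ r) r‖)
        + M * (∫ r in Ioc (t - h) t, ‖I.indicator f₁ r‖) + ‖u₁ t - f t‖) ?_).trans ?_
  · filter_upwards [ae_restrict_mem hI] with t ht
    exact hV.norm_quotient_le hS hu hu₁ hh ht
  refine (eLpNorm_add_le ((c1.const_mul _).add (c2.const_mul _)) m2.1.norm hp).trans ?_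
  rw [eLpNorm_norm]
  refine add_le_add ((eLpNorm_add_le (c1.const_mul _) (c2.const_mul _) hp).trans
    (add_le_add ?_ ?_)) le_rfl
  · refine (eLpNorm_const_smul_le (c := M * h⁻¹)).trans ?_
    rw [Real.enorm_of_nonneg (by positivity)]
    refine (mul_le_mul_right (eLpNorm_sliding_restrict_le hp hS.ne_top hI m1 hh) _).trans_eq ?_
    rw [← mul_assoc, ← ENNReal.ofReal_mul (by positivity), mul_assoc, inv_mul_cancel₀ hh.ne',
      mul_one]
  · refine (eLpNorm_const_smul_le (c := M)).trans ?_
    rw [Real.enorm_of_nonneg hM]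
    refine (mul_le_mul_right (eLpNorm_sliding_restrict_le hp hS.ne_top hI hu₁.memLp hh) _).trans_eq ?_
    rw [← mul_assoc, ← ENNReal.ofReal_mul hM]

variable [Fact (1 ≤ p)]

theorem IsPropagator.norm_shiftFamily_le (hV : IsPropagator I p A M w c V) {σ t : ℝ} (hσ : 0 ≤ σ)
    (ht : t ∈ I) (hm : t - σ ∈ I) (x : X) :
    ‖shiftFamily c V t (t - σ) x‖ ≤ M * Real.exp (w * σ) * ‖x‖ := by
  have h := hV.norm_le (t - σ) hm t ht (by linarith) x
  rw [sub_sub_cancel] at h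
  rw [shiftFamily, sub_sub_cancel, smul_apply, Complex.coe_smul, norm_smul,
    Real.norm_of_nonneg (Real.exp_pos _).le]
  refine (mul_le_mul_of_nonneg_left h (Real.exp_pos _).le).trans_eq ?_
  have : Real.exp (w * σ) = Real.exp (c * σ) * Real.exp (-(c - w) * σ) := by
    rw [← Real.exp_add]; congr 1; ring
  rw [this]; ring

theorem shiftApply_shiftFamily (c : ℝ) (V : ℝ → ℝ → X →L[ℂ] X) (σ : ℝ) (f : ℝ → X) (t : ℝ) :
    shiftApply I (shiftFamily c V) σ f t = Real.exp (c * σ) • shiftApply I V σ f t := by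
  rw [shiftApply, shiftApply]
  by_cases hm : t - σ ∈ I
  · rw [indicator_of_mem hm, indicator_of_mem hm, shiftFamily, sub_sub_cancel,
      smul_apply, Complex.coe_smul]
  · rw [indicator_of_notMem hm, indicator_of_notMem hm, smul_zero]

variable {T : ℝ → Lp X p (volume.restrict I) →L[ℂ] Lp X p (volume.restrict I)}

/-- In the `L^p` version of the quotient bound, `u₁` is chosen close to `f` first; then `h` is taken
small compared with the norm of `f₁`, which may be large. -/
theorem IsPropagator.tendsto_quotient (hS : IsSolvable I p A M w c)
    (hV : IsPropagator I p A M w c V)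
    (hT : ∀ σ : ℝ, 0 ≤ σ → ∀ f : Lp X p (volume.restrict I),
        T σ f =ᵐ[volume.restrict I] shiftApply I (shiftFamily c V) σ f)
    {f u : ℝ → X} (hu : ResolventPair I p A c f u) {u₀ f₀ : Lp X p (volume.restrict I)}
    (hu₀ : u₀ =ᵐ[volume.restrict I] u) (hf₀ : f₀ =ᵐ[volume.restrict I] f) :
    Tendsto (fun h : ℝ => (h : ℂ)⁻¹ • ((Real.exp (-(c * h)) : ℂ) • T h u₀ - u₀)) (𝓝[>] 0)
      (𝓝 (-f₀)) := by
  have hM := hS.kato.nonneg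
  have hI := hS.interval.measurableSet
  refine Metric.tendsto_nhds.2 fun ε hε => ?_
  set δ := ε / (2 * (M + 1)) with hδ
  have hδ0 : 0 < δ := by positivity
  obtain ⟨f₁, u₁, hu₁, hd⟩ := hS.dense f hu.memLp (ENNReal.ofReal δ) (by simpa using hδ0)
  have hd' : eLpNorm (fun t => f t - u₁ t) p (volume.restrict I) ≤ ENNReal.ofReal δ := by
    rw [← eLpNorm_neg]
    simpa [Pi.neg_def] using hd
  set N := (eLpNorm f₁ p (volume.restrict I)).toReal with hN
  have hN' : eLpNorm f₁ p (volume.restrict I) = ENNReal.ofReal N :=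
    (ENNReal.ofReal_toReal hu₁.memLp.2.ne).symm
  have hN0 : 0 ≤ N := ENNReal.toReal_nonneg
  have hsm : ∀ᶠ h in 𝓝[>] (0:ℝ), M * h * N < ε / 2 := by
    refine (Tendsto.mono_left ?_ nhdsWithin_le_nhds).eventually_lt_const (half_pos hε)
    have : Continuous fun h : ℝ => M * h * N := by fun_prop
    simpa using this.tendsto 0
  filter_upwards [hsm, self_mem_nhdsWithin] with h h1 hh
  have hh0 : (0:ℝ) < h := hh
  have h2 := hV.eLpNorm_quotient_le hS hu hu₁ hh0
  have hae : ((h : ℂ)⁻¹ • ((Real.exp (-(c * h)) : ℂ) • T h u₀ - u₀) - -f₀ :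
      Lp X p (volume.restrict I))
      =ᵐ[volume.restrict I] fun t => h⁻¹ • (shiftApply I V h u t - u t) + f t := by
    filter_upwards [hT h hh0.le u₀, shiftApply_congr (U := shiftFamily c V) hI hu₀ h, hu₀, hf₀,
      Lp.coeFn_sub ((h : ℂ)⁻¹ • ((Real.exp (-(c * h)) : ℂ) • T h u₀ - u₀)) (-f₀), Lp.coeFn_neg f₀,
      Lp.coeFn_smul (h : ℂ)⁻¹ ((Real.exp (-(c * h)) : ℂ) • T h u₀ - u₀),
      Lp.coeFn_sub ((Real.exp (-(c * h)) : ℂ) • T h u₀) u₀,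
      Lp.coeFn_smul (Real.exp (-(c * h)) : ℂ) (T h u₀)] with t a1 a2 a3 a4 a5 a6 a7 a8 a9
    rw [a5, Pi.sub_apply, a6, Pi.neg_apply, a7, Pi.smul_apply, a8, Pi.sub_apply, a9, Pi.smul_apply,
      a1, a2, a3, a4, shiftApply_shiftFamily, ← Complex.ofReal_inv, Complex.coe_smul,
      Complex.coe_smul, smul_smul, ← Real.exp_add]
    simp
  rw [dist_eq_norm, Lp.norm_def, eLpNorm_congr_ae hae]
  have h3 : eLpNorm (fun t => h⁻¹ • (shiftApply I V h u t - u t) + f t) p (volume.restrict I)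
      ≤ ENNReal.ofReal (M * δ + M * h * N + δ) := by
    refine h2.trans ?_
    have p1 : 0 ≤ M * h := by positivity
    rw [hN', ENNReal.ofReal_add (by positivity) hδ0.le, ENNReal.ofReal_add (by positivity) (by positivity),
      ENNReal.ofReal_mul (q := δ) hM, ENNReal.ofReal_mul (q := N) p1]
    gcongr
  refine (ENNReal.toReal_le_of_le_ofReal (by positivity) h3).trans_lt ?_
  have : M * δ + δ = ε / 2 := by rw [hδ]; field_simp
  linarith

theorem IsPropagator.generatorRel (hS : IsSolvable I p A M w c) (hV : IsPropagator I p A M w c V)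
    (hT : ∀ σ : ℝ, 0 ≤ σ → ∀ f : Lp X p (volume.restrict I),
        T σ f =ᵐ[volume.restrict I] shiftApply I (shiftFamily c V) σ f)
    {f g : Lp X p (volume.restrict I)} (h : (f, g) ∈ G0Graph I p A) : GeneratorRel T f g := by
  obtain ⟨u, u', z, hu, hfu, hgu⟩ := h
  have h1 : ResolventPair I p A c (fun t => (c : ℂ) • u t - (-u' t + z t)) u :=
    ⟨u', z, hu, EventuallyEq.rfl⟩
  have hf₀ : ((c : ℂ) • f - g : Lp X p (volume.restrict I)) =ᵐ[volume.restrict I]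
      fun t => (c : ℂ) • u t - (-u' t + z t) := by
    filter_upwards [hfu, hgu, Lp.coeFn_sub ((c : ℂ) • f) g, Lp.coeFn_smul (c : ℂ) f]
      with t a1 a2 a3 a4
    rw [a3, Pi.sub_apply, a4, Pi.smul_apply, a1, a2]
  have h2 := hV.tendsto_quotient hS hT h1 hfu hf₀
  have hexp : Tendsto (fun h : ℝ => (Real.exp (c * h) : ℂ)) (𝓝[>] 0) (𝓝 1) := by
    have : Continuous fun h : ℝ => (Real.exp (c * h) : ℂ) := by fun_prop
    simpa using (this.tendsto 0).mono_left (nhdsWithin_le_nhds (s := Ioi 0))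
  have hder : Tendsto (fun h : ℝ => (h : ℂ)⁻¹ * ((Real.exp (c * h) : ℂ) - 1)) (𝓝[>] 0)
      (𝓝 (c : ℂ)) := by
    have : HasDerivAt (fun h : ℝ => Real.exp (c * h)) c 0 := by
      simpa using ((hasDerivAt_id (0:ℝ)).const_mul c).exp
    have := (Complex.continuous_ofReal.tendsto _).comp this.tendsto_slope_zero_right
    simpa [Function.comp_def] using this
  have h3 := (hexp.smul h2).add (hder.smul_const f)
  have e : (1 : ℂ) • -((c : ℂ) • f - g) + (c : ℂ) • f = g := by
    rw [one_smul]; abel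
  rw [e] at h3
  refine h3.congr fun h => ?_
  have e1 : (Real.exp (c * h) : ℂ) * (Real.exp (-(c * h)) : ℂ) = 1 := by
    rw [← Complex.ofReal_mul, ← Real.exp_add]; simp
  rw [smul_comm (Real.exp (c * h) : ℂ) (h : ℂ)⁻¹, smul_sub (Real.exp (c * h) : ℂ), smul_smul, e1,
    one_smul, mul_smul, ← smul_add, sub_smul, one_smul]
  congr 1
  abel

theorem GeneratorRel.sub {Y : Type*} [NormedAddCommGroup Y] [NormedSpace ℂ Y]
    {T : ℝ → Y →L[ℂ] Y} {a b a' b' : Y} (h : GeneratorRel T a b) (h' : GeneratorRel T a' b') :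
    GeneratorRel T (a - a') (b - b') := by
  refine (Tendsto.sub h h').congr fun r => ?_
  rw [← smul_sub, map_sub]
  congr 1
  abel

/-- The generator is closed and extends `G₀`, so it contains the closure. Conversely, `c - G₀` has
dense range and `c` minus the generator is bounded below, so every element of the generator's graph
is a limit of elements of the graph of `G₀`. -/
theorem IsPropagator.isGeneratedBy (hS : IsSolvable I p A M w c) (hV : IsPropagator I p A M w c V) :
    IsGeneratedBy I p A (shiftFamily c V) := by
  have hM := hS.kato.nonneg
  have hIo := hS.interval.ordConnected
  have hU := hV.isEvolutionFamily hS
  refine ⟨hU, ?_⟩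
  obtain ⟨T, hT, hT0, hTadd⟩ := exists_evolutionSemigroup (p := p) hIo hU
  have hb : ∀ r, 0 ≤ r → ∀ y, ‖T r y‖ ≤ M * Real.exp (w * r) * ‖y‖ := fun r hr y =>
    norm_evolutionSemigroup_le hIo.measurableSet (by positivity) (hT r hr)
      (fun t ht hm x => hV.norm_shiftFamily_le hr ht hm x) y
  have hgen := fun {f g : Lp X p (volume.restrict I)} (h : (f, g) ∈ G0Graph I p A) =>
    hV.generatorRel hS hT h
  have hpair : ∀ {f u : ℝ → X} (h : ResolventPair I p A c f u), ∃ a b : Lp X p (volume.restrict I),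
      (a, b) ∈ G0Graph I p A ∧ a =ᵐ[volume.restrict I] u ∧
        ((c : ℂ) • a - b : Lp X p (volume.restrict I)) =ᵐ[volume.restrict I] f := by
    intro f u h
    obtain ⟨u', z, hu, hf⟩ := h
    have m1 := hu.sobolev.1
    have m2 : MemLp (fun t => -u' t + z t) p (volume.restrict I) := hu.sobolev.2.1.neg.add hu.memLp
    refine ⟨m1.toLp _, m2.toLp _, ⟨u, u', z, hu, m1.coeFn_toLp, m2.coeFn_toLp⟩, m1.coeFn_toLp, ?_⟩
    filter_upwards [hf, m1.coeFn_toLp, m2.coeFn_toLp, Lp.coeFn_sub ((c : ℂ) • m1.toLp u) (m2.toLp _),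
      Lp.coeFn_smul (c : ℂ) (m1.toLp u)] with t a1 a2 a3 a4 a5
    rw [a4, Pi.sub_apply, a5, Pi.smul_apply, a2, a3, a1]
  have hC0 : IsC0Semigroup T := by
    refine isC0Semigroup_of_tendsto hT0 hTadd hM hb fun y ε hε => ?_
    obtain ⟨f, u, hu, hd⟩ := hS.dense y (Lp.memLp y) (ENNReal.ofReal (ε / 2)) (by simpa using hε)
    obtain ⟨a, b, hab, hau, -⟩ := hpair hu
    refine ⟨a, ?_, ?_⟩
    · rw [Lp.norm_def]
      have e : (a - y : Lp X p (volume.restrict I)) =ᵐ[volume.restrict I] fun t => u t - y t := by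
        filter_upwards [Lp.coeFn_sub a y, hau] with t a1 a2
        rw [a1, Pi.sub_apply, a2]
      rw [eLpNorm_congr_ae e]
      exact (ENNReal.toReal_le_of_le_ofReal (by positivity) hd).trans_lt (by linarith)
    · have h1 : Tendsto (fun h : ℝ => (h : ℂ)⁻¹ • (T h a - a)) (𝓝[>] 0) (𝓝 b) := hgen hab
      have h2 : Tendsto (fun h : ℝ => (h : ℂ)) (𝓝[>] 0) (𝓝 0) := by
        simpa using (Complex.continuous_ofReal.tendsto 0).mono_left (nhdsWithin_le_nhds (s := Ioi 0))
      have h3 := (h2.smul h1).add_const a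
      rw [zero_smul, zero_add] at h3
      refine h3.congr' ?_
      filter_upwards [self_mem_nhdsWithin] with h hh
      rw [smul_smul, mul_inv_cancel₀ (Complex.ofReal_ne_zero.2 (ne_of_gt hh)), one_smul,
        sub_add_cancel]
  refine ⟨T, hC0, hT, fun f g => ⟨fun h => ?_, fun h => ?_⟩⟩
  · exact closure_minimal (fun yz hyz => hgen hyz) (hC0.isClosed_generatorRel hM hb) h
  -- Choose `(a, b)` in the graph of `G₀` with `c a - b` close to `c f - g`. The lower bound gives
  -- `a` close to `f`, and then `b` is close to `g`.
  · have hlim : ∀ ε : ℝ, 0 < ε → ∃ a b : Lp X p (volume.restrict I), (a, b) ∈ G0Graph I p A ∧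
        ‖a - f‖ ≤ M / (c - w) * ε ∧ ‖b - g‖ ≤ (|c| * (M / (c - w)) + 1) * ε := by
      intro ε hε
      obtain ⟨k, u, hu, hd⟩ := hS.dense_range _ (Lp.memLp ((c : ℂ) • f - g)) (ENNReal.ofReal ε)
        (by simpa using hε)
      obtain ⟨a, b, hab, hau, habk⟩ := hpair hu
      have hcw := sub_pos.2 hS.lt
      have hn : ‖(c : ℂ) • (a - f) - (b - g)‖ ≤ ε := by
        have e0 : (c : ℂ) • (a - f) - (b - g) = ((c : ℂ) • a - b) - ((c : ℂ) • f - g) := by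
          rw [smul_sub]; abel
        have e : (((c : ℂ) • a - b) - ((c : ℂ) • f - g) : Lp X p (volume.restrict I))
            =ᵐ[volume.restrict I] fun t => k t - ((c : ℂ) • f - g : Lp X p (volume.restrict I)) t := by
          filter_upwards [Lp.coeFn_sub ((c : ℂ) • a - b) ((c : ℂ) • f - g), habk] with t a1 a2
          rw [a1, Pi.sub_apply, a2]
        rw [e0, Lp.norm_def, eLpNorm_congr_ae e]
        exact ENNReal.toReal_le_of_le_ofReal hε.le hd
      have h1 : ‖a - f‖ ≤ M / (c - w) * ε :=
        (hC0.norm_le_of_generatorRel hM hb hS.lt ((hgen hab).sub h)).trans (by gcongr)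
      refine ⟨a, b, hab, h1, ?_⟩
      have h2 : b - g = (c : ℂ) • (a - f) - ((c : ℂ) • (a - f) - (b - g)) := by abel
      rw [h2]
      refine (_root_.norm_sub_le _ _).trans ?_
      rw [norm_smul, Complex.norm_real, Real.norm_eq_abs]
      calc _ ≤ |c| * (M / (c - w) * ε) + ε := by gcongr
        _ = _ := by ring
    have hcw := sub_pos.2 hS.lt
    refine Metric.mem_closure_iff.2 fun ε hε => ?_
    set K := M / (c - w) + (|c| * (M / (c - w)) + 1) with hK
    have hK0 : 0 < K := by positivity
    obtain ⟨a, b, hab, h1, h2⟩ := hlim (ε / (2 * K)) (by positivity)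
    refine ⟨(a, b), hab, ?_⟩
    have e : K * (ε / (2 * K)) < ε := by
      have : K * (ε / (2 * K)) = ε / 2 := by field_simp
      linarith
    have p1 : 0 ≤ M / (c - w) * (ε / (2 * K)) := by positivity
    have p2 : 0 ≤ (|c| * (M / (c - w)) + 1) * (ε / (2 * K)) := by positivity
    have e' : M / (c - w) * (ε / (2 * K)) + (|c| * (M / (c - w)) + 1) * (ε / (2 * K)) < ε := by
      rw [← add_mul]; exact e
    rw [dist_comm, Prod.dist_eq, dist_eq_norm, dist_eq_norm]
    exact max_lt (by linarith) (by linarith)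

end Quotient

/-! ### The evolution family is determined by the closure of `G₀` -/

section Uniqueness

variable {X : Type*} [NormedAddCommGroup X] [NormedSpace ℂ X] [CompleteSpace X] {I : Set ℝ}
  {p : ℝ≥0∞} [Fact (1 ≤ p)] {A : ℝ → X →ₗ.[ℂ] X}

/-- Both evolution semigroups have the same generator, hence coincide. Applied to the constant `x`
on a short interval, they give `U a (a - σ) x = U₂ a (a - σ) x` for almost every `a` near `t`, and
continuity yields equality at `t`. -/
theorem IsGeneratedBy.eq_of_le (hI : IsTimeInterval I) {U U₂ : ℝ → ℝ → X →L[ℂ] X}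
    (hU : IsGeneratedBy I p A U) (hU₂ : IsGeneratedBy I p A U₂) {s t : ℝ} (hs : s ∈ I) (ht : t ∈ I)
    (hst : s ≤ t) : U t s = U₂ t s := by
  have hIo := hI.ordConnected
  obtain ⟨hE, T, hT, hTU, hTG⟩ := hU
  obtain ⟨hE₂, T₂, hT₂, hTU₂, hTG₂⟩ := hU₂
  obtain ⟨M, w, hb⟩ := hE.exp_bounded
  set σ := t - s with hσ
  have hσ0 : 0 ≤ σ := sub_nonneg.2 hst
  have hTT : T σ = T₂ σ := by
    refine hT.eq_of_generatorRel_iff hT₂ (K := |M|) (w := w) (abs_nonneg M) (fun r hr y => ?_)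
      (fun y z => (hTG y z).symm.trans (hTG₂ y z)) (fun y ε hε => hT.dense_generatorRel y hε) hσ0
    refine norm_evolutionSemigroup_le (U := U) hIo.measurableSet (by positivity) (hTU r hr)
      (fun a ha hm x => ((U a (a - r)).le_opNorm x).trans ?_) y
    gcongr
    refine (hb a ha _ hm (by linarith)).trans ?_
    rw [sub_sub_cancel]
    gcongr
    exact le_abs_self M
  -- The interval extends to the left of `s`, since `s` and `t` may be the right end point of `I`.
  obtain ⟨η, hη, hsub⟩ := hI.exists_Icc_subset hs
  ext x
  have hf : MemLp ((Icc (s - η) s).indicator fun _ => x) p (volume.restrict I) :=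
    memLp_indicator_const p measurableSet_Icc x (Or.inr
      ((Measure.restrict_apply_le _ _).trans_lt (by simp)).ne)
  have hmem : ∀ a ∈ Icc (t - η) t, a - σ ∈ Icc (s - η) s ∧ a ∈ I := by
    intro a ha
    have h1 : a - σ ∈ Icc (s - η) s := ⟨by linarith [ha.1], by linarith [ha.2]⟩
    exact ⟨h1, hIo.out (hsub h1) ht ⟨by linarith, ha.2⟩⟩
  have hae : (fun a => U a (a - σ) x) =ᵐ[volume.restrict (Icc (t - η) t)]
      fun a => U₂ a (a - σ) x := by
    have h1 := shiftApply_congr (U := U) hIo.measurableSet hf.coeFn_toLp σ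
    have h2 := shiftApply_congr (U := U₂) hIo.measurableSet hf.coeFn_toLp σ
    have hIcc : volume.restrict (Icc (t - η) t) ≤ volume.restrict I :=
      Measure.restrict_mono (fun a ha => (hmem a ha).2) le_rfl
    have h3 := hTU σ hσ0 (hf.toLp _)
    have h4 := hTU₂ σ hσ0 (hf.toLp _)
    rw [hTT] at h3
    have h5 := ((h1.symm.trans h3.symm).trans (h4.trans h2))
    filter_upwards [hIcc.absolutelyContinuous.ae_le h5, ae_restrict_mem measurableSet_Icc]
      with a ha hm
    have hm' := hmem a hm
    rw [shiftApply, shiftApply, indicator_of_mem (hsub hm'.1), indicator_of_mem (hsub hm'.1),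
      indicator_of_mem hm'.1] at ha
    exact ha
  have hcont : ∀ {W : ℝ → ℝ → X →L[ℂ] X}, IsEvolutionFamily I W →
      ContinuousOn (fun a => W a (a - σ) x) (Icc (t - η) t) := fun hW =>
    (hW.strongly_continuous x).comp (f := fun a => (a, a - σ)) (by fun_prop)
      fun a ha => ⟨(hmem a ha).2, hsub (hmem a ha).1, by simpa using hσ0⟩
  have := Measure.eqOn_Icc_of_ae_eq (μ := volume) (by linarith : t - η ≠ t) hae (hcont hE)
    (hcont hE₂) (right_mem_Icc.2 (by linarith))
  simpa [hσ] using this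

end Uniqueness

/-! ### The duality identity between `U` and `F'_q` -/

section Duality

variable {X : Type*} [NormedAddCommGroup X] [NormedSpace ℂ X]

/-- The duality pairing as a real bilinear map. -/
noncomputable def pairing (X : Type*) [NormedAddCommGroup X] [NormedSpace ℂ X] :
    StrongDual ℂ X →L[ℝ] X →L[ℝ] ℂ :=
  (ContinuousLinearMap.id ℂ (StrongDual ℂ X)).bilinearRestrictScalars ℝ

@[simp] theorem pairing_apply (f : StrongDual ℂ X) (x : X) : pairing X f x = f x := rfl

theorem real_smul_dual_apply (r : ℝ) (f : StrongDual ℂ X) (x : X) : (r • f) x = r • f x := by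
  rw [← Complex.coe_smul, smul_apply, Complex.coe_smul]

variable {I : Set ℝ} {p q : ℝ≥0∞} {A : ℝ → X →ₗ.[ℂ] X} {M w c : ℝ} {V : ℝ → ℝ → X →L[ℂ] X}

theorem exists_setIntegral_norm_le (hp : 1 ≤ p) {Y : Type*} [NormedAddCommGroup Y] {s t : ℝ}
    (hst : Ioc s t ⊆ I) : ∃ C : ℝ, 0 ≤ C ∧ ∀ f : ℝ → Y, MemLp f p (volume.restrict I) →
      ∫ r in Ioc s t, ‖f r‖ ≤ C * (eLpNorm f p (volume.restrict I)).toReal := by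
  have hle : volume.restrict (Ioc s t) ≤ volume.restrict I := Measure.restrict_mono hst le_rfl
  set K := (volume.restrict (Ioc s t)) univ ^ (1 / (1 : ℝ≥0∞).toReal - 1 / p.toReal) with hK
  have hK' : K ≠ ⊤ := by
    refine ENNReal.rpow_ne_top_of_nonneg ?_ (by simp)
    rw [ENNReal.toReal_one, div_one, sub_nonneg]
    by_cases hp' : p = ⊤
    · simp [hp']
    · have : 1 ≤ p.toReal := by rw [← ENNReal.toReal_one]; exact ENNReal.toReal_mono hp' hp
      rw [div_le_one (by linarith)]; exact this
  refine ⟨K.toReal, ENNReal.toReal_nonneg, fun f hf => ?_⟩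
  have hm := hf.1.mono_measure hle
  rw [integral_norm_eq_lintegral_enorm hm, ← eLpNorm_one_eq_lintegral_enorm, mul_comm,
    ← ENNReal.toReal_mul]
  refine ENNReal.toReal_mono (ENNReal.mul_ne_top hf.2.ne hK') ?_
  exact (eLpNorm_le_eLpNorm_mul_rpow_measure_univ hp hm).trans
    (by gcongr)

variable [CompleteSpace X] {v v' z : ℝ → StrongDual ℂ X}

/-- The product rule for `v r (u r)`; at almost every time the adjoint relation moves `A(r)` from
`u` to `v`. -/
theorem ResolventPair.duality (hp : 1 ≤ p) (hq : 1 ≤ q) (hI : I.OrdConnected)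
    (hd : ∀ t ∈ I, Dense ((A t).domain : Set X)) {f u : ℝ → X} (hu : ResolventPair I p A c f u)
    (hv : MemFBackward I q (fun t => adjoint (A t)) v v' z) {s t : ℝ} (hs : s ∈ I) (ht : t ∈ I)
    (hst : s ≤ t) :
    v t (u t) - v s (u s) = ∫ r in s..t, ((v' r + z r - (c : ℂ) • v r) (u r) + v r (f r)) := by
  obtain ⟨u', k, hu, hf⟩ := hu
  have h1 := (hv.sobolev.isPrimitiveOn hq hI hs ht hst).bilin (pairing X) hst
    (hu.sobolev.isPrimitiveOn hp hI hs ht hst)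
  simp only [pairing_apply] at h1
  rw [h1, intervalIntegral.integral_of_le hst, intervalIntegral.integral_of_le hst]
  have hsub : Ioc s t ⊆ I := Ioc_subset_Icc_self.trans (hI.out hs ht)
  have hle := (Measure.restrict_mono hsub (le_refl volume)).absolutelyContinuous
  refine integral_congr_ae ?_
  filter_upwards [hle.ae_le hf, hle.ae_le hu.graph, hle.ae_le hv.graph,
    ae_restrict_mem measurableSet_Ioc] with r a1 a2 a3 hr
  have e := (mem_graph_adjoint (hd r (hsub hr)) _ _).1 a3 _ _ a2
  rw [a1]
  simp only [add_apply, sub_apply, smul_apply, map_sub, map_add, map_neg, map_smul, e]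
  ring

/-- The orbit `V r s x` need not lie in any domain. It is approximated uniformly on `[s, t]` by some
`u ∈ F_p` whose forcing is small in `L^p` on `(s, t]`, so every term of the identity for `u`
converges. -/
theorem IsPropagator.duality (hS : IsSolvable I p A M w c) (hV : IsPropagator I p A M w c V)
    (hq : 1 ≤ q) (hd : ∀ t ∈ I, Dense ((A t).domain : Set X))
    (hv : MemFBackward I q (fun t => adjoint (A t)) v v' z) {s t : ℝ} (hs : s ∈ I) (ht : t ∈ I)
    (hst : s ≤ t) (x : X) :
    v t (V t s x) - v s x = ∫ r in s..t, (v' r + z r - (c : ℂ) • v r) (V r s x) := by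
  have hM := hS.kato.nonneg
  have hI := hS.interval.ordConnected
  have hIcc : Icc s t ⊆ I := hI.out hs ht
  set g : ℝ → StrongDual ℂ X := fun r => v' r + z r - (c : ℂ) • v r with hg
  have hvc : ContinuousOn v (Icc s t) := (hv.sobolev.continuousOn hq hI).mono hIcc
  have hvi : IntervalIntegrable v volume s t := hvc.intervalIntegrable_of_Icc hst
  have hgi : IntervalIntegrable g volume s t :=
    ((hv.sobolev.isPrimitiveOn hq hI hs ht hst).1.add
      (MemLp.intervalIntegrable hq hI hv.memLp hs ht hst)).sub (hvi.smul (c : ℂ))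
  obtain ⟨B, hB⟩ := isCompact_Icc.exists_bound_of_continuousOn hvc
  have hB0 : 0 ≤ B := (norm_nonneg _).trans (hB s (left_mem_Icc.2 hst))
  obtain ⟨C, hC0, hC⟩ := exists_setIntegral_norm_le (Y := X) hS.one_lt.le
    (hS.interval.Ioc_subset hs ht)
  set G := ∫ r in s..t, ‖g r‖ with hGdef
  have hG0 : 0 ≤ G := intervalIntegral.integral_nonneg hst fun r _ => norm_nonneg _
  have hVc : ContinuousOn (fun r => V r s x) (Icc s t) :=
    (hV.continuousOn hS x).comp (f := fun r => (r, s)) (by fun_prop)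
      fun r hr => ⟨hIcc hr, hs, hr.1⟩
  -- The four summands account for the boundary terms at `t` and `s`, the replacement of the orbit
  -- by `u` in the integral, and the residual forcing `f₁`.
  set K := B * (1 + M) + B * (1 + M) + (G * (1 + M) + B * C) with hK
  have hK0 : 0 ≤ K := by positivity
  refine eq_of_forall_dist_le fun ε hε => ?_
  set η := ε / (K + 1) with hη
  have hη0 : 0 < η := by positivity
  obtain ⟨f, y, hy, hf, hyx⟩ := hS.exists_isMild_near hs x hη0
  obtain ⟨f₁, u, hu, hfd, hud⟩ := hy.2 η hη0
  have hclose : ∀ r ∈ Icc s t, ‖u r - V r s x‖ ≤ (1 + M) * η := by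
    intro r hr
    have e1 := hV.map s hs r (hIcc hr) hr.1 f y hy (ae_of_all _ fun a ha => hf a ha.1)
    have e2 : u r - V r s x = (u r - y r) + V r s (y s - x) := by rw [map_sub, e1]; abel
    have h1 := hV.norm_le' hS hs (hIcc hr) hr.1 (y s - x)
    have h2 : M * ‖y s - x‖ ≤ M * η := by gcongr
    rw [e2]
    refine (norm_add_le _ _).trans ?_
    linarith [hud r (hIcc hr)]
  have huc : ContinuousOn u (Icc s t) := (hu.continuousOn hS.one_lt.le hI).mono hIcc
  have i1 : IntervalIntegrable (fun r => g r (u r)) volume s t :=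
    intervalIntegrable_bilin (L := pairing X) hst hgi huc
  have i2 : IntervalIntegrable (fun r => g r (V r s x)) volume s t :=
    intervalIntegrable_bilin (L := pairing X) hst hgi hVc
  have i3 : IntervalIntegrable (fun r => v r (f₁ r)) volume s t :=
    intervalIntegrable_bilin (L := (pairing X).flip) hst
      (MemLp.intervalIntegrable hS.one_lt.le hI hu.memLp hs ht hst) hvc
  have key := hu.duality hS.one_lt.le hq hI hd hv hs ht hst
  rw [intervalIntegral.integral_add i1 i3] at key
  have b1 : ‖v t (u t - V t s x)‖ ≤ B * (1 + M) * η := by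
    refine ((v t).le_opNorm _).trans ?_
    rw [mul_assoc]
    exact mul_le_mul (hB t (right_mem_Icc.2 hst)) (hclose t (right_mem_Icc.2 hst)) (norm_nonneg _)
      hB0
  have b2 : ‖v s (u s - x)‖ ≤ B * (1 + M) * η := by
    refine ((v s).le_opNorm _).trans ?_
    rw [mul_assoc]
    have := hclose s (left_mem_Icc.2 hst)
    rw [hV.refl hS hs] at this
    exact mul_le_mul (hB s (left_mem_Icc.2 hst)) this (norm_nonneg _) hB0
  have b3 : ‖∫ r in s..t, g r (u r - V r s x)‖ ≤ G * (1 + M) * η := by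
    rw [hGdef, mul_assoc, ← intervalIntegral.integral_mul_const]
    refine intervalIntegral.norm_integral_le_of_norm_le hst (ae_of_all _ fun r hr => ?_)
      (hgi.norm.mul_const _)
    refine ((g r).le_opNorm _).trans ?_
    gcongr
    exact hclose r (Ioc_subset_Icc_self hr)
  have b4 : ‖∫ r in s..t, v r (f₁ r)‖ ≤ B * C * η := by
    have h1 : ∫ r in Ioc s t, ‖f₁ r - f r‖ ≤ C * η :=
      (hC _ (hu.memLp.sub hy.1)).trans (by gcongr; exact hfd)
    have h2 : ∫ r in Ioc s t, ‖f₁ r - f r‖ = ∫ r in s..t, ‖f₁ r‖ := by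
      rw [intervalIntegral.integral_of_le hst]
      refine setIntegral_congr_fun measurableSet_Ioc fun r hr => ?_
      simp only [hf r hr.1, sub_zero]
    rw [h2] at h1
    calc ‖∫ r in s..t, v r (f₁ r)‖ ≤ ∫ r in s..t, B * ‖f₁ r‖ := by
          refine intervalIntegral.norm_integral_le_of_norm_le hst (ae_of_all _ fun r hr => ?_)
            ((MemLp.intervalIntegrable hS.one_lt.le hI hu.memLp hs ht hst).norm.const_mul _)
          exact ((v r).le_opNorm _).trans (by gcongr; exact hB r (Ioc_subset_Icc_self hr))
      _ = B * ∫ r in s..t, ‖f₁ r‖ := intervalIntegral.integral_const_mul _ _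
      _ ≤ B * (C * η) := by gcongr
      _ = _ := by ring
  have e3 : (∫ r in s..t, g r (u r - V r s x))
      = (∫ r in s..t, g r (u r)) - ∫ r in s..t, g r (V r s x) := by
    rw [← intervalIntegral.integral_sub i1 i2]
    simp only [map_sub]
  have e4 : v t (V t s x) - v s x - ∫ r in s..t, g r (V r s x)
      = -v t (u t - V t s x) + v s (u s - x) + ((∫ r in s..t, g r (u r - V r s x))
        + ∫ r in s..t, v r (f₁ r)) := by
    rw [e3, map_sub, map_sub]
    linear_combination key
  rw [dist_eq_norm, e4]
  have n1 := norm_add_le (-v t (u t - V t s x) + v s (u s - x))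
    ((∫ r in s..t, g r (u r - V r s x)) + ∫ r in s..t, v r (f₁ r))
  have n2 := norm_add_le (-v t (u t - V t s x)) (v s (u s - x))
  have n3 := norm_add_le (∫ r in s..t, g r (u r - V r s x)) (∫ r in s..t, v r (f₁ r))
  rw [norm_neg] at n2
  have hfin : K * η ≤ ε := by
    rw [hη, ← mul_div_assoc, div_le_iff₀ (by positivity)]; nlinarith
  have : K * η = B * (1 + M) * η + B * (1 + M) * η + (G * (1 + M) * η + B * C * η) := by
    rw [hK]; ring
  linarith

/-- The bounded extension of `exp (c (r - s))` that is constant outside of `[s, t]`. -/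
theorem isMultiplier_exp (c : ℝ) {s t : ℝ} (hst : s ≤ t) :
    IsMultiplier (fun r => Real.exp (c * (max s (min t r) - s)))
      ((Ioc s t).indicator fun r => c * Real.exp (c * (r - s))) := by
  refine isMultiplier_clamp (G := fun r => Real.exp (c * (r - s))) hst (fun r => ?_) (by fun_prop)
  have := (((hasDerivAt_id r).sub_const s).const_mul c).exp
  simpa [mul_comm] using this

/-- The identity for `V` is applied to `exp (c (r - s)) v r`: the derivative of the weight cancels
the term `c v`. -/
theorem IsPropagator.shiftFamily_duality (hS : IsSolvable I p A M w c)
    (hV : IsPropagator I p A M w c V)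
    (hq : 1 ≤ q) (hd : ∀ t ∈ I, Dense ((A t).domain : Set X))
    (hv : MemFBackward I q (fun t => adjoint (A t)) v v' z) {s t : ℝ} (hs : s ∈ I) (ht : t ∈ I)
    (hst : s ≤ t) (x : X) :
    v t (shiftFamily c V t s x) - v s x = ∫ r in s..t, (v' r + z r) (shiftFamily c V r s x) := by
  have h1 := hV.duality hS hq hd (hv.smul hq hS.interval.ordConnected (isMultiplier_exp c hst))
    hs ht hst x
  have e0 : ∀ r ∈ Icc s t, max s (min t r) = r := fun r hr => by
    rw [min_eq_right hr.2, max_eq_right hr.1]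
  rw [e0 t (right_mem_Icc.2 hst), e0 s (left_mem_Icc.2 hst), real_smul_dual_apply,
    real_smul_dual_apply] at h1
  simp only [sub_self, mul_zero, Real.exp_zero, one_smul] at h1
  have e1 : ∀ r, shiftFamily c V r s x = Real.exp (c * (r - s)) • V r s x := fun r => by
    rw [shiftFamily, smul_apply, Complex.coe_smul]
  have e2 : ∀ (φ : StrongDual ℂ X) (a : ℝ) (y : X), φ (a • y) = a • φ y := fun φ a y => by
    rw [← Complex.coe_smul, map_smul, Complex.coe_smul]
  rw [e1, e2, h1, intervalIntegral.integral_of_le hst, intervalIntegral.integral_of_le hst]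
  refine setIntegral_congr_fun measurableSet_Ioc fun r hr => ?_
  simp only [e0 r (Ioc_subset_Icc_self hr), indicator_of_mem hr, e1, e2]
  simp only [sub_apply, add_apply, smul_apply, Complex.real_smul, smul_eq_mul]
  push_cast
  ring

/-- Valid for every family generated by the closure of `G₀`, since on `[s, t]` it coincides with the
constructed one. -/
theorem IsGeneratedBy.duality [Fact (1 ≤ p)] (hS : IsSolvable I p A M w c) (hq : 1 ≤ q)
    (hd : ∀ t ∈ I, Dense ((A t).domain : Set X)) {U : ℝ → ℝ → X →L[ℂ] X}
    (hU : IsGeneratedBy I p A U)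
    (hv : MemFBackward I q (fun t => adjoint (A t)) v v' z) {s t : ℝ} (hs : s ∈ I) (ht : t ∈ I)
    (hst : s ≤ t) (x : X) :
    v t (U t s x) - v s x = ∫ r in s..t, (v' r + z r) (U r s x) := by
  obtain ⟨V, hV⟩ := hS.exists_isPropagator
  have h1 := hV.shiftFamily_duality hS hq hd hv hs ht hst x
  have h2 : ∀ r ∈ Icc s t, shiftFamily c V r s = U r s := fun r hr =>
    (hV.isGeneratedBy hS).eq_of_le hS.interval hU hs (hS.interval.ordConnected.out hs ht hr) hr.1
  rw [h2 t (right_mem_Icc.2 hst)] at h1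
  rw [h1]
  refine intervalIntegral.integral_congr fun r hr => ?_
  rw [uIcc_of_le hst] at hr
  simp only [h2 r hr]

end Duality

/-! ### Weak solutions on an interval with a right end point -/

section Uniqueness

variable {X : Type*} [NormedAddCommGroup X] [NormedSpace ℂ X] {I : Set ℝ} {p q : ℝ≥0∞}
  {A : ℝ → X →ₗ.[ℂ] X} {B : ℝ → StrongDual ℂ X →ₗ.[ℂ] StrongDual ℂ X}

theorem memLp_indicator_Ioo {Y : Type*} [NormedAddCommGroup Y] {g : ℝ → Y} {s t : ℝ}
    (hg : ContinuousOn g (Icc s t)) : MemLp ((Ioo s t).indicator g) q (volume.restrict I) := by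
  obtain ⟨C, hC⟩ := isCompact_Icc.exists_bound_of_continuousOn hg
  have h1 : MemLp g q (volume.restrict (Ioo s t)) := by
    refine MemLp.of_bound ((hg.mono Ioo_subset_Icc_self).aestronglyMeasurable measurableSet_Ioo) C ?_
    filter_upwards [ae_restrict_mem measurableSet_Ioo] with r hr
    exact hC r (Ioo_subset_Icc_self hr)
  exact MemLp.restrict I ((memLp_indicator_iff_restrict measurableSet_Ioo).2 h1)

/-- For a functional `ξ`, the test function `conj (ξ (e r)) ξ` on `(s, t)` turns the integral into
that of `φ ‖ξ (e r)‖²`. It vanishes only if `ξ ∘ e` does, and functionals separate points. -/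
theorem eqOn_zero_of_forall_integral_eq_zero {s t : ℝ} (hst : s < t) {φ : ℝ → ℝ}
    (hφ : Continuous φ) (hφ0 : ∀ r, 0 < φ r) {e : ℝ → X} (he : ContinuousOn e (Icc s t))
    (h : ∀ g : ℝ → StrongDual ℂ X, MemLp g q (volume.restrict I) → (∀ r ∉ Ioo s t, g r = 0) →
      ∫ r in s..t, φ r • g r (e r) = 0) : EqOn e 0 (Icc s t) := by
  intro r₀ hr₀
  refine SeparatingDual.eq_zero_of_forall_dual_eq_zero (R := ℂ) fun ξ => ?_
  by_contra hne
  have hξe : ContinuousOn (fun r => ξ (e r)) (Icc s t) := ξ.continuous.comp_continuousOn he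
  have hc : ContinuousOn (fun r => (starRingEnd ℂ (ξ (e r))) • ξ) (Icc s t) :=
    (Complex.continuous_conj.comp_continuousOn hξe).smul continuousOn_const
  have h1 := h _ (memLp_indicator_Ioo hc) fun r hr => indicator_of_notMem hr _
  have h2 : ∫ r in s..t, φ r • (Ioo s t).indicator (fun r => (starRingEnd ℂ (ξ (e r))) • ξ) r (e r)
      = ((∫ r in s..t, φ r * ‖ξ (e r)‖ ^ 2 : ℝ) : ℂ) := by
    rw [← intervalIntegral.integral_ofReal, intervalIntegral.integral_of_le hst.le,
      intervalIntegral.integral_of_le hst.le, integral_Ioc_eq_integral_Ioo,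
      integral_Ioc_eq_integral_Ioo]
    refine setIntegral_congr_fun measurableSet_Ioo fun r hr => ?_
    simp only [indicator_of_mem hr, smul_apply, smul_eq_mul, Complex.real_smul]
    rw [Complex.conj_mul']
    push_cast
    ring
  rw [h2, Complex.ofReal_eq_zero] at h1
  have hpos : 0 < ∫ r in s..t, φ r * ‖ξ (e r)‖ ^ 2 := by
    have hcont : ContinuousOn (fun r => φ r * ‖ξ (e r)‖ ^ 2) (Icc s t) :=
      hφ.continuousOn.mul (hξe.norm.pow 2)
    refine intervalIntegral.integral_pos hst hcont
      (fun r _ => mul_nonneg (hφ0 r).le (pow_nonneg (norm_nonneg _) 2)) ⟨r₀, hr₀, ?_⟩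
    exact mul_pos (hφ0 r₀) (pow_pos (norm_pos_iff.2 hne) 2)
  exact hpos.ne' h1

variable [CompleteSpace X]

/-- Uniqueness of weak solutions with zero initial value, if the backward equation
`(c - G₀')v = g` can be solved approximately with approximately vanishing final value. -/
theorem eqOn_zero_of_duality (hq : 1 ≤ q) (hI : I.OrdConnected) {s t c : ℝ} (hs : s ∈ I) (ht : t ∈ I)
    (hst : s < t)
    (hB : ∀ g : ℝ → StrongDual ℂ X, MemLp g q (volume.restrict I) → (∀ r ∉ Ioo s t, g r = 0) →
      ∀ ε : ℝ, 0 < ε → ∃ v v' z : ℝ → StrongDual ℂ X, MemFBackward I q B v v' z ∧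
        (eLpNorm (fun r => ((c : ℂ) • v r - (v' r + z r)) - g r) q (volume.restrict I)).toReal ≤ ε ∧
        ‖v t‖ ≤ ε)
    {e : ℝ → X} (he : ContinuousOn e (Icc s t))
    (h : ∀ v v' z : ℝ → StrongDual ℂ X, MemFBackward I q B v v' z →
      v t (e t) = ∫ r in s..t, (v' r + z r) (e r)) : EqOn e 0 (Icc s t) := by
  -- The hypothesis pairs `e` with `v' + z`, while density concerns `c v - (v' + z)`. Weighting `v`
  -- by `φ`, with `φ' = -c φ`, passes from one to the other.
  set φ : ℝ → ℝ := fun r => Real.exp (-c * (r - s)) with hφ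
  have hφc : Continuous φ := by fun_prop
  refine eqOn_zero_of_forall_integral_eq_zero (I := I) (q := q) hst hφc
    (fun r => Real.exp_pos _) he fun g hg hg0 => ?_
  obtain ⟨E, hE⟩ := isCompact_Icc.exists_bound_of_continuousOn he
  obtain ⟨D, hD⟩ := isCompact_Icc.exists_bound_of_continuousOn (hφc.continuousOn (s := Icc s t))
  have hE0 : 0 ≤ E := (norm_nonneg _).trans (hE s (left_mem_Icc.2 hst.le))
  have hD0 : 0 ≤ D := (norm_nonneg _).trans (hD s (left_mem_Icc.2 hst.le))
  have hIcc : Icc s t ⊆ I := hI.out hs ht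
  obtain ⟨C, hC0, hC⟩ := exists_setIntegral_norm_le (Y := StrongDual ℂ X) hq
    (Ioc_subset_Icc_self.trans hIcc)
  have hgi : IntervalIntegrable g volume s t := MemLp.intervalIntegrable hq hI hg hs ht hst.le
  have hpair : ∀ {k : ℝ → StrongDual ℂ X}, IntervalIntegrable k volume s t →
      IntervalIntegrable (fun r => φ r • k r (e r)) volume s t := fun hk =>
    (intervalIntegrable_bilin (L := pairing X) hst.le hk he).continuousOn_smul hφc.continuousOn
  set K := D * E * C + D * E with hK
  have hK0 : 0 ≤ K := by positivity
  rw [← norm_le_zero_iff]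
  refine le_of_forall_pos_le_add fun ε hε => ?_
  rw [zero_add]
  set η := ε / (K + 1) with hη
  have hη0 : 0 < η := by positivity
  obtain ⟨v, v', z, hv, hvg, hvt⟩ := hB g hg hg0 η hη0
  set f : ℝ → StrongDual ℂ X := fun r => (c : ℂ) • v r - (v' r + z r) with hf
  have hfm : MemLp f q (volume.restrict I) :=
    (hv.sobolev.1.const_smul (c : ℂ)).sub (hv.sobolev.2.1.add hv.memLp)
  have hfi : IntervalIntegrable f volume s t := MemLp.intervalIntegrable hq hI hfm hs ht hst.le
  have h1 := h _ _ _ (hv.smul hq hI (isMultiplier_exp (-c) hst.le))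
  have e0 : ∀ r ∈ Icc s t, max s (min t r) = r := fun r hr => by
    rw [min_eq_right hr.2, max_eq_right hr.1]
  have h2 : φ t • v t (e t) = -∫ r in s..t, φ r • f r (e r) := by
    rw [e0 t (right_mem_Icc.2 hst.le), real_smul_dual_apply] at h1
    rw [h1, ← intervalIntegral.integral_neg, intervalIntegral.integral_of_le hst.le,
      intervalIntegral.integral_of_le hst.le]
    refine setIntegral_congr_fun measurableSet_Ioc fun r hr => ?_
    simp only [e0 r (Ioc_subset_Icc_self hr), indicator_of_mem hr, hf, hφ]
    simp only [sub_apply, add_apply, smul_apply, Complex.real_smul, smul_eq_mul]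
    push_cast
    ring
  have h3 : ∫ r in s..t, φ r • g r (e r)
      = -(∫ r in s..t, φ r • (f r - g r) (e r)) - φ t • v t (e t) := by
    have : (∫ r in s..t, φ r • (f r - g r) (e r))
        = (∫ r in s..t, φ r • f r (e r)) - ∫ r in s..t, φ r • g r (e r) := by
      rw [← intervalIntegral.integral_sub (hpair hfi) (hpair hgi)]
      simp only [sub_apply, smul_sub]
    rw [this, h2]; ring
  have b1 : ‖∫ r in s..t, φ r • (f r - g r) (e r)‖ ≤ D * E * C * η := by
    calc _ ≤ ∫ r in s..t, D * E * ‖f r - g r‖ := by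
          refine intervalIntegral.norm_integral_le_of_norm_le hst.le (ae_of_all _ fun r hr => ?_)
            ((hfi.sub hgi).norm.const_mul _)
          have hr' := Ioc_subset_Icc_self hr
          rw [norm_smul]
          calc _ ≤ D * (‖f r - g r‖ * E) :=
                mul_le_mul (hD r hr') (((f r - g r).le_opNorm _).trans (by gcongr; exact hE r hr'))
                  (norm_nonneg _) hD0
            _ = _ := by ring
      _ = D * E * ∫ r in Ioc s t, ‖f r - g r‖ := by
          rw [intervalIntegral.integral_const_mul, intervalIntegral.integral_of_le hst.le]
      _ ≤ D * E * (C * η) := by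
          gcongr
          exact (hC _ (hfm.sub hg)).trans (by gcongr; exact hvg)
      _ = _ := by ring
  have b2 : ‖φ t • v t (e t)‖ ≤ D * E * η := by
    rw [norm_smul]
    have hr' := right_mem_Icc.2 hst.le
    calc _ ≤ D * (η * E) := mul_le_mul (hD t hr')
          (((v t).le_opNorm _).trans (mul_le_mul hvt (hE t hr') (norm_nonneg _) hη0.le))
          (norm_nonneg _) hD0
      _ = _ := by ring
  rw [h3]
  refine (norm_sub_le _ _).trans ?_
  rw [norm_neg]
  have hfin : K * η ≤ ε := by
    rw [hη, ← mul_div_assoc, div_le_iff₀ (by positivity)]; nlinarith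
  have : K * η = D * E * C * η + D * E * η := by rw [hK]; ring
  linarith

theorem IsGeneratedBy.isWeakSolution [Fact (1 ≤ p)] {M w c : ℝ} (hS : IsSolvable I p A M w c)
    (hq : 1 ≤ q)
    (hd : ∀ t ∈ I, Dense ((A t).domain : Set X)) {U : ℝ → ℝ → X →L[ℂ] X}
    (hU : IsGeneratedBy I p A U) {b s : ℝ} (hb : IsGreatest I b) (hs : s ∈ I) (x : X) :
    IsWeakSolution I q A s b x (fun t => U t s x) := by
  have hsb : s ≤ b := hb.2 hs
  refine ⟨?_, by simp [hU.1.refl s hs], fun v v' z hv => ?_⟩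
  · exact (hU.1.strongly_continuous x).comp (f := fun r => (r, s)) (by fun_prop)
      fun r hr => ⟨hS.interval.ordConnected.out hs hb.1 hr, hs, hr.1⟩
  · rw [← hU.duality hS hq hd hv hs hb.1 hsb x, hv.right_zero b hb]
    simp

/-- Elements of `F'_q` vanish at `b`, so the final value demanded by the duality argument is exactly
`0`, and density of the range of `c - G₀'` suffices. -/
theorem IsWeakSolution.eqOn (hq : 1 ≤ q) (hI : I.OrdConnected)
    (hA' : BackwardAssumptions I q fun t => adjoint (A t)) {b s : ℝ} (hb : IsGreatest I b)
    (hs : s ∈ I) {x : X} {u u₂ : ℝ → X} (hu : IsWeakSolution I q A s b x u)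
    (hu₂ : IsWeakSolution I q A s b x u₂) : EqOn u u₂ (Icc s b) := by
  rcases (hb.2 hs).eq_or_lt with h | hsb
  · intro r hr
    obtain rfl : r = s := le_antisymm (hr.2.trans h.ge) hr.1
    rw [hu.2.1, hu₂.2.1]
  obtain ⟨M, w, c, -, -, -, -, hdr, -, -⟩ := hA'
  have h0 : EqOn (fun r => u r - u₂ r) 0 (Icc s b) := by
    refine eqOn_zero_of_duality (c := c) (B := fun t => adjoint (A t)) hq hI hs hb.1 hsb
      (fun g hg _ ε hε => ?_) (hu.1.sub hu₂.1) fun v v' z hv => ?_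
    · obtain ⟨v, v', z, hv, hvg⟩ := hdr g hg (ENNReal.ofReal ε) (by simpa using hε)
      refine ⟨v, v', z, hv, ENNReal.toReal_le_of_le_ofReal hε.le hvg.le, ?_⟩
      rw [hv.right_zero b hb, norm_zero]; exact hε.le
    · have hgi : IntervalIntegrable (fun r => v' r + z r) volume s b :=
        (hv.sobolev.isPrimitiveOn hq hI hs hb.1 hsb.le).1.add
          (MemLp.intervalIntegrable hq hI hv.memLp hs hb.1 hsb.le)
      have i1 : IntervalIntegrable (fun r => (v' r + z r) (u r)) volume s b :=
        intervalIntegrable_bilin (L := pairing X) hsb.le hgi hu.1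
      have i2 : IntervalIntegrable (fun r => (v' r + z r) (u₂ r)) volume s b :=
        intervalIntegrable_bilin (L := pairing X) hsb.le hgi hu₂.1
      simp only [map_sub]
      rw [intervalIntegral.integral_sub i1 i2, hu.2.2 v v' z hv, hu₂.2.2 v v' z hv,
        hv.right_zero b hb]
      simp
  intro r hr
  exact sub_eq_zero.1 (h0 hr)

end Uniqueness

/-! ### Time reflection on the line and the backward a priori estimate -/

section Reflection

variable {Y : Type*} [NormedAddCommGroup Y] [NormedSpace ℂ Y] {q : ℝ≥0∞} {M w c : ℝ}
  {B : ℝ → Y →ₗ.[ℂ] Y}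

theorem KatoStable.reflect (h : KatoStable (· ≤ ·) univ B M w) :
    KatoStable (· ≥ ·) univ (fun t => B (-t)) M w := by
  refine ⟨fun t _ c hc => h.1 (-t) (mem_univ _) c hc, fun l _ hl c hc => ?_⟩
  have := h.2 (l.map fun t => -t) (fun t _ => mem_univ t)
    (List.pairwise_map.2 (hl.imp fun hab => neg_le_neg hab)) c hc
  simpa [Function.comp_def] using this

theorem memLp_comp_neg {Y : Type*} [NormedAddCommGroup Y] {k : ℝ → Y}
    (hk : MemLp k q (volume.restrict univ)) :
    MemLp (fun t => k (-t)) q (volume.restrict univ) ∧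
      eLpNorm (fun t => k (-t)) q (volume.restrict univ) = eLpNorm k q (volume.restrict univ) := by
  have hmp : MeasurePreserving (fun r : ℝ => -r) volume volume := Measure.measurePreserving_neg _
  rw [Measure.restrict_univ] at hk ⊢
  exact ⟨hk.comp_measurePreserving hmp, eLpNorm_comp_measurePreserving hk.1 hmp⟩

/-- Under `t ↦ -t` the derivative changes sign and `d/dt + B(t)` becomes `-d/dt + B(-t)`, so the
forward estimates apply to the backward problem. -/
theorem MemFBackward.reflect {v v' z : ℝ → Y} (hv : MemFBackward univ q B v v' z) :
    MemF univ q (fun t => B (-t)) (fun t => v (-t)) (fun t => -v' (-t)) (fun t => z (-t)) := by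
  have hmp : MeasurePreserving (fun r : ℝ => -r) volume volume := Measure.measurePreserving_neg _
  refine ⟨⟨(memLp_comp_neg hv.sobolev.1).1, (memLp_comp_neg hv.sobolev.2.1).1.neg,
    fun s _ t _ => ?_⟩, fun a ha => ?_, (memLp_comp_neg hv.memLp).1, ?_⟩
  · rw [hv.sobolev.2.2 (-s) (mem_univ _) (-t) (mem_univ _), intervalIntegral.integral_neg,
      intervalIntegral.integral_comp_neg (fun r => v' r), intervalIntegral.integral_symm]
  · exact absurd (ha.1 (mem_univ (a - 1))) (by linarith)
  · have := hv.graph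
    rw [Measure.restrict_univ] at this ⊢
    exact hmp.quasiMeasurePreserving.ae this

variable [CompleteSpace Y]

theorem MemFBackward.norm_le_decayNorm (hq1 : 1 < q) (hq : q ≠ ⊤)
    (hK : KatoStable (· ≤ ·) univ B M w) (hc : w < c) {v v' z : ℝ → Y}
    (hv : MemFBackward univ q B v v' z) (t : ℝ) :
    ‖v t‖ ≤ M * decayNorm (c - w) univ (fun r => (c : ℂ) • v (-r) - (v' (-r) + z (-r))) (-t) := by
  have h1 : ResolventPair univ q (fun t => B (-t)) c
      (fun r => (c : ℂ) • v (-r) - (v' (-r) + z (-r))) (fun r => v (-r)) :=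
    ⟨_, _, hv.reflect, ae_of_all _ fun r => by simp only [neg_neg]⟩
  have := h1.norm_le_decayNorm (Or.inr (Or.inr rfl)) hq1 hq hK.reflect hc (mem_univ (-t))
  rwa [neg_neg] at this

/-- The backward estimate bounds `v t` by `(c - G₀')v` on `[t, ∞)` alone. There `g` vanishes, so `(c
- G₀')v` equals the approximation error, which is small. -/
theorem exists_backward_approx (hq1 : 1 < q) (hq : q ≠ ⊤)
    (hK : KatoStable (· ≤ ·) univ B M w) (hc : w < c)
    (hd : ∀ g : ℝ → Y, MemLp g q (volume.restrict univ) → ∀ ε : ℝ≥0∞, 0 < ε →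
      ∃ v v' z : ℝ → Y, MemFBackward univ q B v v' z ∧
        eLpNorm (fun t => ((c : ℂ) • v t - (v' t + z t)) - g t) q (volume.restrict univ) < ε)
    {g : ℝ → Y} (hg : MemLp g q (volume.restrict univ)) {t : ℝ} (hg0 : ∀ r, t ≤ r → g r = 0)
    {ε : ℝ} (hε : 0 < ε) : ∃ v v' z : ℝ → Y, MemFBackward univ q B v v' z ∧
        (eLpNorm (fun r => ((c : ℂ) • v r - (v' r + z r)) - g r) q (volume.restrict univ)).toReal ≤ ε ∧
        ‖v t‖ ≤ ε := by
  have hM := hK.nonneg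
  obtain ⟨C, hC0, hC⟩ := exists_decayNorm_le Y hq1 (sub_pos.2 hc) univ
  set η := ε / (1 + M * C) with hη
  have hη0 : 0 < η := by positivity
  have hηε : η * (1 + M * C) = ε := by rw [hη]; field_simp
  have hMC : 0 ≤ M * C := by positivity
  obtain ⟨v, v', z, hv, hvg⟩ := hd g hg (ENNReal.ofReal η) (by simpa using hη0)
  have hN := ENNReal.toReal_le_of_le_ofReal hη0.le hvg.le
  refine ⟨v, v', z, hv, hN.trans (by nlinarith), ?_⟩
  have hkm : MemLp (fun r => ((c : ℂ) • v r - (v' r + z r)) - g r) q (volume.restrict univ) :=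
    ((hv.sobolev.1.const_smul (c : ℂ)).sub (hv.sobolev.2.1.add hv.memLp)).sub hg
  set k : ℝ → Y := fun r => ((c : ℂ) • v r - (v' r + z r)) - g r with hk
  obtain ⟨hkm', hkN⟩ := memLp_comp_neg hkm
  have e : decayNorm (c - w) univ (fun r => (c : ℂ) • v (-r) - (v' (-r) + z (-r))) (-t)
      = decayNorm (c - w) univ (fun r => k (-r)) (-t) := by
    rw [decayNorm, decayNorm]
    congr 1
    ext r
    rcases lt_or_ge (-t - r) 0 with h | h
    · rw [decayKernel_of_neg h, zero_mul, zero_mul]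
    · simp only [hk, hg0 (-r) (by linarith), sub_zero]
  have h1 := hv.norm_le_decayNorm hq1 hq hK hc t
  rw [e] at h1
  have h2 := (hC (-t) _ hkm').2
  rw [hkN] at h2
  calc ‖v t‖ ≤ M * (C * η) := h1.trans (by gcongr; exact h2.trans (by gcongr))
    _ ≤ ε := by nlinarith

end Reflection

/-! ### Weak solutions on the whole line -/

section Line

variable {X : Type*} [NormedAddCommGroup X] [NormedSpace ℂ X] {p q : ℝ≥0∞}
  {A : ℝ → X →ₗ.[ℂ] X} {B : ℝ → StrongDual ℂ X →ₗ.[ℂ] StrongDual ℂ X}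

/-- Both branches of the definition equal `U(t, r) U(s, r)⁻¹` for any earlier `r`. Statements about
the two-sided orbit thus reduce to forward orbits from a remote time. -/
theorem twoSided_apply {U : ℝ → ℝ → X →L[ℂ] X} (hU : IsEvolutionFamily univ U)
    (hinv : IsInvertibleFamily univ U) {r s t : ℝ} (hrs : r ≤ s) (hrt : r ≤ t) (x : X) :
    twoSided U t s x = U t r (Ring.inverse (U s r) x) := by
  have hi : ∀ {a b : ℝ}, b ≤ a → ∀ y, U a b (Ring.inverse (U a b) y) = y := fun hab y =>
    DFunLike.congr_fun (Ring.mul_inverse_cancel _ (hinv _ (mem_univ _) _ (mem_univ _) hab)) y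
  have hi' : ∀ {a b : ℝ}, b ≤ a → ∀ y, Ring.inverse (U a b) (U a b y) = y := fun hab y =>
    DFunLike.congr_fun (Ring.inverse_mul_cancel _ (hinv _ (mem_univ _) _ (mem_univ _) hab)) y
  have hc : ∀ {a b d : ℝ}, d ≤ b → b ≤ a → ∀ y, U a b (U b d y) = U a d y := fun h1 h2 y =>
    DFunLike.congr_fun (hU.comp _ (mem_univ _) _ (mem_univ _) _ (mem_univ _) h1 h2) y
  rw [twoSided]
  split_ifs with h
  · rw [← hc hrs h, hi hrs]
  · have hts := (not_le.1 h).le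
    conv_lhs => rw [← hi hrs x, ← hc hrt hts, hi' hts]

/-- Off the support, the primitive of `v'` is locally constant, so `v' = 0` almost everywhere there
by Lebesgue differentiation; and `z` is the image of `0` under a linear operator. -/
theorem MemFBackward.ae_eq_zero (hq : 1 ≤ q) {v v' z : ℝ → StrongDual ℂ X}
    (hv : MemFBackward univ q B v v' z) : ∀ᵐ r, r ∉ tsupport v → v' r + z r = 0 := by
  have hd : ∀ᵐ r, r ∉ tsupport v → v' r = 0 := by
    have hL : LocallyIntegrable v' volume := by
      have := hv.sobolev.2.1
      rw [Measure.restrict_univ] at this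
      exact this.locallyIntegrable hq
    filter_upwards [LocallyIntegrable.ae_hasDerivAt_integral hL] with r hr hrv
    have h1 : (fun t => ∫ a in (0:ℝ)..t, v' a) =ᶠ[𝓝 r] fun _ => -v 0 := by
      filter_upwards [(isClosed_tsupport v).isOpen_compl.mem_nhds hrv] with t ht
      rw [← hv.sobolev.2.2 0 (mem_univ _) t (mem_univ _), image_eq_zero_of_notMem_tsupport ht,
        zero_sub]
    exact ((hr 0).congr_of_eventuallyEq h1.symm).unique (hasDerivAt_const r _)
  have hg := hv.graph
  rw [Measure.restrict_univ] at hg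
  filter_upwards [hd, hg] with r h1 h2 hr
  rw [image_eq_zero_of_notMem_tsupport hr] at h2
  rw [h1 hr, zero_add]
  exact LinearPMap.graph_fst_eq_zero_snd _ h2 rfl

variable [CompleteSpace X]

theorem MemFBackward.intervalIntegrable_pairing (hq : 1 ≤ q) {v v' z : ℝ → StrongDual ℂ X}
    (hv : MemFBackward univ q B v v' z) {e : ℝ → X} {s t : ℝ} (hst : s ≤ t)
    (he : ContinuousOn e (Icc s t)) :
    IntervalIntegrable (fun r => (v' r + z r) (e r)) volume s t :=
  intervalIntegrable_bilin (L := pairing X) hst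
    ((hv.sobolev.isPrimitiveOn hq ordConnected_univ (mem_univ s) (mem_univ t) hst).1.add
      (MemLp.intervalIntegrable hq ordConnected_univ hv.memLp (mem_univ s) (mem_univ t) hst)) he

/-- Testing with cut-off functions localizes the weak formulation on the line. -/
theorem duality_of_hasCompactSupport (hq : 1 ≤ q) {d : ℝ → X} (hd : Continuous d)
    (h : ∀ v v' z : ℝ → StrongDual ℂ X, MemFBackward univ q B v v' z → HasCompactSupport v →
      ∫ r, (v' r + z r) (d r) = 0) {v v' z : ℝ → StrongDual ℂ X}
    (hv : MemFBackward univ q B v v' z) {s t : ℝ} (hst : s < t) :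
    v t (d t) - v s (d s) = ∫ r in s..t, (v' r + z r) (d r) := by
  set α : ℝ → ℂ := fun r => v r (d r) with hα
  set β : ℝ → ℂ := fun r => (v' r + z r) (d r) with hβ
  have hvc : Continuous v := continuousOn_univ.1 (hv.sobolev.continuousOn hq ordConnected_univ)
  have hαc : Continuous α := hvc.clm_apply hd
  have hβi : IntegrableOn β (Icc s (t + 1)) := by
    rw [← intervalIntegrable_iff_integrableOn_Icc_of_le (by linarith)]
    exact hv.intervalIntegrable_pairing hq (by linarith) hd.continuousOn
  have hβm : AEStronglyMeasurable β volume := by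
    have h1 := (hv.sobolev.2.1.add hv.memLp).1
    rw [Measure.restrict_univ] at h1
    exact (pairing X).aestronglyMeasurable_comp₂ h1 hd.aestronglyMeasurable
  -- A trapezoid that rises on `[s, s + h]`, falls on `[t, t + h]`, and tends pointwise to the
  -- indicator function of `(s, t]` as `h → 0`.
  set φ : ℝ → ℝ → ℝ := fun h r => ramp s h r - ramp t h r with hφ
  have hφm : ∀ {h : ℝ}, 0 < h → IsMultiplier (φ h) fun r =>
      (Ioc s (s + h)).indicator (fun _ => h⁻¹) r - (Ioc t (t + h)).indicator (fun _ => h⁻¹) r :=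
    fun hh => (isMultiplier_ramp s hh).sub (isMultiplier_ramp t hh)
  have hφ0 : ∀ {h r : ℝ}, 0 < h → r ∉ Icc s (t + h) → φ h r = 0 := by
    intro h r hh hr
    rcases lt_or_ge r s with h1 | h1
    · rw [hφ]; simp only [ramp_of_le hh h1.le, ramp_of_le hh (h1.trans hst).le, sub_zero]
    · have h2 : t + h ≤ r := by
        by_contra! h2
        exact hr ⟨h1, h2.le⟩
      rw [hφ]; simp only [ramp_of_ge hh h2, ramp_of_ge hh (by linarith : s + h ≤ r), sub_self]
  have hφ1 : ∀ {h : ℝ}, 0 < h → ∀ r, |φ h r| ≤ 1 := by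
    intro h hh r
    have := ramp_nonneg (a := s) hh r
    have := ramp_nonneg (a := t) hh r
    have := ramp_le_one (a := s) hh r
    have := ramp_le_one (a := t) hh r
    rw [hφ, abs_le]
    constructor <;> linarith
  have hbound : ∀ {h : ℝ}, 0 < h → h ≤ 1 → ∀ r, ‖φ h r • β r‖
      ≤ (Icc s (t + 1)).indicator (fun r => ‖β r‖) r := by
    intro h hh hh1 r
    by_cases hr : r ∈ Icc s (t + 1)
    · rw [indicator_of_mem hr, norm_smul]
      exact mul_le_of_le_one_left (norm_nonneg _) (hφ1 hh r)
    · rw [hφ0 hh fun h' => hr ⟨h'.1, h'.2.trans (by linarith)⟩, zero_smul, norm_zero]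
      exact indicator_nonneg (fun _ _ => norm_nonneg _) r
  have hbi : Integrable ((Icc s (t + 1)).indicator fun r => ‖β r‖) :=
    IntegrableOn.integrable_indicator hβi.norm measurableSet_Icc
  have hφβm : ∀ {h : ℝ}, 0 < h → AEStronglyMeasurable (fun r => φ h r • β r) volume :=
    fun hh => (hφm hh).measurable.aestronglyMeasurable.smul hβm
  -- Testing with `φ h • v`: the derivative of the cut-off contributes averages of `α` to the right
  -- of `s` and of `t`, which converge to the boundary values.
  have hid : ∀ {h : ℝ}, 0 < h → h ≤ 1 → h⁻¹ • (∫ r in s..(s + h), α r)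
      - h⁻¹ • (∫ r in t..(t + h), α r) + ∫ r, φ h r • β r = 0 := by
    intro τ hh hh1
    have h1 := h _ _ _ (hv.smul hq ordConnected_univ (hφm hh))
      (HasCompactSupport.intro (isCompact_Icc (a := s) (b := t + τ)) fun r hr => by
        rw [hφ0 hh hr]; exact zero_smul ℝ (v r))
    have hint : ∀ a : ℝ, Integrable ((Ioc a (a + τ)).indicator fun r => τ⁻¹ • α r) := fun a =>
      ((hαc.const_smul τ⁻¹).continuousOn.integrableOn_Icc.mono_set
        Ioc_subset_Icc_self).integrable_indicator measurableSet_Ioc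
    have hval : ∀ a : ℝ, ∫ r, (Ioc a (a + τ)).indicator (fun r => τ⁻¹ • α r) r
        = τ⁻¹ • ∫ r in a..(a + τ), α r := fun a => by
      rw [integral_indicator measurableSet_Ioc, intervalIntegral.integral_of_le (by linarith),
        integral_smul]
    have i3 : Integrable fun r => φ τ r • β r :=
      hbi.mono' (hφβm hh) (ae_of_all _ (hbound hh hh1))
    have i4 : Integrable fun r => (Ioc s (s + τ)).indicator (fun r => τ⁻¹ • α r) r
        - (Ioc t (t + τ)).indicator (fun r => τ⁻¹ • α r) r := (hint s).sub (hint t)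
    rw [← hval s, ← hval t, ← integral_sub (hint s) (hint t), ← integral_add i4 i3, ← h1]
    refine integral_congr_ae (ae_of_all _ fun r => ?_)
    have e : ∀ a : ℝ, (Ioc a (a + τ)).indicator (fun r => τ⁻¹ • α r) r
        = (Ioc a (a + τ)).indicator (fun _ => τ⁻¹) r • α r := fun a => by
      by_cases hr : r ∈ Ioc a (a + τ)
      · rw [indicator_of_mem hr, indicator_of_mem hr]
      · rw [indicator_of_notMem hr, indicator_of_notMem hr, zero_smul]
    beta_reduce
    rw [e s, e t]
    simp only [hα, hβ, add_apply, smul_apply, Complex.real_smul]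
    push_cast
    ring
  have havg : ∀ a : ℝ, Tendsto (fun h : ℝ => h⁻¹ • ∫ r in a..(a + h), α r) (𝓝[>] 0) (𝓝 (α a)) := by
    intro a
    have h1 : HasDerivAt (fun u => ∫ r in a..u, α r) (α a) a :=
      intervalIntegral.integral_hasDerivAt_right (by simp)
        hαc.aestronglyMeasurable.stronglyMeasurableAtFilter hαc.continuousAt
    simpa using h1.tendsto_slope_zero_right
  have hsmall : ∀ {δ : ℝ}, 0 < δ → ∀ᶠ h in 𝓝[>] (0:ℝ), 0 < h ∧ h ≤ δ := fun hδ => by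
    filter_upwards [self_mem_nhdsWithin, mem_nhdsWithin_of_mem_nhds (Iic_mem_nhds hδ)]
      with h h1 h2 using ⟨h1, h2⟩
  have hlim : Tendsto (fun h : ℝ => ∫ r, φ h r • β r) (𝓝[>] 0)
      (𝓝 (∫ r, (Ioc s t).indicator β r)) := by
    refine tendsto_integral_filter_of_dominated_convergence
      ((Icc s (t + 1)).indicator fun r => ‖β r‖) ?_ ?_ hbi (ae_of_all _ fun r => ?_)
    · filter_upwards [hsmall one_pos] with h hh using hφβm hh.1
    · filter_upwards [hsmall one_pos] with h hh using ae_of_all _ (hbound hh.1 hh.2)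
    · refine tendsto_const_nhds.congr' ?_
      rcases le_or_gt r s with h1 | h1
      · filter_upwards [hsmall one_pos] with h hh
        rw [indicator_of_notMem fun h' => absurd h'.1 (not_lt.2 h1), hφ]
        simp only [ramp_of_le hh.1 h1, ramp_of_le hh.1 (h1.trans hst.le), sub_zero, zero_smul]
      · rcases le_or_gt r t with h2 | h2
        · filter_upwards [hsmall (sub_pos.2 h1)] with h hh
          rw [indicator_of_mem (mem_Ioc.2 ⟨h1, h2⟩), hφ]
          simp only [ramp_of_ge hh.1 (by linarith [hh.2] : s + h ≤ r), ramp_of_le hh.1 h2, sub_zero,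
            one_smul]
        · filter_upwards [hsmall (sub_pos.2 h2)] with h hh
          rw [indicator_of_notMem fun h' => absurd h'.2 (not_le.2 h2), hφ]
          simp only [ramp_of_ge hh.1 (by linarith [hh.2] : s + h ≤ r),
            ramp_of_ge hh.1 (by linarith [hh.2] : t + h ≤ r), sub_self, zero_smul]
  have hzero : Tendsto (fun h : ℝ => h⁻¹ • (∫ r in s..(s + h), α r)
      - h⁻¹ • (∫ r in t..(t + h), α r) + ∫ r, φ h r • β r) (𝓝[>] 0) (𝓝 0) :=
    tendsto_const_nhds.congr' (by filter_upwards [hsmall one_pos] with h hh using (hid hh.1 hh.2).symm)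
  have key := tendsto_nhds_unique (((havg s).sub (havg t)).add hlim) hzero
  rw [integral_indicator measurableSet_Ioc, ← intervalIntegral.integral_of_le hst.le] at key
  linear_combination -key

/-- Starting at `-b`, left of the support of `v`, the two-sided orbit is a forward orbit, and both
boundary terms of the duality identity on `[-b, b]` vanish. -/
theorem IsGeneratedBy.isWeakSolutionOnLine [Fact (1 ≤ p)] {M w c : ℝ}
    (hS : IsSolvable univ p A M w c) (hq : 1 ≤ q) (hd : ∀ t, Dense ((A t).domain : Set X))
    {U : ℝ → ℝ → X →L[ℂ] X} (hU : IsGeneratedBy univ p A U) (hinv : IsInvertibleFamily univ U)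
    (s : ℝ) (x : X) : IsWeakSolutionOnLine q A s x (fun t => twoSided U t s x) := by
  have hcont : Continuous fun t => twoSided U t s x := by
    refine continuous_iff_continuousAt.2 fun t => ?_
    set r := min s t - 1 with hr
    have hrs : r ≤ s := by linarith [min_le_left s t]
    have hrt : r < t := by linarith [min_le_right s t]
    have h1 : ContinuousOn (fun t => U t r (Ring.inverse (U s r) x)) (Ici r) :=
      (hU.1.strongly_continuous _).comp (f := fun t => (t, r)) (by fun_prop)
        fun a ha => ⟨mem_univ _, mem_univ _, ha⟩
    refine (h1.continuousAt (Ici_mem_nhds hrt)).congr ?_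
    filter_upwards [Ici_mem_nhds hrt] with a ha
    rw [twoSided_apply hU.1 hinv hrs ha]
  refine ⟨hcont, by simp [twoSided, hU.1.refl s (mem_univ s)], fun v v' z hv hvs => ?_⟩
  obtain ⟨R, hR⟩ := hvs.isBounded.subset_closedBall 0
  have hR' : ∀ r, R < |r| → r ∉ tsupport v := fun r hr hm => by
    have := hR hm
    rw [mem_closedBall_zero_iff, Real.norm_eq_abs] at this
    linarith
  set b := |R| + |s| + 1 with hb
  have hbR : R < b := by linarith [le_abs_self R, abs_nonneg s]
  have hb0 : 0 < b := by positivity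
  have hbs : -b ≤ s := by linarith [neg_abs_le s, abs_nonneg R]
  have h1 : ∫ r, (v' r + z r) (twoSided U r s x)
      = ∫ r in Ioc (-b) b, (v' r + z r) (twoSided U r s x) := by
    refine (setIntegral_eq_integral_of_ae_compl_eq_zero ?_).symm
    filter_upwards [hv.ae_eq_zero hq] with r hr hrb
    rw [hr (hR' r (hbR.trans_le ?_))]
    · rfl
    · rw [le_abs']
      by_contra! hcon
      exact hrb ⟨hcon.1, hcon.2.le⟩
  have h2 := hU.duality hS hq (fun t _ => hd t) hv (mem_univ (-b)) (mem_univ b) (by linarith)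
    (Ring.inverse (U s (-b)) x)
  have h3 : ∫ r in (-b)..b, (v' r + z r) (U r (-b) (Ring.inverse (U s (-b)) x))
      = ∫ r in (-b)..b, (v' r + z r) (twoSided U r s x) := by
    refine intervalIntegral.integral_congr fun r hr => ?_
    rw [uIcc_of_le (by linarith)] at hr
    simp only [twoSided_apply hU.1 hinv hbs hr.1]
  rw [h1, ← intervalIntegral.integral_of_le (by linarith), ← h3, ← h2,
    image_eq_zero_of_notMem_tsupport (hR' b (by rwa [abs_of_pos hb0])),
    image_eq_zero_of_notMem_tsupport (hR' (-b) (by rwa [abs_neg, abs_of_pos hb0]))]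
  simp

/-- The localized identity for the difference `d` of two solutions gives `d = 0` to the right of
`s`, because `d s = 0`. To the left of `s` the value `d t` is unknown, and invertibility of `U` has
to recover it. -/
theorem IsWeakSolutionOnLine.eq [Fact (1 ≤ p)] {M w c : ℝ} (hS : IsSolvable univ p A M w c)
    (hq1 : 1 < q) (hq : q ≠ ⊤) (hd : ∀ t, Dense ((A t).domain : Set X))
    (hA' : BackwardAssumptions univ q fun t => adjoint (A t))
    {U : ℝ → ℝ → X →L[ℂ] X} (hU : IsGeneratedBy univ p A U) (hinv : IsInvertibleFamily univ U)
    {s : ℝ} {x : X} {u u₂ : ℝ → X} (hu : IsWeakSolutionOnLine q A s x u)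
    (hu₂ : IsWeakSolutionOnLine q A s x u₂) : u = u₂ := by
  obtain ⟨M', w', c', hwc', -, hK', -, hdr, -, -⟩ := hA'
  set d : ℝ → X := fun r => u r - u₂ r with hdd
  have hdc : Continuous d := hu.1.sub hu₂.1
  have hds : d s = 0 := by rw [hdd]; simp only [hu.2.1, hu₂.2.1, sub_self]
  have hforward : ∀ {a b : ℝ}, a < b → ∀ {e : ℝ → X}, ContinuousOn e (Icc a b) →
      (∀ v v' z : ℝ → StrongDual ℂ X, MemFBackward univ q (fun t => adjoint (A t)) v v' z →
        v b (e b) = ∫ r in a..b, (v' r + z r) (e r)) → EqOn e 0 (Icc a b) := by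
    intro a b hab e he h
    exact eqOn_zero_of_duality hq1.le ordConnected_univ (mem_univ a) (mem_univ b) hab
      (fun g hg hg0 ε hε => exists_backward_approx hq1 hq hK' hwc' hdr hg
        (fun r hr => hg0 r fun h => absurd h.2 (not_lt.2 hr)) hε) he h
  have hint : ∀ v v' z : ℝ → StrongDual ℂ X, MemFBackward univ q (fun t => adjoint (A t)) v v' z →
      HasCompactSupport v → ∫ r, (v' r + z r) (d r) = 0 := by
    intro v v' z hv hvs
    have hi : ∀ {k : ℝ → X}, Continuous k → Integrable fun r => (v' r + z r) (k r) := by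
      intro k hk
      obtain ⟨R, hR⟩ := hvs.isBounded.subset_closedBall 0
      rw [Real.closedBall_eq_Icc, zero_sub, zero_add] at hR
      have h1 : IntegrableOn (fun r => (v' r + z r) (k r)) (Icc (-|R|) |R|) := by
        rw [← intervalIntegrable_iff_integrableOn_Icc_of_le (by linarith [abs_nonneg R])]
        exact hv.intervalIntegrable_pairing hq1.le (by linarith [abs_nonneg R]) hk.continuousOn
      refine (h1.integrable_indicator measurableSet_Icc).congr ?_
      filter_upwards [hv.ae_eq_zero hq1.le] with r hr
      by_cases hm : r ∈ Icc (-|R|) |R|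
      · rw [indicator_of_mem hm]
      · rw [indicator_of_notMem hm, hr fun h => hm ?_]
        · rfl
        · exact ⟨(neg_le_neg (le_abs_self R)).trans (hR h).1, (hR h).2.trans (le_abs_self R)⟩
    rw [hdd]
    simp only [map_sub]
    rw [integral_sub (hi hu.1) (hi hu₂.1), hu.2.2 v v' z hv hvs, hu₂.2.2 v v' z hv hvs, sub_zero]
  have hloc := fun {v v' z : ℝ → StrongDual ℂ X}
    (hv : MemFBackward univ q (fun t => adjoint (A t)) v v' z) {a b : ℝ} (hab : a < b) =>
    duality_of_hasCompactSupport hq1.le hdc hint hv hab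
  suffices h0 : ∀ t, d t = 0 from funext fun t => sub_eq_zero.1 (h0 t)
  intro t
  rcases lt_trichotomy s t with h | rfl | h
  · refine hforward h hdc.continuousOn (fun v v' z hv => ?_) (right_mem_Icc.2 h.le)
    have := hloc hv h
    rwa [hds, map_zero, sub_zero] at this
  · exact hds
  · have hUc : ContinuousOn (fun r => U r t (d t)) (Icc t s) :=
      (hU.1.strongly_continuous (d t)).comp (f := fun r => (r, t)) (by fun_prop)
        fun r hr => ⟨mem_univ _, mem_univ _, hr.1⟩
    -- Subtracting the forward orbit of `d t` removes the boundary term at `t`, so `d r = U r t (d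
    -- t)` on `[t, s]`. At `r = s` this reads `U s t (d t) = 0`, and `U s t` is injective.
    have h1 : EqOn (fun r => d r - U r t (d t)) 0 (Icc t s) := by
      refine hforward h (hdc.continuousOn.sub hUc) fun v v' z hv => ?_
      have e1 := hloc hv h
      have e2 := hU.duality hS hq1.le (fun t _ => hd t) hv (mem_univ t) (mem_univ s) h.le (d t)
      simp only [map_sub]
      rw [intervalIntegral.integral_sub
        (hv.intervalIntegrable_pairing hq1.le h.le hdc.continuousOn)
        (hv.intervalIntegrable_pairing hq1.le h.le hUc), ← e1, ← e2]
      ring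
    have h2 : U s t (d t) = 0 := by
      have := h1 (right_mem_Icc.2 h.le)
      simp only [hds, zero_sub, Pi.zero_apply, neg_eq_zero] at this
      exact this
    have h3 := DFunLike.congr_fun
      (Ring.inverse_mul_cancel _ (hinv s (mem_univ _) t (mem_univ _) h.le)) (d t)
    rw [mul_apply_eq_comp, h2, map_zero] at h3
    exact h3.symm

end Line

end EvolutionEquation

/-! ### The main theorem -/

theorem mainTheorem8 {X : Type*} [NormedAddCommGroup X] [NormedSpace ℂ X] [CompleteSpace X]
    (hX : Function.Surjective (NormedSpace.inclusionInDoubleDual ℂ X))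
    (p q : ENNReal) [Fact (1 ≤ p)] (hp1 : 1 < p) (hp : p ≠ ⊤) (hpq : p.HolderConjugate q)
    (I : Set ℝ) (hI : EvolutionEquation.IsTimeInterval I)
    (A : ℝ → X →ₗ.[ℂ] X)
    (hA : EvolutionEquation.ForwardAssumptions I p A)
    (hA' : EvolutionEquation.BackwardAssumptions I q (fun t => EvolutionEquation.adjoint (A t))) :
    (∃ U : ℝ → ℝ → X →L[ℂ] X, EvolutionEquation.IsGeneratedBy I p A U) ∧
    ∀ U : ℝ → ℝ → X →L[ℂ] X, EvolutionEquation.IsGeneratedBy I p A U →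
      (∀ b : ℝ, IsGreatest I b → ∀ s ∈ I, ∀ x : X,
        EvolutionEquation.IsWeakSolution I q A s b x (fun t => U t s x) ∧
        ∀ u : ℝ → X, EvolutionEquation.IsWeakSolution I q A s b x u →
          Set.EqOn u (fun t => U t s x) (Set.Icc s b)) ∧
      (I = Set.univ → EvolutionEquation.IsInvertibleFamily I U → ∀ (s : ℝ) (x : X),
        EvolutionEquation.IsWeakSolutionOnLine q A s x
          (fun t => EvolutionEquation.twoSided U t s x) ∧
        ∀ u : ℝ → X, EvolutionEquation.IsWeakSolutionOnLine q A s x u →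
          u = fun t => EvolutionEquation.twoSided U t s x) := by
  obtain ⟨M, w, c, hS⟩ := hA.exists_isSolvable hI hp1 hp
  have hd : ∀ t ∈ I, Dense ((A t).domain : Set X) := by
    obtain ⟨-, -, -, -, h, -⟩ := hA
    exact fun t ht => (h t ht).dense_domain
  have hq : 1 ≤ q := ENNReal.HolderConjugate.one_le q p
  have hq1 : 1 < q := (ENNReal.HolderConjugate.lt_top_iff_one_lt p q).1 hp.lt_top
  have hqt : q ≠ ⊤ := ((ENNReal.HolderConjugate.lt_top_iff_one_lt q p).2 hp1).ne
  refine ⟨?_, fun U hU => ⟨fun b hb s hs x => ?_, ?_⟩⟩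
  · obtain ⟨V, hV⟩ := hS.exists_isPropagator
    exact ⟨_, hV.isGeneratedBy hS⟩
  · have h1 := hU.isWeakSolution hS hq hd hb hs x
    exact ⟨h1, fun u hu => hu.eqOn hq hI.ordConnected hA' hb hs h1⟩
  · rintro rfl hinv s x
    have hd' : ∀ t, Dense ((A t).domain : Set X) := fun t => hd t (Set.mem_univ t)
    have h1 := hU.isWeakSolutionOnLine hS hq hd' hinv s x
    exact ⟨h1, fun u hu => hu.eq hS hq1 hqt hd' hA' hU hinv h1⟩
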